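/- **Setting.** Work in the external-memory (I/O) model with cache size $M$ and line size $B$, $1\le B\le M$: main memory is divided into aligned lines of $B$ consecutive words, moving one line between main memory and the cache costs one I/O, and computation on the cache is free. A problem on finite, undirected, unweighted graphs with $n$ vertices and $m$ edges (given in main memory as a list of edges) is *solvable in $O(t(n,m,M,B))$ I/Os* if one fixed program, given $n,m,M,B$, returns a correct answer for all $1\le B\le M$ and all admissible inputs after $O(t(n,m,M,B))$ I/Os, using a cache of $O(M)$ words and words of $O(\log(n+m+M))$ bits. *Graph median*: given a connected graph $G=(V,E)$, return a vertex $v$ that minimizes $\sum_{u\in V} d(v,u)$. *3 vs 4 radius in sparse graphs*: given a graph $G=(V,E)$ with $|E|\le K|V|$, where $K$ is a constant, decide whether $\min_{u\in V}\max_{v\in V} d(u,v)\le 3$ (with $d(u,v)=\infty$ if $u$ and $v$ are not connected by a path). **Theorem.** Let $T(n,m,M,B)\ge 1$ be such that $T(n',m',M,B)=O(T(n,m,M,B))$ whenever $n\le n'=O(n)$ and $m\le m'=O(m)$, uniformly in $1\le B\le M$. Suppose graph median is solvable in $O(T(n,m,M,B))$ I/Os. Then, for every constant $K$, 3 vs 4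 radius in sparse graphs is solvable in $$O\!\left(T(n,m,M,B)+\frac{n^2}{MB}+\frac{m\log m}{B}\right)$$ I/Os, where $n=|V|$ and $m=|E|$, and where the program and the constants hidden in the $O$ may depend on $K$. -/

import Mathlib

namespace ExtMem

/-! The external-memory (I/O) model: a word RAM whose working memory is the cache, together with
an unbounded main memory that is cut into aligned lines of `B` consecutive words.  Computation on
the cache is free; moving one line between main memory and cache costs one I/O. -/

/-- Arithmetic expressions over the cache.  `cell e` is the content of the cache word whose address
is the value of `e`; subtraction is truncated, division and remainder are those of `ℕ`. -/
inductive Expr : Type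
  | const (k : ℕ) : Expr
  | cell (e : Expr) : Expr
  | add (e f : Expr) : Expr
  | sub (e f : Expr) : Expr
  | mul (e f : Expr) : Expr
  | div (e f : Expr) : Expr
  | mod (e f : Expr) : Expr

/-- The value of an expression, given the content of the cache. -/
def Expr.eval (cache : ℕ → ℕ) : Expr → ℕ
  | .const k => k
  | .cell e => cache (e.eval cache)
  | .add e f => e.eval cache + f.eval cache
  | .sub e f => e.eval cache - f.eval cache
  | .mul e f => e.eval cache * f.eval cache
  | .div e f => e.eval cache / f.eval cache
  | .mod e f => e.eval cache % f.eval cache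

/-- Programs.  `assign a e` stores the value of `e` in cache word `a`; `readLine p l` copies line `l`
of main memory to the cache words `p, …, p + B - 1`, and `writeLine p l` copies these cache words to
line `l` of main memory; `cond` and `loop` test whether an expression is nonzero. -/
inductive Prog : Type
  | skip : Prog
  | assign (a e : Expr) : Prog
  | readLine (p l : Expr) : Prog
  | writeLine (p l : Expr) : Prog
  | seq (P Q : Prog) : Prog
  | cond (e : Expr) (P Q : Prog) : Prog
  | loop (e : Expr) (P : Prog) : Prog

/-- A memory configuration: the words in the cache and the words in main memory. -/
structure State : Type where
  cache : ℕ → ℕ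
  mem : ℕ → ℕ

/-- The cache content after line `l` of main memory has been copied to position `p`. -/
def State.fetch (B : ℕ) (σ : State) (p l : ℕ) : State where
  cache := fun i => if p ≤ i ∧ i < p + B then σ.mem (l * B + (i - p)) else σ.cache i
  mem := σ.mem

/-- The main memory after `B` cache words from position `p` on have been copied to line `l`. -/
def State.flush (B : ℕ) (σ : State) (p l : ℕ) : State where
  cache := σ.cache
  mem := fun a => if l * B ≤ a ∧ a < l * B + B then σ.cache (p + (a - l * B)) else σ.mem a

/-- `Run B S W P σ k τ`: on the machine with lines of `B` words, a cache of `S` words and words with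
values below `W`, program `P` started in `σ` halts in `τ` after exactly `k` I/Os, never leaving the
cache, never storing a value that does not fit into a word, and never using a line number that does
not fit into a word. -/
inductive Run (B S W : ℕ) : Prog → State → ℕ → State → Prop
  | skip (σ : State) : Run B S W .skip σ 0 σ
  | assign (a e : Expr) (σ : State) (ha : a.eval σ.cache < S) (he : e.eval σ.cache < W) :
      Run B S W (.assign a e) σ 0
        ⟨Function.update σ.cache (a.eval σ.cache) (e.eval σ.cache), σ.mem⟩
  | readLine (p l : Expr) (σ : State) (hp : p.eval σ.cache + B ≤ S) (hl : l.eval σ.cache < W) :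
      Run B S W (.readLine p l) σ 1 (σ.fetch B (p.eval σ.cache) (l.eval σ.cache))
  | writeLine (p l : Expr) (σ : State) (hp : p.eval σ.cache + B ≤ S) (hl : l.eval σ.cache < W) :
      Run B S W (.writeLine p l) σ 1 (σ.flush B (p.eval σ.cache) (l.eval σ.cache))
  | seq {P Q : Prog} {σ τ ρ : State} {j k : ℕ} (hP : Run B S W P σ j τ) (hQ : Run B S W Q τ k ρ) :
      Run B S W (.seq P Q) σ (j + k) ρ
  | condTrue {e : Expr} {P Q : Prog} {σ τ : State} {k : ℕ} (he : e.eval σ.cache ≠ 0)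
      (hP : Run B S W P σ k τ) : Run B S W (.cond e P Q) σ k τ
  | condFalse {e : Expr} {P Q : Prog} {σ τ : State} {k : ℕ} (he : e.eval σ.cache = 0)
      (hQ : Run B S W Q σ k τ) : Run B S W (.cond e P Q) σ k τ
  | loopTrue {e : Expr} {P : Prog} {σ τ ρ : State} {j k : ℕ} (he : e.eval σ.cache ≠ 0)
      (hP : Run B S W P σ j τ) (hL : Run B S W (.loop e P) τ k ρ) :
      Run B S W (.loop e P) σ (j + k) ρ
  | loopFalse {e : Expr} {P : Prog} {σ : State} (he : e.eval σ.cache = 0) :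
      Run B S W (.loop e P) σ 0 σ

/-- The model is deterministic: the number of I/Os and the final state are determined by the
program and the initial state. -/
theorem Run.unique {B S W : ℕ} {P : Prog} {σ τ τ' : State} {k k' : ℕ}
    (h : Run B S W P σ k τ) (h' : Run B S W P σ k' τ') : k = k' ∧ τ = τ' := by
  induction h generalizing k' τ' with
  | skip => cases h'; exact ⟨rfl, rfl⟩
  | assign => cases h'; exact ⟨rfl, rfl⟩
  | readLine => cases h'; exact ⟨rfl, rfl⟩
  | writeLine => cases h'; exact ⟨rfl, rfl⟩
  | seq _ _ ih₁ ih₂ =>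
    cases h' with
    | seq a b =>
      obtain ⟨rfl, rfl⟩ := ih₁ a
      obtain ⟨rfl, rfl⟩ := ih₂ b
      exact ⟨rfl, rfl⟩
  | condTrue he _ ih =>
    cases h' with
    | condTrue _ a => exact ih a
    | condFalse hf _ => exact absurd hf he
  | condFalse he _ ih =>
    cases h' with
    | condTrue ht _ => exact absurd he ht
    | condFalse _ a => exact ih a
  | loopTrue he _ _ ih₁ ih₂ =>
    cases h' with
    | loopTrue _ a b =>
      obtain ⟨rfl, rfl⟩ := ih₁ a
      obtain ⟨rfl, rfl⟩ := ih₂ b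
      exact ⟨rfl, rfl⟩
    | loopFalse hf => exact absurd hf he
  | loopFalse he =>
    cases h' with
    | loopTrue ht _ _ => exact absurd he ht
    | loopFalse _ => exact ⟨rfl, rfl⟩

/-- `L` lists every edge of `G` exactly once, in any order and with its endpoints in any order. -/
def IsEdgeList {n : ℕ} (G : SimpleGraph (Fin n)) (L : List (Fin n × Fin n)) : Prop :=
  (L.map fun e => s(e.1, e.2)).Nodup ∧
    ∀ x : Sym2 (Fin n), x ∈ L.map (fun e => s(e.1, e.2)) ↔ x ∈ G.edgeSet

/-- The initial state on a graph with vertices `0, …, n - 1` and edge list `L`: main memory holds the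
endpoints of the listed edges one after the other and zeros behind them; the first four cache words
hold `n`, the number of edges, `M` and `B`, the other ones are zero. -/
def initState {n : ℕ} (L : List (Fin n × Fin n)) (M B : ℕ) : State where
  cache := fun i => [n, L.length, M, B].getD i 0
  mem := fun a => (L.flatMap fun e => [(e.1 : ℕ), (e.2 : ℕ)]).getD a 0

/-- A problem on finite undirected unweighted graphs is given by the admissible inputs and the
correct output words for each input.  It is solvable in `O(t(n, m, M, B))` I/Os if there are one
program and one constant `c` such that for all `1 ≤ B ≤ M` and each admissible input with `n` vertices
and `m` edges, the program halts with a correct output in cache word `0` after at most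
`c * t(n, m, M, B)` I/Os, on a machine with lines of `B` words, a cache of `c * M` words, and words of
`c * log (n + m + M + 2)` bits. -/
def SolvableIn (Admissible : (n : ℕ) → SimpleGraph (Fin n) → Prop)
    (Correct : (n : ℕ) → SimpleGraph (Fin n) → ℕ → Prop) (t : ℕ → ℕ → ℕ → ℕ → ℝ) : Prop :=
  ∃ (P : Prog) (c : ℕ), ∀ (M B : ℕ), 1 ≤ B → B ≤ M →
    ∀ (n : ℕ) (G : SimpleGraph (Fin n)) (L : List (Fin n × Fin n)),
      Admissible n G → IsEdgeList G L →
        ∃ (k : ℕ) (τ : State),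
          Run B (c * M) ((n + G.edgeSet.ncard + M + 2) ^ c) P (initState L M B) k τ ∧
            (k : ℝ) ≤ c * t n G.edgeSet.ncard M B ∧ Correct n G (τ.cache 0)

/-- Graph median: given a connected graph, return a vertex that minimizes the sum of the distances
to all vertices. -/
def MedianSolvableIn (t : ℕ → ℕ → ℕ → ℕ → ℝ) : Prop :=
  SolvableIn (fun _ G => G.Connected)
    (fun n G out => ∃ v : Fin n, (v : ℕ) = out ∧
      ∀ w : Fin n, ∑ u : Fin n, G.dist v u ≤ ∑ u : Fin n, G.dist w u) t

/-- 3 vs 4 radius in sparse graphs, for graphs with at most `K * n` edges: return `1` if the radius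
is at most `3`, and `0` if it is larger (which includes disconnected graphs). -/
def SparseRadiusSolvableIn (K : ℕ) (t : ℕ → ℕ → ℕ → ℕ → ℝ) : Prop :=
  SolvableIn (fun n G => G.edgeSet.ncard ≤ K * n)
    (fun _ G out => (G.radius ≤ 3 ∧ out = 1) ∨ (¬ G.radius ≤ 3 ∧ out = 0)) t

end ExtMem

/-!
Radius `3` versus `4` in a sparse graph `G` is decided with one median query.

**The gadget graph.** `gadget` consists of four copies `a, b, c, d` of the vertex set, consecutive
copies being joined along equal or adjacent vertices, and of auxiliary vertices. Every `a v` is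
adjacent to three hubs, each of which has many pendant vertices. A vertex outside the layer `a` loses
at least one unit of distance for every triple of pendant vertices (`seven_le_pendBound`), so a median
lies in the layer `a`. There the sum of the distances from `a v` is a constant minus
`2 * (ball1 v + ball2 v + ball3 v + e v)`, where `ball r` counts the vertices within distance `r`,
and `e v` is the number whose two digits in a base `Q` of order `√n` are encoded by the counter
vertices to which `a v` is joined (`distSum_a`). The digits are chosen such that
`ball1 v + ball2 v + e v = 2 * n`. A median `a v` therefore maximizes `ball3 v`, and the radius is at
most `3` iff `v` reaches all vertices within distance `3` (`radius_le_three_iff_of_median`). Two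
digits keep the gadget graph at `O(n)` vertices and `O(n + m)` edges.

**The computation around the query.** It consists of the numbers `ball1 v + ball2 v`, the edge list of
the gadget graph, and a breadth-first search of depth `3` from the vertex returned. The neighbours are
listed as `s = O(n + m)` numbers, the keys, which are sorted by computing the rank of each key. Every
task that is not a single scan is a nested loop: blocks of `min M s` keys are held in the cache, and
the whole list is streamed past each block. One such loop costs `O(s / M + 1)` scans of
`O(s / B + 1)` I/Os, which is `O(n ^ 2 / (M * B) + m / B + 1)` for `m = O(n)`
(`blocks_mul_lines_le`). For vertices at distance `2` it suffices to stream the sorted keys past the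
blocks, marking the keys of the block that share their second vertex with a streamed key; as the
blocks are sorted, each vertex is counted once when only the last vertex counted is remembered
(`Counted.step`).

**The machine.** Programs are written in a language `Cmd` with registers, two arrays of `M` words, and
files of which one line each is buffered. `Rep.compile` turns a command into a program of the model with
exactly as many I/Os as the configurations of the language count, and `Scan` bounds that number for
monotone access. The median program is run in a translated part of the cache and of the main memory
(`Shifted.run`, `call_run`), so that it finds the state it expects.

Graphs with fewer than `n - 1` edges are disconnected and are rejected at once; otherwise `n ≤ 2 * m`
unless `n ≤ 1`, and the sizes of the gadget graph are within a constant factor of `n` and `m`, as the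
scaling hypothesis on `T` requires.
-/

namespace ExtMem

/-! ### A structured language with files -/

/-- Arithmetic expressions over the registers of the structured language. -/
inductive AExpr : Type
  | const (k : ℕ) : AExpr
  | var (x : ℕ) : AExpr
  | add (e f : AExpr) : AExpr
  | sub (e f : AExpr) : AExpr
  | mul (e f : AExpr) : AExpr
  | div (e f : AExpr) : AExpr
  | mod (e f : AExpr) : AExpr

namespace AExpr

/-- The value of an expression, given the content of the registers. -/
def eval (v : ℕ → ℕ) : AExpr → ℕ
  | .const k => k
  | .var x => v x
  | .add e f => e.eval v + f.eval v
  | .sub e f => e.eval v - f.eval v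
  | .mul e f => e.eval v * f.eval v
  | .div e f => e.eval v / f.eval v
  | .mod e f => e.eval v % f.eval v

/-- The machine expression computing the same value: register `x` is kept in cache word `32 + x`. -/
def toExpr : AExpr → Expr
  | .const k => .const k
  | .var x => .cell (.const (32 + x))
  | .add e f => .add e.toExpr f.toExpr
  | .sub e f => .sub e.toExpr f.toExpr
  | .mul e f => .mul e.toExpr f.toExpr
  | .div e f => .div e.toExpr f.toExpr
  | .mod e f => .mod e.toExpr f.toExpr

/-- Whether only registers below `32` occur; these are the registers that have a cache word. -/
def wf : AExpr → Bool
  | .const _ => true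
  | .var x => decide (x < 32)
  | .add e f | .sub e f | .mul e f | .div e f | .mod e f => e.wf && f.wf

/-- `lt e f` is nonzero iff the value of `e` is less than that of `f`. -/
def lt (e f : AExpr) : AExpr := .sub f e

/-- `eq e f` is nonzero iff `e` and `f` have the same value. -/
def eq (e f : AExpr) : AExpr := .sub (.const 1) (.add (.sub e f) (.sub f e))

/-- Literals stand for constant expressions. -/
instance (k : ℕ) : OfNat AExpr k := ⟨.const k⟩
/-- Sums of expressions. -/
instance : Add AExpr := ⟨.add⟩
/-- Truncated differences of expressions. -/
instance : Sub AExpr := ⟨.sub⟩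
/-- Products of expressions. -/
instance : Mul AExpr := ⟨.mul⟩
/-- Quotients of expressions. -/
instance : Div AExpr := ⟨.div⟩
/-- Remainders of expressions. -/
instance : Mod AExpr := ⟨.mod⟩

section simps
variable (v : ℕ → ℕ) (e f : AExpr) (k : ℕ)
@[simp] theorem eval_ofNat : (ofNat(k) : AExpr).eval v = OfNat.ofNat k := rfl
@[simp] theorem eval_var : (AExpr.var k).eval v = v k := rfl
@[simp] theorem eval_add : (e + f).eval v = e.eval v + f.eval v := rfl
@[simp] theorem eval_sub : (e - f).eval v = e.eval v - f.eval v := rfl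
@[simp] theorem eval_mul : (e * f).eval v = e.eval v * f.eval v := rfl
@[simp] theorem eval_div : (e / f).eval v = e.eval v / f.eval v := rfl
@[simp] theorem eval_mod : (e % f).eval v = e.eval v % f.eval v := rfl
theorem eval_lt_eq_zero : (lt e f).eval v = 0 ↔ ¬ e.eval v < f.eval v := by
  simp only [lt, eval]; omega
theorem eval_eq_eq_zero : (eq e f).eval v = 0 ↔ ¬ e.eval v = f.eval v := by
  simp only [eq, eval]; omega
end simps

end AExpr

/-- The parameters that the structured language depends on: block length `M` of its two arrays, line
length `B`, capacity `Z` of its files, and word bound `W`. -/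
structure Par : Type where
  M : ℕ
  B : ℕ
  Z : ℕ
  W : ℕ

/-- Configurations of the structured language: registers, arrays of `M` words in the cache, and files
in main memory.  For every file one line is buffered; `tag f` is its number, and `io f` counts the
I/Os spent on file `f`.  `ok` records that every index and every stored value was in range. -/
structure AState : Type where
  v : ℕ → ℕ
  arr : ℕ → ℕ → ℕ
  file : ℕ → ℕ → ℕ
  tag : ℕ → ℕ
  io : ℕ → ℕ
  ok : Prop

/-- Store `k` in register `x`. -/
def AState.setv (a : AState) (p : Par) (x k : ℕ) : AState :=
  { a with v := Function.update a.v x k, ok := a.ok ∧ k < p.W }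

/-- Store `k` at index `i` of array `b`. -/
def AState.setArr (a : AState) (p : Par) (b i k : ℕ) : AState :=
  { a with
    arr := Function.update a.arr b (Function.update (a.arr b) i k)
    ok := a.ok ∧ i < p.M ∧ k < p.W }

/-- Bring the line containing word `i` of file `f` into the buffer of that file.  If another line is
buffered, that one is written back first, so that a miss costs two I/Os. -/
def AState.touch (a : AState) (p : Par) (f i : ℕ) : AState :=
  { a with
    tag := Function.update a.tag f (i / p.B)
    io := Function.update a.io f (a.io f + if a.tag f = i / p.B then 0 else 2)
    ok := a.ok ∧ i < p.Z }

/-- Store `k` at index `i` of file `f`. -/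
def AState.setFile (a : AState) (p : Par) (f i k : ℕ) : AState :=
  { a with
    file := Function.update a.file f (Function.update (a.file f) i k)
    ok := a.ok ∧ k < p.W }

/-- Add a condition to `ok`. -/
def AState.require (a : AState) (c : Prop) : AState := { a with ok := a.ok ∧ c }

/-- The structured language.  `get` and `put` access the arrays, `read` and `write` the files;
`iter x y c` runs `c` with register `x` equal to `0, 1, …` below the value of register `y`. -/
inductive Cmd : Type
  | skip : Cmd
  | set (x : ℕ) (e : AExpr) : Cmd
  | get (x b : ℕ) (i : AExpr) : Cmd
  | put (b : ℕ) (i e : AExpr) : Cmd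
  | read (x f : ℕ) (i : AExpr) : Cmd
  | write (f : ℕ) (i e : AExpr) : Cmd
  | seq (c d : Cmd) : Cmd
  | ite (e : AExpr) (c d : Cmd) : Cmd
  | iter (x y : ℕ) (c : Cmd) : Cmd

/-- Sequential composition of commands. -/
infixr:60 " ;; " => Cmd.seq

/-- `loopN f N a` is the result of the steps `f 0, …, f (N - 1)`. -/
def loopN (f : ℕ → AState → AState) (N : ℕ) (a : AState) : AState :=
  Nat.rec a (fun i s => f i s) N

@[simp] theorem loopN_succ (f : ℕ → AState → AState) (N : ℕ) (a : AState) :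
    loopN f (N + 1) a = f N (loopN f N a) := rfl

namespace Cmd

open Classical in
/-- The semantics of commands. -/
noncomputable def exec (p : Par) : Cmd → AState → AState
  | .skip, a => a
  | .set x e, a => a.setv p x (e.eval a.v)
  | .get x b i, a => (a.require (i.eval a.v < p.M)).setv p x (a.arr b (i.eval a.v))
  | .put b i e, a => a.setArr p b (i.eval a.v) (e.eval a.v)
  | .read x f i, a => (a.touch p f (i.eval a.v)).setv p x (a.file f (i.eval a.v))
  | .write f i e, a => (a.touch p f (i.eval a.v)).setFile p f (i.eval a.v) (e.eval a.v)
  | .seq c d, a => d.exec p (c.exec p a)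
  | .ite e c d, a => if e.eval a.v ≠ 0 then c.exec p a else d.exec p a
  | .iter x y c, a => (loopN (fun i s => c.exec p (s.setv p x i)) (a.v y) a).setv p x (a.v y)

theorem exec_seq (p : Par) (c d : Cmd) (a : AState) :
    (c ;; d).exec p a = d.exec p (c.exec p a) := rfl

theorem exec_ite_of_ne {p : Par} {e : AExpr} {a : AState} (h : e.eval a.v ≠ 0) (c d : Cmd) :
    (Cmd.ite e c d).exec p a = c.exec p a := if_pos h

theorem exec_ite_of_eq {p : Par} {e : AExpr} {a : AState} (h : e.eval a.v = 0) (c d : Cmd) :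
    (Cmd.ite e c d).exec p a = d.exec p a := if_neg (not_not.2 h)

/-- Whether a command may change register `x`. -/
def writesVar (x : ℕ) : Cmd → Bool
  | .set y _ | .get y _ _ | .read y _ _ => x == y
  | .skip | .put _ _ _ | .write _ _ _ => false
  | .seq c d | .ite _ c d => c.writesVar x || d.writesVar x
  | .iter y _ c => x == y || c.writesVar x

/-- Whether a command may change array `b`. -/
def writesArr (b : ℕ) : Cmd → Bool
  | .put b' _ _ => b == b'
  | .skip | .set _ _ | .get _ _ _ | .read _ _ _ | .write _ _ _ => false
  | .seq c d | .ite _ c d => c.writesArr b || d.writesArr b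
  | .iter _ _ c => c.writesArr b

/-- Whether a command may change the content of file `f`. -/
def writesFile (f : ℕ) : Cmd → Bool
  | .write g _ _ => f == g
  | .skip | .set _ _ | .get _ _ _ | .read _ _ _ | .put _ _ _ => false
  | .seq c d | .ite _ c d => c.writesFile f || d.writesFile f
  | .iter _ _ c => c.writesFile f

/-- Whether a command may access file `f`. -/
def usesFile (f : ℕ) : Cmd → Bool
  | .write g _ _ | .read _ g _ => f == g
  | .skip | .set _ _ | .get _ _ _ | .put _ _ _ => false
  | .seq c d | .ite _ c d => c.usesFile f || d.usesFile f
  | .iter _ _ c => c.usesFile f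

/-- Well-formedness: registers, arrays and files (of which there are `nf`) exist, and loop bodies
change neither the counter nor the bound. -/
def wf (nf : ℕ) : Cmd → Bool
  | .skip => true
  | .set x e => decide (x < 32) && e.wf
  | .get x b i => decide (x < 32) && decide (b < 2) && i.wf
  | .put b i e => decide (b < 2) && i.wf && e.wf
  | .read x f i => decide (x < 32) && decide (f < nf) && i.wf
  | .write f i e => decide (f < nf) && i.wf && e.wf
  | .seq c d => c.wf nf && d.wf nf
  | .ite e c d => e.wf && c.wf nf && d.wf nf
  | .iter x y c => decide (x < 32) && decide (y < 32) && (x != y) && c.wf nf &&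
      !c.writesVar x && !c.writesVar y

theorem exec_frame_v (p : Par) (x : ℕ) : ∀ (c : Cmd) (a : AState), c.writesVar x = false →
    (c.exec p a).v x = a.v x := by
  intro c
  induction c with
  | skip => intros; rfl
  | set | get | read =>
    intro a h
    simp only [writesVar, beq_eq_false_iff_ne] at h
    simp [exec, AState.setv, AState.require, AState.touch, h]
  | put | write => intros; rfl
  | seq c d hc hd =>
    intro a h
    simp only [writesVar, Bool.or_eq_false_iff] at h
    simp [exec, hd _ h.2, hc _ h.1]
  | ite e c d hc hd =>
    intro a h
    simp only [writesVar, Bool.or_eq_false_iff] at h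
    simp only [exec]; split_ifs
    · exact hc _ h.1
    · exact hd _ h.2
  | iter y z c hc =>
    intro a h
    simp only [writesVar, Bool.or_eq_false_iff, beq_eq_false_iff_ne] at h
    simp only [exec, AState.setv, Function.update_of_ne h.1]
    generalize a.v z = N
    induction N with
    | zero => rfl
    | succ N ih => simp only [loopN_succ]; rw [hc _ h.2]; simpa [h.1] using ih

theorem exec_frame_arr (p : Par) (b : ℕ) : ∀ (c : Cmd) (a : AState), c.writesArr b = false →
    (c.exec p a).arr b = a.arr b := by
  intro c
  induction c with
  | put =>
    intro a h
    simp only [writesArr, beq_eq_false_iff_ne] at h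
    simp [exec, AState.setArr, h]
  | skip | set | get | read | write => intros; rfl
  | seq c d hc hd =>
    intro a h
    simp only [writesArr, Bool.or_eq_false_iff] at h
    simp [exec, hd _ h.2, hc _ h.1]
  | ite e c d hc hd =>
    intro a h
    simp only [writesArr, Bool.or_eq_false_iff] at h
    simp only [exec]; split_ifs
    · exact hc _ h.1
    · exact hd _ h.2
  | iter y z c hc =>
    intro a h
    simp only [writesArr] at h
    simp only [exec, AState.setv]
    generalize a.v z = N
    induction N with
    | zero => rfl
    | succ N ih => simp only [loopN_succ]; rw [hc _ h]; exact ih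

theorem exec_frame_file (p : Par) (f : ℕ) : ∀ (c : Cmd) (a : AState), c.writesFile f = false →
    (c.exec p a).file f = a.file f := by
  intro c
  induction c with
  | write =>
    intro a h
    simp only [writesFile, beq_eq_false_iff_ne] at h
    simp [exec, AState.setFile, AState.touch, h]
  | skip | set | get | read | put => intros; rfl
  | seq c d hc hd =>
    intro a h
    simp only [writesFile, Bool.or_eq_false_iff] at h
    simp [exec, hd _ h.2, hc _ h.1]
  | ite e c d hc hd =>
    intro a h
    simp only [writesFile, Bool.or_eq_false_iff] at h
    simp only [exec]; split_ifs
    · exact hc _ h.1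
    · exact hd _ h.2
  | iter y z c hc =>
    intro a h
    simp only [writesFile] at h
    simp only [exec, AState.setv]
    generalize a.v z = N
    induction N with
    | zero => rfl
    | succ N ih => simp only [loopN_succ]; rw [hc _ h]; exact ih

theorem exec_frame_io (p : Par) (f : ℕ) : ∀ (c : Cmd) (a : AState), c.usesFile f = false →
    (c.exec p a).io f = a.io f ∧ (c.exec p a).tag f = a.tag f := by
  intro c
  induction c with
  | write | read =>
    intro a h
    simp only [usesFile, beq_eq_false_iff_ne] at h
    simp [exec, AState.setv, AState.setFile, AState.touch, h]
  | skip | set | get | put => intros; exact ⟨rfl, rfl⟩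
  | seq c d hc hd =>
    intro a h
    simp only [usesFile, Bool.or_eq_false_iff] at h
    simp [exec, hd _ h.2, hc _ h.1]
  | ite e c d hc hd =>
    intro a h
    simp only [usesFile, Bool.or_eq_false_iff] at h
    simp only [exec]; split_ifs
    · exact hc _ h.1
    · exact hd _ h.2
  | iter y z c hc =>
    intro a h
    simp only [usesFile] at h
    simp only [exec, AState.setv]
    generalize a.v z = N
    induction N with
    | zero => exact ⟨rfl, rfl⟩
    | succ N ih => simp only [loopN_succ]; rw [(hc _ h).1, (hc _ h).2]; exact ih

theorem exec_ok_mono (p : Par) : ∀ (c : Cmd) (a : AState), (c.exec p a).ok → a.ok := by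
  intro c
  induction c with
  | write | read | skip | set | get | put =>
    intro a h
    simp only [exec, AState.setv, AState.setFile, AState.touch, AState.require,
      AState.setArr] at h
    tauto
  | seq c d hc hd => intro a h; exact hc _ (hd _ h)
  | ite e c d hc hd =>
    intro a h
    simp only [exec] at h; split_ifs at h
    · exact hc _ h
    · exact hd _ h
  | iter y z c hc =>
    intro a h
    simp only [exec, AState.setv] at h
    replace h := h.1
    generalize a.v z = N at h
    induction N with
    | zero => exact h
    | succ N ih =>
      simp only [loopN_succ] at h
      have := hc _ h
      exact ih this.1

/-- Induction principle for loops. -/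
theorem exec_for (p : Par) {x y N : ℕ} {c : Cmd} {a : AState} (I : ℕ → AState → Prop)
    (hN : a.v y = N) (h0 : I 0 a)
    (hs : ∀ i s, i < N → I i s → I (i + 1) (c.exec p (s.setv p x i))) :
    ∃ s, I N s ∧ (Cmd.iter x y c).exec p a = s.setv p x N := by
  subst hN
  refine ⟨_, ?_, rfl⟩
  have : ∀ N ≤ a.v y, I N (loopN (fun i s => c.exec p (s.setv p x i)) N a) := by
    intro N hN
    induction N with
    | zero => exact h0
    | succ N ih => exact hs N _ hN (ih (by omega))
  exact this _ le_rfl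

end Cmd

/-! ### Compilation to machine programs -/

/-- The cache word holding the line length. -/
def eB : Expr := .cell (.const 3)
/-- The cache word holding the cache size, which is also the length of an array. -/
def eM : Expr := .cell (.const 2)
/-- The cache word holding the capacity of a file. -/
def eZ : Expr := .cell (.const 4)
/-- The cache word holding the number of the buffered line of file `f`. -/
def eTag (f : ℕ) : Expr := .cell (.const (8 + f))
/-- The cache address of array `b`. -/
def eArr (b : ℕ) : Expr := .add (.const 64) (.mul (.const b) eM)
/-- The main memory line with number `eTag f` in file `f`. -/
def eLine (f : ℕ) : Expr := .add (.mul (.const f) eZ) (eTag f)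

/-- Bring the line of file `f` that contains word `i` into the buffer, unless it is there. -/
def seek (f : ℕ) (i : Expr) : Prog :=
  .cond (.add (.sub (.div i eB) (eTag f)) (.sub (eTag f) (.div i eB)))
    (.seq (.writeLine (eArr (2 + f)) (eLine f))
      (.seq (.assign (.const (8 + f)) (.div i eB)) (.readLine (eArr (2 + f)) (eLine f))))
    .skip

/-- The machine program for a command.  The buffer of file `f` is placed like an array with number
`2 + f`. -/
def Cmd.compile : Cmd → Prog
  | .skip => .skip
  | .set x e => .assign (.const (32 + x)) e.toExpr
  | .get x b i => .assign (.const (32 + x)) (.cell (.add (eArr b) i.toExpr))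
  | .put b i e => .assign (.add (eArr b) i.toExpr) e.toExpr
  | .read x f i => .seq (seek f i.toExpr)
      (.assign (.const (32 + x)) (.cell (.add (eArr (2 + f)) (.mod i.toExpr eB))))
  | .write f i e => .seq (seek f i.toExpr)
      (.assign (.add (eArr (2 + f)) (.mod i.toExpr eB)) e.toExpr)
  | .seq c d => .seq c.compile d.compile
  | .ite e c d => .cond e.toExpr c.compile d.compile
  | .iter x y c => .seq (.assign (.const (32 + x)) (.const 0))
      (.loop (.sub (.cell (.const (32 + y))) (.cell (.const (32 + x))))
        (.seq c.compile
          (.assign (.const (32 + x)) (.add (.cell (.const (32 + x))) (.const 1)))))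

/-- The machine state `σ` represents the configuration `a` with its first `nf` files.  File `f`
occupies the lines `f * Z, …, f * Z + Z - 1` of main memory, where the buffered line may be out of
date.  The functions `h` and `g` give the cache words behind the buffers and the main memory words
behind the files. -/
structure Rep (p : Par) (nf : ℕ) (h g : ℕ → ℕ) (a : AState) (σ : State) : Prop where
  cM : σ.cache 2 = p.M
  cB : σ.cache 3 = p.B
  cZ : σ.cache 4 = p.Z
  cOff : σ.cache 5 = 64 + 12 * p.M
  cMed : σ.cache 6 = 9 * p.Z
  v : ∀ x < 32, σ.cache (32 + x) = a.v x
  tag : ∀ f < nf, σ.cache (8 + f) = a.tag f ∧ a.tag f < p.Z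
  arr : ∀ b < 2, ∀ j < p.M, σ.cache (64 + b * p.M + j) = a.arr b j
  buf : ∀ f < nf, ∀ j < p.B, σ.cache (64 + (2 + f) * p.M + j) = a.file f (a.tag f * p.B + j)
  mem : ∀ f < nf, ∀ l < p.Z, ∀ j < p.B, l ≠ a.tag f →
    σ.mem ((f * p.Z + l) * p.B + j) = a.file f (l * p.B + j)
  high : ∀ i, 64 + 12 * p.M ≤ i → σ.cache i = h i
  far : ∀ i, nf * p.Z * p.B ≤ i → σ.mem i = g i

section rep
variable {p : Par} {nf : ℕ} {h g : ℕ → ℕ} {a : AState} {σ : State}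

theorem mul_add_inj {M b b' j j' : ℕ} (hj : j < M) (hj' : j' < M)
    (e : b * M + j = b' * M + j') : b = b' ∧ j = j' := by
  have h0 : 0 < M := by omega
  have h1 : (b * M + j) / M = b := by
    rw [mul_comm, Nat.mul_add_div h0, Nat.div_eq_of_lt hj, add_zero]
  have h2 : (b' * M + j') / M = b' := by
    rw [mul_comm, Nat.mul_add_div h0, Nat.div_eq_of_lt hj', add_zero]
  have : b = b' := by rw [← h1, ← h2, e]
  subst this
  exact ⟨rfl, by omega⟩

theorem Rep.eval (r : Rep p nf h g a σ) {e : AExpr} (he : e.wf = true) :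
    e.toExpr.eval σ.cache = e.eval a.v := by
  induction e with
  | const => rfl
  | var x => exact r.v x (by simpa [AExpr.wf] using he)
  | add e f ihe ihf | sub e f ihe ihf | mul e f ihe ihf | div e f ihe ihf | mod e f ihe ihf =>
    simp only [AExpr.wf, Bool.and_eq_true] at he
    simp [AExpr.toExpr, AExpr.eval, Expr.eval, ihe he.1, ihf he.2]

theorem cache_update_ne {c m : ℕ → ℕ} {q k i : ℕ} (hi : i ≠ q) :
    (⟨Function.update c q k, m⟩ : State).cache i = c i := Function.update_of_ne hi _ _

theorem Rep.setv (r : Rep p nf h g a σ) (hnf : nf ≤ 10) {x k : ℕ} (hx : x < 32) :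
    Rep p nf h g (a.setv p x k) ⟨Function.update σ.cache (32 + x) k, σ.mem⟩ where
  cM := by rw [cache_update_ne (by omega)]; exact r.cM
  cB := by rw [cache_update_ne (by omega)]; exact r.cB
  cZ := by rw [cache_update_ne (by omega)]; exact r.cZ
  cOff := by rw [cache_update_ne (by omega)]; exact r.cOff
  cMed := by rw [cache_update_ne (by omega)]; exact r.cMed
  v y hy := by
    simp only [AState.setv, Function.update_apply, Nat.add_left_cancel_iff]
    split_ifs
    · rfl
    · exact r.v y hy
  tag f hf := by
    rw [cache_update_ne (by omega)]; exact r.tag f hf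
  arr b hb j hj := by
    rw [cache_update_ne (by omega)]; exact r.arr b hb j hj
  buf f hf j hj := by
    rw [cache_update_ne (by omega)]; exact r.buf f hf j hj
  mem := r.mem
  high i hi := by
    rw [cache_update_ne (by omega)]; exact r.high i hi
  far := r.far

theorem Rep.require (r : Rep p nf h g a σ) {c : Prop} : Rep p nf h g (a.require c) σ :=
  ⟨r.cM, r.cB, r.cZ, r.cOff, r.cMed, r.v, r.tag, r.arr, r.buf, r.mem, r.high, r.far⟩

theorem Rep.setArr (r : Rep p nf h g a σ) (hnf : nf ≤ 10) (hBM : p.B ≤ p.M) {b i k : ℕ}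
    (hb : b < 2) (hi : i < p.M) :
    Rep p nf h g (a.setArr p b i k)
      ⟨Function.update σ.cache (64 + b * p.M + i) k, σ.mem⟩ where
  cM := by rw [cache_update_ne (by omega)]; exact r.cM
  cB := by rw [cache_update_ne (by omega)]; exact r.cB
  cZ := by rw [cache_update_ne (by omega)]; exact r.cZ
  cOff := by rw [cache_update_ne (by omega)]; exact r.cOff
  cMed := by rw [cache_update_ne (by omega)]; exact r.cMed
  v y hy := by rw [cache_update_ne (by omega)]; exact r.v y hy
  tag f hf := by rw [cache_update_ne (by omega)]; exact r.tag f hf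
  arr b' hb' j hj := by
    simp only [AState.setArr, Function.update_apply]
    by_cases e : b' = b
    · subst e
      simp only [if_true, Nat.add_left_cancel_iff, Function.update_apply]
      split_ifs
      · rfl
      · exact r.arr b' hb' j hj
    · rw [if_neg, if_neg e]
      · exact r.arr b' hb' j hj
      · intro e'
        exact e (mul_add_inj hj hi (by omega)).1
  buf f hf j hj := by
    rw [cache_update_ne]
    · exact r.buf f hf j hj
    · intro e'
      have := (mul_add_inj (lt_of_lt_of_le hj hBM) hi (b := 2 + f) (b' := b) (by omega)).1
      omega
  mem := r.mem
  high i' hi' := by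
    rw [cache_update_ne]
    · exact r.high i' hi'
    · have : b * p.M ≤ 1 * p.M := Nat.mul_le_mul_right _ (by omega)
      omega
  far := r.far

theorem Rep.setFile (r : Rep p nf h g a σ) (hnf : nf ≤ 10) (hB : 0 < p.B) (hBM : p.B ≤ p.M)
    {f i k : ℕ} (hf : f < nf) (ht : a.tag f = i / p.B) :
    Rep p nf h g (a.setFile p f i k)
      ⟨Function.update σ.cache (64 + (2 + f) * p.M + i % p.B) k, σ.mem⟩ := by
  have hlow : 64 + 2 * p.M ≤ 64 + (2 + f) * p.M + i % p.B := by
    have : 2 * p.M ≤ (2 + f) * p.M := Nat.mul_le_mul_right _ (by omega)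
    omega
  have hmod := Nat.mod_lt i hB
  have hi : i = a.tag f * p.B + i % p.B := by rw [ht, mul_comm]; exact (Nat.div_add_mod _ _).symm
  refine ⟨?_, ?_, ?_, ?_, ?_, ?_, ?_, ?_, ?_, ?_, ?_, r.far⟩
  · rw [cache_update_ne (by omega)]; exact r.cM
  · rw [cache_update_ne (by omega)]; exact r.cB
  · rw [cache_update_ne (by omega)]; exact r.cZ
  · rw [cache_update_ne (by omega)]; exact r.cOff
  · rw [cache_update_ne (by omega)]; exact r.cMed
  · intro y hy; rw [cache_update_ne (by omega)]; exact r.v y hy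
  · intro f' hf'; rw [cache_update_ne (by omega)]; exact r.tag f' hf'
  · intro b hb j hj
    have : b * p.M ≤ 1 * p.M := Nat.mul_le_mul_right _ (by omega)
    rw [cache_update_ne (by omega)]; exact r.arr b hb j hj
  · intro f' hf' j hj
    simp only [AState.setFile, Function.update_apply]
    by_cases e : f' = f
    · subst e
      simp only [if_true, Nat.add_left_cancel_iff, Function.update_apply]
      by_cases e2 : j = i % p.B
      · rw [if_pos e2, if_pos (by omega)]
      · rw [if_neg e2, if_neg (by omega)]; exact r.buf f' hf' j hj
    · rw [if_neg, if_neg e]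
      · exact r.buf f' hf' j hj
      · intro e'
        have := (mul_add_inj (b := 2 + f') (b' := 2 + f) (lt_of_lt_of_le hj hBM)
          (lt_of_lt_of_le hmod hBM) (by omega)).1
        omega
  · intro f' hf' l hl j hj hne
    simp only [AState.setFile, Function.update_apply] at hne ⊢
    by_cases e : f' = f
    · subst e
      simp only [if_true, Function.update_apply]
      rw [if_neg]
      · exact r.mem f' hf' l hl j hj hne
      · intro e'
        exact hne (mul_add_inj hj hmod (e'.trans hi)).1
    · rw [if_neg e]; exact r.mem f' hf' l hl j hj hne
  · intro i' hi'
    rw [cache_update_ne]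
    · exact r.high i' hi'
    · have : (2 + f) * p.M ≤ 11 * p.M := Nat.mul_le_mul_right _ (by omega)
      omega

theorem Rep.eval_eArr (r : Rep p nf h g a σ) (b : ℕ) :
    (eArr b).eval σ.cache = 64 + b * p.M := by
  simp only [eArr, eM, Expr.eval, r.cM]

theorem Rep.eval_eLine (r : Rep p nf h g a σ) {f : ℕ} (hf : f < nf) :
    (eLine f).eval σ.cache = f * p.Z + a.tag f := by
  simp only [eLine, eZ, eTag, Expr.eval, r.cZ, (r.tag f hf).1]

/-- The cost of bringing word `i` of file `f` into the buffer. -/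
def AState.missCost (a : AState) (p : Par) (f i : ℕ) : ℕ := if a.tag f = i / p.B then 0 else 2

theorem Rep.seek (r : Rep p nf h g a σ) (hnf : nf ≤ 10) (hB : 0 < p.B) (hBM : p.B ≤ p.M)
    {S : ℕ} (hS : 64 + 12 * p.M ≤ S) (hW : 10 * p.Z ≤ p.W)
    {f : ℕ} (hf : f < nf) {i : AExpr} (hi : i.wf = true) (hZ : i.eval a.v < p.Z) :
    ∃ τ, Run p.B S p.W (seek f i.toExpr) σ (a.missCost p f (i.eval a.v)) τ ∧
      Rep p nf h g (a.touch p f (i.eval a.v)) τ := by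
  set k := i.eval a.v with hk
  have hev := r.eval hi
  have hZ' : k / p.B < p.Z := lt_of_le_of_lt (Nat.div_le_self _ _) hZ
  have hbufle : 64 + (2 + f) * p.M + p.B ≤ S := by
    have : (2 + f) * p.M ≤ 11 * p.M := Nat.mul_le_mul_right _ (by omega)
    omega
  have hline : ∀ t, t < p.Z → f * p.Z + t < p.W := by
    intro t ht
    have : f * p.Z ≤ 9 * p.Z := Nat.mul_le_mul_right _ (by omega)
    omega
  have hlow : 64 + 2 * p.M ≤ 64 + (2 + f) * p.M := by
    have : 2 * p.M ≤ (2 + f) * p.M := Nat.mul_le_mul_right _ (by omega)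
    omega
  by_cases ht : a.tag f = k / p.B
  · refine ⟨σ, ?_, ?_⟩
    · rw [AState.missCost, if_pos ht]
      refine Run.condFalse ?_ (Run.skip σ)
      simp only [Expr.eval, eB, eTag, r.cB, (r.tag f hf).1, hev, ← hk, ht]
      omega
    · have e1 : Function.update a.tag f (k / p.B) = a.tag := by rw [← ht]; simp
      refine ⟨r.cM, r.cB, r.cZ, r.cOff, r.cMed, r.v, ?_, r.arr, ?_, ?_, r.high, r.far⟩ <;>
        simp only [AState.touch, e1]
      exacts [r.tag, r.buf, r.mem]
  · have hcache1 : ∀ q l, (σ.flush p.B q l).cache = σ.cache := fun _ _ => rfl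
    set σ1 := σ.flush p.B (64 + (2 + f) * p.M) (f * p.Z + a.tag f) with hσ1
    set σ2 : State := ⟨Function.update σ1.cache (8 + f) (k / p.B), σ1.mem⟩ with hσ2
    set σ3 := σ2.fetch p.B (64 + (2 + f) * p.M) (f * p.Z + k / p.B) with hσ3
    have htZ := (r.tag f hf).2
    have c2 : ∀ i, i ≠ 8 + f → σ2.cache i = σ.cache i := fun i hi => by
      simp only [hσ2, Function.update_of_ne hi]; rfl
    have c2f : σ2.cache (8 + f) = k / p.B := by simp [hσ2]
    have c3 : ∀ i, (i < 64 + (2 + f) * p.M ∨ 64 + (2 + f) * p.M + p.B ≤ i) →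
        σ3.cache i = σ2.cache i := by
      intro i hi
      simp only [hσ3, State.fetch]
      rw [if_neg (by omega)]
    have c3' : ∀ i, (i < 64 + (2 + f) * p.M ∨ 64 + (2 + f) * p.M + p.B ≤ i) → i ≠ 8 + f →
        σ3.cache i = σ.cache i := fun i hi h' => (c3 i hi).trans (c2 i h')
    -- main memory after the buffered line has been written back
    have m1 : ∀ f' < nf, ∀ l < p.Z, ∀ j < p.B, (f' = f ∨ l ≠ a.tag f') →
        σ1.mem ((f' * p.Z + l) * p.B + j) = a.file f' (l * p.B + j) := by
      intro f' hf' l hl j hj hor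
      simp only [hσ1, State.flush]
      split_ifs with hc
      · have := mul_add_inj (b := f' * p.Z + l) (b' := f * p.Z + a.tag f) (j := j)
          (j' := (f' * p.Z + l) * p.B + j - (f * p.Z + a.tag f) * p.B) hj (by omega) (by omega)
        have h2 := mul_add_inj hl htZ this.1
        obtain ⟨rfl, rfl⟩ := h2
        rw [← this.2]
        exact r.buf f' hf' j hj
      · by_cases hne : l = a.tag f'
        · rcases hor with rfl | hor
          · subst hne; omega
          · exact absurd hne hor
        · exact r.mem f' hf' l hl j hj hne
    refine ⟨σ3, ?_, ?_⟩
    · rw [AState.missCost, if_neg ht]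
      refine Run.condTrue (k := 2) ?_ ?_
      · simp only [Expr.eval, eB, eTag, r.cB, (r.tag f hf).1, hev, ← hk]
        omega
      · have w1 : Run p.B S p.W (.writeLine (eArr (2 + f)) (eLine f)) σ 1 σ1 := by
          have := Run.writeLine (B := p.B) (S := S) (W := p.W) (eArr (2 + f)) (eLine f) σ
            (by rw [r.eval_eArr]; exact hbufle) (by rw [r.eval_eLine hf]; exact hline _ htZ)
          rwa [r.eval_eArr, r.eval_eLine hf] at this
        have w2 : Run p.B S p.W (.assign (.const (8 + f)) (.div i.toExpr eB)) σ1 0 σ2 := by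
          have he : (Expr.div i.toExpr eB).eval σ1.cache = k / p.B := by
            change i.toExpr.eval σ.cache / σ.cache 3 = k / p.B
            rw [hev, r.cB]
          have := Run.assign (B := p.B) (S := S) (W := p.W) (.const (8 + f)) (.div i.toExpr eB) σ1
            (by simp only [Expr.eval]; omega) (by rw [he]; have := hline (k / p.B) hZ'; omega)
          rwa [he] at this
        have ea : (eArr (2 + f)).eval σ2.cache = 64 + (2 + f) * p.M := by
          simp only [eArr, eM, Expr.eval]; rw [c2 2 (by omega), r.cM]
        have el : (eLine f).eval σ2.cache = f * p.Z + k / p.B := by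
          simp only [eLine, eZ, eTag, Expr.eval]; rw [c2 4 (by omega), r.cZ, c2f]
        have w3 : Run p.B S p.W (.readLine (eArr (2 + f)) (eLine f)) σ2 1 σ3 := by
          have := Run.readLine (B := p.B) (S := S) (W := p.W) (eArr (2 + f)) (eLine f) σ2
            (by rw [ea]; exact hbufle) (by rw [el]; exact hline _ hZ')
          rwa [ea, el] at this
        exact Run.seq w1 (Run.seq w2 w3)
    · refine ⟨?_, ?_, ?_, ?_, ?_, ?_, ?_, ?_, ?_, ?_, ?_, ?_⟩
      · rw [c3' _ (by omega) (by omega)]; exact r.cM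
      · rw [c3' _ (by omega) (by omega)]; exact r.cB
      · rw [c3' _ (by omega) (by omega)]; exact r.cZ
      · rw [c3' _ (by omega) (by omega)]; exact r.cOff
      · rw [c3' _ (by omega) (by omega)]; exact r.cMed
      · intro x hx; rw [c3' _ (by omega) (by omega)]; exact r.v x hx
      · intro f' hf'
        rw [c3 _ (by omega)]
        simp only [AState.touch, Function.update_apply]
        split_ifs with e
        · subst e; exact ⟨c2f, hZ'⟩
        · rw [c2 _ (by omega)]; exact r.tag f' hf'
      · intro b hb j hj
        have : b * p.M ≤ 1 * p.M := Nat.mul_le_mul_right _ (by omega)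
        rw [c3' _ (by omega) (by omega)]; exact r.arr b hb j hj
      · intro f' hf' j hj
        have hlow' : 64 + 2 * p.M ≤ 64 + (2 + f') * p.M := by
          have : 2 * p.M ≤ (2 + f') * p.M := Nat.mul_le_mul_right _ (by omega)
          omega
        simp only [AState.touch, Function.update_apply]
        split_ifs with e
        · subst e
          have hM := m1 f' hf' (k / p.B) hZ' j hj (Or.inl rfl)
          simp only [hσ3, State.fetch]
          rw [if_pos (by omega), Nat.add_sub_cancel_left]
          exact hM
        · have hne : ¬ (64 + (2 + f) * p.M ≤ 64 + (2 + f') * p.M + j ∧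
              64 + (2 + f') * p.M + j < 64 + (2 + f) * p.M + p.B) := by
            intro hc
            have := (mul_add_inj (b := 2 + f') (b' := 2 + f) (M := p.M) (j := j)
              (j' := (2 + f') * p.M + j - (2 + f) * p.M) (by omega) (by omega) (by omega)).1
            omega
          rw [c3' _ (by omega) (by omega)]; exact r.buf f' hf' j hj
      · intro f' hf' l hl j hj hne
        change σ1.mem _ = _
        simp only [AState.touch, Function.update_apply] at hne ⊢
        refine m1 f' hf' l hl j hj ?_
        split_ifs at hne with e
        · exact Or.inl e
        · exact Or.inr hne
      · intro i' hi'
        rw [c3' _ _ (by omega)]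
        · exact r.high i' hi'
        · have : (2 + f) * p.M ≤ 11 * p.M := Nat.mul_le_mul_right _ (by omega)
          omega
      · intro i' hi'
        change σ1.mem _ = _
        simp only [hσ1, State.flush]
        rw [if_neg]
        · exact r.far i' hi'
        · have h1 : f * p.Z + a.tag f + 1 ≤ nf * p.Z := by
            have : (f + 1) * p.Z ≤ nf * p.Z := Nat.mul_le_mul_right _ hf
            rw [add_mul] at this; omega
          have := Nat.mul_le_mul_right p.B h1
          rw [add_mul] at this
          omega

/-- The total number of I/Os spent on the first `nf` files. -/
def AState.total (a : AState) (nf : ℕ) : ℕ := ∑ f ∈ Finset.range nf, a.io f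

theorem AState.total_touch (a : AState) {f i : ℕ} (hf : f < nf) :
    (a.touch p f i).total nf = a.missCost p f i + a.total nf := by
  unfold AState.total
  have hm : f ∈ Finset.range nf := Finset.mem_range.2 hf
  rw [← Finset.add_sum_erase _ _ hm, ← Finset.add_sum_erase (Finset.range nf) a.io hm]
  have : ∑ x ∈ (Finset.range nf).erase f, (a.touch p f i).io x
      = ∑ x ∈ (Finset.range nf).erase f, a.io x := by
    refine Finset.sum_congr rfl fun x hx => ?_
    simp [AState.touch, Finset.ne_of_mem_erase hx]
  rw [this]
  simp only [AState.touch, Function.update_self, AState.missCost]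
  omega

/-- Correctness of compilation: a run of a command that stays in range is simulated by the machine,
with the I/Os that the configurations count. -/
theorem Rep.compile (hnf : nf ≤ 10) (hB : 0 < p.B) (hBM : p.B ≤ p.M)
    {S : ℕ} (hS : 64 + 12 * p.M ≤ S) (hW : 10 * p.Z ≤ p.W) (c : Cmd) (hc : c.wf nf = true) :
    ∀ (a : AState) (σ : State), Rep p nf h g a σ → (c.exec p a).ok →
      ∃ k τ, Run p.B S p.W c.compile σ k τ ∧ Rep p nf h g (c.exec p a) τ ∧
        k + a.total nf = (c.exec p a).total nf := by
  induction c with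
  | skip => exact fun a σ r _ => ⟨0, σ, Run.skip σ, r, by simp [Cmd.exec]⟩
  | set x e =>
    intro a σ r hok
    simp only [Cmd.wf, Bool.and_eq_true, decide_eq_true_eq] at hc
    have he := r.eval hc.2
    refine ⟨0, _, Run.assign _ _ σ ?_ ?_, ?_, by simp [Cmd.exec, AState.total, AState.setv]⟩
    · simp only [Expr.eval]; omega
    · rw [he]; exact hok.2
    · rw [he]; exact r.setv hnf hc.1
  | get x b i =>
    intro a σ r hok
    simp only [Cmd.wf, Bool.and_eq_true, decide_eq_true_eq] at hc
    simp only [Cmd.exec, AState.setv, AState.require] at hok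
    have he : (Expr.cell (.add (eArr b) i.toExpr)).eval σ.cache = a.arr b (i.eval a.v) := by
      change σ.cache ((eArr b).eval σ.cache + i.toExpr.eval σ.cache) = _
      rw [r.eval_eArr, r.eval hc.2]
      exact r.arr b hc.1.2 _ hok.1.2
    refine ⟨0, _, Run.assign _ _ σ ?_ ?_, ?_,
      by simp [Cmd.exec, AState.total, AState.setv, AState.require]⟩
    · simp only [Expr.eval]; omega
    · rw [he]; exact hok.2
    · rw [he]; exact r.require.setv hnf hc.1.1
  | put b i e =>
    intro a σ r hok
    simp only [Cmd.wf, Bool.and_eq_true, decide_eq_true_eq] at hc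
    simp only [Cmd.exec, AState.setArr] at hok
    have he : (Expr.add (eArr b) i.toExpr).eval σ.cache = 64 + b * p.M + i.eval a.v := by
      change (eArr b).eval σ.cache + i.toExpr.eval σ.cache = _
      rw [r.eval_eArr, r.eval hc.1.2]
    refine ⟨0, _, Run.assign _ _ σ ?_ ?_, ?_, by simp [Cmd.exec, AState.total, AState.setArr]⟩
    · rw [he]
      have : b * p.M ≤ 1 * p.M := Nat.mul_le_mul_right _ (by omega)
      omega
    · rw [r.eval hc.2]; exact hok.2.2
    · rw [he, r.eval hc.2]; exact r.setArr hnf hBM hc.1.1 hok.2.1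
  | read x f i =>
    intro a σ r hok
    simp only [Cmd.wf, Bool.and_eq_true, decide_eq_true_eq] at hc
    simp only [Cmd.exec, AState.setv] at hok
    obtain ⟨τ, hτ, r'⟩ := r.seek hnf hB hBM hS hW hc.1.2 hc.2 hok.1.2
    have he : (Expr.cell (.add (eArr (2 + f)) (.mod i.toExpr eB))).eval τ.cache
        = a.file f (i.eval a.v) := by
      change τ.cache ((eArr (2 + f)).eval τ.cache + i.toExpr.eval τ.cache % τ.cache 3) = _
      rw [r'.eval_eArr, r'.eval hc.2, r'.cB, r'.buf f hc.1.2 _ (Nat.mod_lt _ hB)]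
      simp [AState.touch, Nat.div_add_mod']
    refine ⟨_, _, Run.seq hτ (Run.assign _ _ τ ?_ ?_), ?_, ?_⟩
    · simp only [Expr.eval]; omega
    · rw [he]; exact hok.2
    · rw [he]; exact r'.setv hnf hc.1.1
    · exact (a.total_touch hc.1.2).symm
  | write f i e =>
    intro a σ r hok
    simp only [Cmd.wf, Bool.and_eq_true, decide_eq_true_eq] at hc
    simp only [Cmd.exec, AState.setFile] at hok
    obtain ⟨τ, hτ, r'⟩ := r.seek hnf hB hBM hS hW hc.1.1 hc.1.2 hok.1.2
    have he : (Expr.add (eArr (2 + f)) (.mod i.toExpr eB)).eval τ.cache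
        = 64 + (2 + f) * p.M + i.eval a.v % p.B := by
      change (eArr (2 + f)).eval τ.cache + i.toExpr.eval τ.cache % τ.cache 3 = _
      rw [r'.eval_eArr, r'.eval hc.1.2, r'.cB]; rfl
    have hm := Nat.mod_lt (i.eval a.v) hB
    refine ⟨_, _, Run.seq hτ (Run.assign _ _ τ ?_ ?_), ?_, ?_⟩
    · rw [he]
      have : (2 + f) * p.M ≤ 11 * p.M := Nat.mul_le_mul_right _ (by omega)
      omega
    · rw [r'.eval hc.2]; exact hok.2
    · rw [he, r'.eval hc.2]
      exact r'.setFile hnf hB hBM hc.1.1 (by simp [AState.touch])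
    · exact (a.total_touch hc.1.1).symm
  | seq c d ihc ihd =>
    intro a σ r hok
    simp only [Cmd.wf, Bool.and_eq_true] at hc
    obtain ⟨j, τ, hτ, r1, e1⟩ := ihc hc.1 a σ r (Cmd.exec_ok_mono p d _ hok)
    obtain ⟨k, ρ, hρ, r2, e2⟩ := ihd hc.2 _ τ r1 hok
    exact ⟨j + k, ρ, Run.seq hτ hρ, r2, by simp only [Cmd.exec]; omega⟩
  | ite e c d ihc ihd =>
    intro a σ r hok
    simp only [Cmd.wf, Bool.and_eq_true] at hc
    have he := r.eval hc.1.1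
    by_cases h0 : e.eval a.v ≠ 0
    · simp only [Cmd.exec, if_pos h0] at hok ⊢
      obtain ⟨k, τ, hτ, r1, e1⟩ := ihc hc.1.2 a σ r hok
      exact ⟨k, τ, Run.condTrue (by rwa [he]) hτ, r1, e1⟩
    · simp only [Cmd.exec, if_neg h0] at hok ⊢
      obtain ⟨k, τ, hτ, r1, e1⟩ := ihd hc.2 a σ r hok
      exact ⟨k, τ, Run.condFalse (by rw [he]; tauto) hτ, r1, e1⟩
  | iter x y c ih =>
    intro a σ r hok
    simp only [Cmd.wf, Bool.and_eq_true, decide_eq_true_eq, Bool.not_eq_true', bne_iff_ne] at hc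
    obtain ⟨⟨⟨⟨⟨hx, hy⟩, hxy⟩, hcw⟩, hwx⟩, hwy⟩ := hc
    simp only [Cmd.exec] at hok ⊢
    set N := a.v y with hN
    set F := fun i s => c.exec p (AState.setv s p x i) with hF
    have hNW : N < p.W := hok.2
    -- the configurations at the start of each iteration
    have hFy : ∀ i s, (F i s).v y = s.v y := fun i s => by
      rw [hF]; simp only
      rw [Cmd.exec_frame_v p y c _ hwy, AState.setv]
      exact Function.update_of_ne (Ne.symm hxy) _ _
    have hLy : ∀ i, (loopN F i a).v y = N := by
      intro i
      induction i with
      | zero => rfl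
      | succ i ihi => rw [loopN_succ, hFy, ihi]
    have hFok : ∀ i s, (F i s).ok → s.ok := fun i s h' => (Cmd.exec_ok_mono p c _ h').1
    have hLok : ∀ d i, i + d = N → (loopN F i a).ok := by
      intro d
      induction d with
      | zero => intro i hi; rw [show i = N by omega]; exact hok.1
      | succ d ihd => intro i hi; exact hFok i _ (ihd (i + 1) (by omega))
    have key : ∀ d i τ, i + d = N → Rep p nf h g ((loopN F i a).setv p x i) τ →
        ∃ k ρ, Run p.B S p.W (.loop (.sub (.cell (.const (32 + y))) (.cell (.const (32 + x))))
          (.seq c.compile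
            (.assign (.const (32 + x)) (.add (.cell (.const (32 + x))) (.const 1))))) τ k ρ ∧
          Rep p nf h g ((loopN F N a).setv p x N) ρ ∧
          k + (loopN F i a).total nf = (loopN F N a).total nf := by
      intro d
      induction d with
      | zero =>
        intro i τ hi r1
        obtain rfl : i = N := by omega
        refine ⟨0, τ, Run.loopFalse ?_, r1, by simp⟩
        have e1 := r1.v x hx
        have e2 := r1.v y hy
        have e3 := hLy N
        simp only [AState.setv, Function.update_self,
          Function.update_of_ne (Ne.symm hxy)] at e1 e2
        simp only [Expr.eval, e1, e2, e3]
        omega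
      | succ d ihd =>
        intro i τ hi r1
        have e1 := r1.v x hx
        have e2 := r1.v y hy
        have e3 := hLy i
        simp only [AState.setv, Function.update_self,
          Function.update_of_ne (Ne.symm hxy)] at e1 e2
        obtain ⟨j, ρ, hρ, r2, t2⟩ := ih hcw _ τ r1 (hLok d (i + 1) (by omega))
        have e4 : ρ.cache (32 + x) = i := by
          rw [r2.v x hx, Cmd.exec_frame_v p x c _ hwx]; simp [AState.setv]
        have r3 := r2.setv hnf hx (k := i + 1)
        have hr : Run p.B S p.W
            (.assign (.const (32 + x)) (.add (.cell (.const (32 + x))) (.const 1))) ρ 0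
            ⟨Function.update ρ.cache (32 + x) (i + 1), ρ.mem⟩ := by
          have := Run.assign (B := p.B) (S := S) (W := p.W) (.const (32 + x))
            (.add (.cell (.const (32 + x))) (.const 1)) ρ
            (by simp only [Expr.eval]; omega) (by simp only [Expr.eval, e4]; omega)
          simpa only [Expr.eval, e4] using this
        obtain ⟨k, ρ', hρ', r4, t4⟩ := ihd (i + 1) _ (by omega) r3
        refine ⟨j + 0 + k, ρ', Run.loopTrue ?_ (Run.seq hρ hr) hρ', r4, ?_⟩
        · simp only [Expr.eval, e1, e2, e3]; omega
        · rw [loopN_succ] at t4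
          have : ((loopN F i a).setv p x i).total nf = (loopN F i a).total nf := rfl
          rw [this] at t2
          simp only [hF] at t4 t2 ⊢
          omega
    obtain ⟨k, ρ, hρ, r1, t1⟩ := key N 0 _ (by omega) (r.setv hnf hx (k := 0))
    refine ⟨0 + k, ρ, Run.seq ?_ hρ, r1, ?_⟩
    · have := Run.assign (B := p.B) (S := S) (W := p.W) (.const (32 + x)) (.const 0) σ
        (by simp only [Expr.eval]; omega) (by simp only [Expr.eval]; omega)
      simpa only [Expr.eval] using this
    · rw [zero_add]; exact t1

end rep

/-! ### Running a program in a translated part of the memory -/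

/-- The expression evaluated in the part of the cache whose start is stored in word `5`. -/
def Expr.shift : Expr → Expr
  | .const k => .const k
  | .cell e => .cell (.add e.shift (.cell (.const 5)))
  | .add e f => .add e.shift f.shift
  | .sub e f => .sub e.shift f.shift
  | .mul e f => .mul e.shift f.shift
  | .div e f => .div e.shift f.shift
  | .mod e f => .mod e.shift f.shift

/-- The program run in the part of the cache whose start is stored in word `5`, and in the part of
the main memory whose first line is stored in word `6`. -/
def Prog.shift : Prog → Prog
  | .skip => .skip
  | .assign a e => .assign (.add a.shift (.cell (.const 5))) e.shift
  | .readLine p l => .readLine (.add p.shift (.cell (.const 5))) (.add l.shift (.cell (.const 6)))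
  | .writeLine p l => .writeLine (.add p.shift (.cell (.const 5))) (.add l.shift (.cell (.const 6)))
  | .seq P Q => .seq P.shift Q.shift
  | .cond e P Q => .cond e.shift P.shift Q.shift
  | .loop e P => .loop e.shift P.shift

/-- The state `τ` contains a copy of `σ` from cache word `O` and from line `l₀` on; below, its content
is given by `c₀` and `m₀`. -/
structure Shifted (B O l₀ : ℕ) (c₀ m₀ : ℕ → ℕ) (σ τ : State) : Prop where
  cacheHigh : ∀ i, τ.cache (i + O) = σ.cache i
  memHigh : ∀ i, τ.mem (l₀ * B + i) = σ.mem i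
  cacheLow : ∀ i < O, τ.cache i = c₀ i
  memLow : ∀ i < l₀ * B, τ.mem i = m₀ i

section shifted
variable {B O l₀ : ℕ} {c₀ m₀ : ℕ → ℕ} {σ τ : State}

theorem Shifted.eval (s : Shifted B O l₀ c₀ m₀ σ τ) (hO : 6 < O) (h5 : c₀ 5 = O) (e : Expr) :
    e.shift.eval τ.cache = e.eval σ.cache := by
  have h5' : τ.cache 5 = O := (s.cacheLow 5 (by omega)).trans h5
  induction e with
  | const => rfl
  | cell e ih => simp only [Expr.shift, Expr.eval, ih, h5', s.cacheHigh]
  | add e f ihe ihf | sub e f ihe ihf | mul e f ihe ihf | div e f ihe ihf | mod e f ihe ihf =>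
    simp only [Expr.shift, Expr.eval, ihe, ihf]

theorem Shifted.run (hO : 6 < O) (h5 : c₀ 5 = O) (h6 : c₀ 6 = l₀)
    {S S' W W' : ℕ} (hS : S + O ≤ S') (hW : W + l₀ ≤ W') {P : Prog} {σ σ' : State} {k : ℕ}
    (hr : Run B S W P σ k σ') :
    ∀ τ, Shifted B O l₀ c₀ m₀ σ τ →
      ∃ τ', Run B S' W' P.shift τ k τ' ∧ Shifted B O l₀ c₀ m₀ σ' τ' := by
  have e5 : ∀ {σ τ : State}, Shifted B O l₀ c₀ m₀ σ τ → (Expr.cell (.const 5)).eval τ.cache = O :=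
    fun s => (s.cacheLow 5 (by omega)).trans h5
  have e6 : ∀ {σ τ : State}, Shifted B O l₀ c₀ m₀ σ τ → (Expr.cell (.const 6)).eval τ.cache = l₀ :=
    fun s => (s.cacheLow 6 (by omega)).trans h6
  induction hr with
  | skip σ => exact fun τ s => ⟨τ, Run.skip τ, s⟩
  | assign a e σ ha he =>
    intro τ s
    have h1 : (Expr.add a.shift (.cell (.const 5))).eval τ.cache = a.eval σ.cache + O := by
      rw [Expr.eval, s.eval hO h5, e5 s]
    refine ⟨_, Run.assign _ _ τ (by rw [h1]; omega) (by rw [s.eval hO h5]; omega), ?_⟩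
    rw [h1, s.eval hO h5]
    refine ⟨fun i => ?_, s.memHigh, fun i hi => ?_, s.memLow⟩
    · simp only [Function.update_apply, Nat.add_right_cancel_iff, s.cacheHigh]
    · simp only [Function.update_apply]
      rw [if_neg (by omega)]; exact s.cacheLow i hi
  | readLine p l σ hp hl =>
    intro τ s
    have h1 : (Expr.add p.shift (.cell (.const 5))).eval τ.cache = p.eval σ.cache + O := by
      rw [Expr.eval, s.eval hO h5, e5 s]
    have h2 : (Expr.add l.shift (.cell (.const 6))).eval τ.cache = l.eval σ.cache + l₀ := by
      rw [Expr.eval, s.eval hO h5, e6 s]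
    refine ⟨_, Run.readLine _ _ τ (by rw [h1]; omega) (by rw [h2]; omega), ?_⟩
    rw [h1, h2]
    refine ⟨fun i => ?_, s.memHigh, fun i hi => ?_, s.memLow⟩
    · simp only [State.fetch, s.cacheHigh]
      by_cases hc : p.eval σ.cache ≤ i ∧ i < p.eval σ.cache + B
      · rw [if_pos hc, if_pos (by omega), ← s.memHigh]
        congr 1
        rw [add_mul]; omega
      · rw [if_neg hc, if_neg (by omega)]
    · simp only [State.fetch]
      rw [if_neg (by omega)]; exact s.cacheLow i hi
  | writeLine p l σ hp hl =>
    intro τ s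
    have h1 : (Expr.add p.shift (.cell (.const 5))).eval τ.cache = p.eval σ.cache + O := by
      rw [Expr.eval, s.eval hO h5, e5 s]
    have h2 : (Expr.add l.shift (.cell (.const 6))).eval τ.cache = l.eval σ.cache + l₀ := by
      rw [Expr.eval, s.eval hO h5, e6 s]
    refine ⟨_, Run.writeLine _ _ τ (by rw [h1]; omega) (by rw [h2]; omega), ?_⟩
    rw [h1, h2]
    refine ⟨s.cacheHigh, fun i => ?_, s.cacheLow, fun i hi => ?_⟩
    · simp only [State.flush, s.memHigh, add_mul]
      by_cases hc : l.eval σ.cache * B ≤ i ∧ i < l.eval σ.cache * B + B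
      · rw [if_pos hc, if_pos (by omega), ← s.cacheHigh]
        congr 1
        omega
      · rw [if_neg hc, if_neg (by omega)]
    · simp only [State.flush, add_mul]
      rw [if_neg (by omega)]; exact s.memLow i hi
  | seq _ _ ih1 ih2 =>
    intro τ s
    obtain ⟨τ1, r1, s1⟩ := ih1 τ s
    obtain ⟨τ2, r2, s2⟩ := ih2 τ1 s1
    exact ⟨τ2, Run.seq r1 r2, s2⟩
  | condTrue he _ ih =>
    intro τ s
    obtain ⟨τ1, r1, s1⟩ := ih τ s
    exact ⟨τ1, Run.condTrue (by rwa [s.eval hO h5]) r1, s1⟩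
  | condFalse he _ ih =>
    intro τ s
    obtain ⟨τ1, r1, s1⟩ := ih τ s
    exact ⟨τ1, Run.condFalse (by rwa [s.eval hO h5]) r1, s1⟩
  | loopTrue he _ _ ih1 ih2 =>
    intro τ s
    obtain ⟨τ1, r1, s1⟩ := ih1 τ s
    obtain ⟨τ2, r2, s2⟩ := ih2 τ1 s1
    exact ⟨τ2, Run.loopTrue (by rwa [s.eval hO h5]) r1 r2, s2⟩
  | loopFalse he =>
    exact fun τ s => ⟨τ, Run.loopFalse (by rwa [s.eval hO h5]), s⟩

end shifted

/-! ### Setting up the files, and calling a program on the graph stored in a file -/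

/-- The words of an edge list. -/
def words {n : ℕ} (L : List (Fin n × Fin n)) (i : ℕ) : ℕ :=
  (L.flatMap fun e => [(e.1 : ℕ), (e.2 : ℕ)]).getD i 0

theorem words_eq_zero {n : ℕ} (L : List (Fin n × Fin n)) {i : ℕ} (hi : 2 * L.length ≤ i) :
    words L i = 0 := by
  rw [words, List.getD_eq_default]
  have : ∀ L : List (Fin n × Fin n),
      (L.flatMap fun e => [(e.1 : ℕ), (e.2 : ℕ)]).length = 2 * L.length := by
    intro L
    induction L with
    | nil => rfl
    | cons e L ih => rw [List.flatMap_cons, List.length_append, ih]; simp; omega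
  rw [this]; exact hi

/-- Compute the layout of cache and main memory from `n`, `m` and `M`, and buffer the first line of
the input.  The number of lines of a file, in word `4`, is an upper bound for the number of words
that the edge list of the gadget graph takes up.  Behind `64` single words, the two arrays and the buffers of the ten files take up `12 * M` words of the
cache.  Word `6` makes the translated main memory start at file `9`. -/
def setup : Prog :=
  .seq (.assign (.const 32) (.cell (.const 0)))
  (.seq (.assign (.const 33) (.cell (.const 1)))
  (.seq (.assign (.const 34) (.cell (.const 2)))
  (.seq (.assign (.const 4) (.mul (.const 1000)
    (.add (.add (.cell (.const 0)) (.cell (.const 1))) (.const 1))))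
  (.seq (.assign (.const 5) (.add (.const 64) (.mul (.const 12) eM)))
  (.seq (.assign (.const 6) (.mul (.const 9) eZ))
    (.readLine (eArr 2) (.const 0)))))))

/-- The configuration after `setup`: registers `0, 1, 2` hold `n`, `m` and `M`, and file `0` is the
edge list. -/
def startState {n : ℕ} (L : List (Fin n × Fin n)) (M : ℕ) : AState where
  v := fun x => [n, L.length, M].getD x 0
  arr := fun _ _ => 0
  file := fun f i => if f = 0 then words L i else 0
  tag := fun _ => 0
  io := fun _ => 0
  ok := True

theorem setup_run {n : ℕ} (L : List (Fin n × Fin n)) {p : Par} {S : ℕ}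
    (hZ : p.Z = 1000 * (n + L.length + 1)) (hB : 0 < p.B) (hBM : p.B ≤ p.M)
    (hS : 64 + 12 * p.M ≤ S) (hW : 10 * p.Z ≤ p.W) (hWM : 64 + 12 * p.M < p.W) :
    ∃ τ, Run p.B S p.W setup (initState L p.M p.B) 1 τ ∧
      Rep p 10 (fun _ => 0) (fun _ => 0) (startState L p.M) τ := by
  have hmem : (initState L p.M p.B).mem = words L := rfl
  set σ := initState L p.M p.B with hσ
  have hc : σ.cache = fun i => [n, L.length, p.M, p.B].getD i 0 := rfl
  have hc0 : ∀ i, 4 ≤ i → σ.cache i = 0 := by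
    intro i hi; rw [hc]; simp only; rw [List.getD_eq_default]; simpa using hi
  have hv0 : ∀ x, 3 ≤ x → (startState L p.M).v x = 0 := by
    intro i hi; simp only [startState]; rw [List.getD_eq_default]; simpa using hi
  have h0 : σ.cache 0 = n := rfl
  have h1 : σ.cache 1 = L.length := rfl
  have h2 : σ.cache 2 = p.M := rfl
  have h3 : σ.cache 3 = p.B := rfl
  let c : ℕ → ℕ := Function.update (Function.update (Function.update (Function.update
    (Function.update (Function.update σ.cache 32 n) 33 L.length) 34 p.M) 4 p.Z)
      5 (64 + 12 * p.M)) 6 (9 * p.Z)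
  have r1 : Run p.B S p.W setup σ 1 ((⟨c, words L⟩ : State).fetch p.B (64 + 2 * p.M) 0) := by
    have A : ∀ (q : ℕ) (e : Expr) (k : ℕ) (s : State), q < 64 → e.eval s.cache = k → k < p.W →
        Run p.B S p.W (.assign (.const q) e) s 0 ⟨Function.update s.cache q k, s.mem⟩ := by
      intro q e k s hq he hk
      subst he
      exact Run.assign _ _ _ (by simp only [Expr.eval]; omega) hk
    refine Run.seq (j := 0) (k := 1) (A 32 _ n _ (by omega) h0 (by omega)) ?_
    refine Run.seq (j := 0) (k := 1) (A 33 _ L.length _ (by omega) h1 (by omega)) ?_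
    refine Run.seq (j := 0) (k := 1) (A 34 _ p.M _ (by omega) h2 (by omega)) ?_
    refine Run.seq (j := 0) (k := 1) (A 4 _ p.Z _ (by omega) hZ.symm (by omega)) ?_
    refine Run.seq (j := 0) (k := 1) (A 5 _ (64 + 12 * p.M) _ (by omega) rfl (by omega)) ?_
    refine Run.seq (j := 0) (k := 1) (A 6 _ (9 * p.Z) _ (by omega) ?_ (by omega)) ?_
    · simp [Expr.eval, eZ]
    · exact Run.readLine _ _ _ (show 64 + 2 * p.M + p.B ≤ S by omega)
        (show 0 < p.W by omega)
  refine ⟨_, r1, ?_⟩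
  have hcc : ∀ i, ¬ (64 + 2 * p.M ≤ i ∧ i < 64 + 2 * p.M + p.B) →
      ((⟨c, words L⟩ : State).fetch p.B (64 + 2 * p.M) 0).cache i = c i := by
    intro i hi; simp only [State.fetch]; rw [if_neg hi]
  have hz : ∀ i, 35 ≤ i → c i = 0 := by
    intro i hi
    simp only [c]
    repeat rw [Function.update_of_ne (by omega)]
    exact hc0 i (by omega)
  refine ⟨?_, ?_, ?_, ?_, ?_, ?_, ?_, ?_, ?_, ?_, ?_, ?_⟩
  · rw [hcc _ (by omega)]; simp [c, h2]
  · rw [hcc _ (by omega)]; simp [c, h3]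
  · rw [hcc _ (by omega)]; simp [c]
  · rw [hcc _ (by omega)]; simp [c]
  · rw [hcc _ (by omega)]; simp [c]
  · intro x hx
    rw [hcc _ (by omega)]
    by_cases hx3 : 3 ≤ x
    · rw [hz _ (by omega), hv0 x hx3]
    · interval_cases x <;> simp [c, startState]
  · intro f hf
    rw [hcc _ (by omega)]
    refine ⟨?_, show 0 < p.Z by omega⟩
    simp only [c]
    repeat rw [Function.update_of_ne (by omega)]
    exact hc0 _ (by omega)
  · intro b hb j hj
    have : b * p.M ≤ 1 * p.M := Nat.mul_le_mul_right _ (by omega)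
    rw [hcc _ (by omega), hz _ (by omega)]; rfl
  · intro f hf j hj
    by_cases hf0 : f = 0
    · subst hf0
      simp only [State.fetch]
      rw [if_pos (by omega)]
      simp [startState]
    · have : 3 * p.M ≤ (2 + f) * p.M := Nat.mul_le_mul_right _ (by omega)
      rw [hcc _ (by omega), hz _ (by omega)]
      simp [startState, hf0]
  · intro f hf l hl j hj hne
    change words L _ = _
    by_cases hf0 : f = 0
    · subst hf0; simp [startState]
    · simp only [startState, if_neg hf0]
      apply words_eq_zero
      have h1 : 1 * p.Z ≤ f * p.Z := Nat.mul_le_mul_right _ (by omega)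
      have h2 : (f * p.Z + l) * 1 ≤ (f * p.Z + l) * p.B := Nat.mul_le_mul_left _ hB
      omega
  · intro i hi; rw [hcc _ (by omega)]; exact hz i (by omega)
  · intro i hi
    apply words_eq_zero
    have h2 : (10 * p.Z) * 1 ≤ (10 * p.Z) * p.B := Nat.mul_le_mul_left _ hB
    omega

/-- Run `P` on the graph whose edge list is stored in file `9` and whose numbers of vertices and edges
are in registers `y` and `z`; afterwards store its output in register `x`. -/
def call (P : Prog) (x y z : ℕ) : Prog :=
  .seq (.writeLine (eArr 11) (eLine 9))
  (.seq (.assign (.add (.const 0) (.cell (.const 5))) (.cell (.const (32 + y))))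
  (.seq (.assign (.add (.const 1) (.cell (.const 5))) (.cell (.const (32 + z))))
  (.seq (.assign (.add (.const 2) (.cell (.const 5))) eM)
  (.seq (.assign (.add (.const 3) (.cell (.const 5))) eB)
  (.seq P.shift
    (.assign (.const (32 + x)) (.cell (.add (.const 0) (.cell (.const 5))))))))))

theorem call_run {p : Par} {a : AState} {σ : State}
    (r : Rep p 10 (fun _ => 0) (fun _ => 0) a σ) (hB : 0 < p.B) (hBM : p.B ≤ p.M)
    {S S₀ W₀ : ℕ} (hS : S₀ + (64 + 12 * p.M) ≤ S) (hS4 : 4 ≤ S₀) (hW : W₀ + 9 * p.Z ≤ p.W)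
    (hZW : 10 * p.Z ≤ p.W) (hMW : p.M < p.W)
    {x y z : ℕ} (hx : x < 32) (hy : y < 32) (hz : z < 32)
    {n : ℕ} (L : List (Fin n × Fin n)) (hLZ : 2 * L.length ≤ p.Z) (hnW : n < p.W)
    (hfile : ∀ i, a.file 9 i = words L i) (hn : a.v y = n) (hm : a.v z = L.length)
    {P : Prog} {k : ℕ} {τ₀ : State} (hP : Run p.B S₀ W₀ P (initState L p.M p.B) k τ₀)
    (hout : τ₀.cache 0 < p.W) :
    ∃ h g ρ, Run p.B S p.W (call P x y z) σ (k + 1) ρ ∧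
      Rep p 9 h g (a.setv p x (τ₀.cache 0)) ρ := by
  set O := 64 + 12 * p.M with hO
  set σ1 := σ.flush p.B (64 + 11 * p.M) (9 * p.Z + a.tag 9) with hσ1
  have htag := (r.tag 9 (by omega)).2
  have w1 : Run p.B S p.W (.writeLine (eArr 11) (eLine 9)) σ 1 σ1 := by
    have := Run.writeLine (B := p.B) (S := S) (W := p.W) (eArr 11) (eLine 9) σ
      (by rw [r.eval_eArr]; omega) (by rw [r.eval_eLine (by omega)]; omega)
    rwa [r.eval_eArr, r.eval_eLine (by omega)] at this
  let c1 := Function.update σ.cache O n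
  let c2 := Function.update c1 (O + 1) L.length
  let c3 := Function.update c2 (O + 2) p.M
  let c4 := Function.update c3 (O + 3) p.B
  have lowc : ∀ i < O, c1 i = σ.cache i ∧ c2 i = σ.cache i ∧ c3 i = σ.cache i ∧
      c4 i = σ.cache i := by
    intro i hi
    have e1 : c1 i = σ.cache i := Function.update_of_ne (by omega) _ _
    have e2 : c2 i = c1 i := Function.update_of_ne (by omega) _ _
    have e3 : c3 i = c2 i := Function.update_of_ne (by omega) _ _
    have e4 : c4 i = c3 i := Function.update_of_ne (by omega) _ _
    refine ⟨e1, by rw [e2, e1], by rw [e3, e2, e1], by rw [e4, e3, e2, e1]⟩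
  have A : ∀ (q : ℕ) (e : Expr) (w : ℕ) (c m : ℕ → ℕ), q < 4 → c 5 = O → e.eval c = w →
      w < p.W → Run p.B S p.W (.assign (.add (.const q) (.cell (.const 5))) e) ⟨c, m⟩ 0
        ⟨Function.update c (O + q) w, m⟩ := by
    intro q e w c m hq h5 he hw
    subst he
    have := Run.assign (B := p.B) (S := S) (W := p.W) (.add (.const q) (.cell (.const 5))) e
      ⟨c, m⟩ (by simp only [Expr.eval, h5]; omega) hw
    simpa only [Expr.eval, h5, add_comm q O] using this
  have h5 := r.cOff
  have a1 := A 0 (.cell (.const (32 + y))) n σ1.cache σ1.mem (by omega) h5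
    ((r.v y hy).trans hn) hnW
  have a2 := A 1 (.cell (.const (32 + z))) L.length c1 σ1.mem (by omega)
    ((lowc 5 (by omega)).1.trans h5)
    (((lowc (32 + z) (by omega)).1.trans (r.v z hz)).trans hm) (by omega)
  have a3 := A 2 eM p.M c2 σ1.mem (by omega) ((lowc 5 (by omega)).2.1.trans h5)
    ((lowc 2 (by omega)).2.1.trans r.cM) hMW
  have a4 := A 3 eB p.B c3 σ1.mem (by omega) ((lowc 5 (by omega)).2.2.1.trans h5)
    ((lowc 3 (by omega)).2.2.1.trans r.cB) (by omega)
  have sh : Shifted p.B O (9 * p.Z) σ.cache σ1.mem (initState L p.M p.B) ⟨c4, σ1.mem⟩ := by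
    refine ⟨?_, ?_, fun i hi => (lowc i hi).2.2.2, fun _ _ => rfl⟩
    · intro i
      by_cases hi : 4 ≤ i
      · have : c4 (i + O) = σ.cache (i + O) := by
          simp only [c4, c3, c2, c1]
          repeat rw [Function.update_of_ne (by omega)]
        simp only [this, initState]
        rw [r.high _ (by omega), List.getD_eq_default]
        simpa using hi
      · interval_cases i <;> simp [c4, c3, c2, c1, initState, add_comm]
    · intro i
      change _ = words L i
      simp only [hσ1, State.flush]
      by_cases hiZ : i < p.Z * p.B
      · have hl : i / p.B < p.Z := Nat.div_lt_of_lt_mul (by rwa [mul_comm])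
        have hj := Nat.mod_lt i hB
        have hdm := Nat.div_add_mod' i p.B
        have e1 : 9 * p.Z * p.B + i = (9 * p.Z + i / p.B) * p.B + i % p.B := by
          rw [add_mul]; omega
        split_ifs with hc
        · have h2 := mul_add_inj (b := 9 * p.Z + i / p.B) (b' := 9 * p.Z + a.tag 9) (j := i % p.B)
            (j' := 9 * p.Z * p.B + i - (9 * p.Z + a.tag 9) * p.B) hj (by omega) (by omega)
          rw [← h2.2, r.buf 9 (by omega) _ hj, hfile]
          congr 1
          rw [show a.tag 9 = i / p.B by omega]; exact hdm
        · have hne : i / p.B ≠ a.tag 9 := by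
            intro h; rw [h] at e1; omega
          rw [e1, r.mem 9 (by omega) _ hl _ hj hne, hdm, hfile]
      · have h3 : (9 * p.Z + a.tag 9 + 1) * p.B ≤ 10 * p.Z * p.B :=
          Nat.mul_le_mul_right _ (by omega)
        rw [add_mul _ 1] at h3
        have h4 : 10 * p.Z * p.B = 9 * p.Z * p.B + p.Z * p.B := by ring
        rw [if_neg (by omega), r.far _ (by omega), words_eq_zero]
        have : p.Z * 1 ≤ p.Z * p.B := Nat.mul_le_mul_left _ hB
        omega
  obtain ⟨ρ1, hρ1, sh1⟩ := Shifted.run (by omega) h5 r.cMed (S' := S) (by omega) hW hP _ sh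
  have hlow := sh1.cacheLow
  have e5 : ρ1.cache 5 = O := (hlow 5 (by omega)).trans h5
  have hfin : Run p.B S p.W (.assign (.const (32 + x))
      (.cell (.add (.const 0) (.cell (.const 5))))) ρ1 0
      ⟨Function.update ρ1.cache (32 + x) (τ₀.cache 0), ρ1.mem⟩ := by
    have e : (Expr.cell (.add (.const 0) (.cell (.const 5)))).eval ρ1.cache = τ₀.cache 0 := by
      simp only [Expr.eval, e5]; exact sh1.cacheHigh 0
    have := Run.assign (B := p.B) (S := S) (W := p.W) (.const (32 + x))
      (.cell (.add (.const 0) (.cell (.const 5)))) ρ1 (by simp only [Expr.eval]; omega)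
      (by rw [e]; exact hout)
    rwa [e] at this
  have rep1 : Rep p 9 ρ1.cache ρ1.mem a ρ1 := by
    have hbl : ∀ f < 9, (2 + f) * p.M ≤ 10 * p.M := fun f hf => Nat.mul_le_mul_right _ (by omega)
    refine ⟨?_, ?_, ?_, ?_, ?_, ?_, ?_, ?_, ?_, ?_, fun _ _ => rfl, fun _ _ => rfl⟩
    · rw [hlow _ (by omega)]; exact r.cM
    · rw [hlow _ (by omega)]; exact r.cB
    · rw [hlow _ (by omega)]; exact r.cZ
    · rw [hlow _ (by omega)]; exact r.cOff
    · rw [hlow _ (by omega)]; exact r.cMed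
    · intro x hx; rw [hlow _ (by omega)]; exact r.v x hx
    · intro f hf; rw [hlow _ (by omega)]; exact r.tag f (by omega)
    · intro b hb j hj
      have : b * p.M ≤ 1 * p.M := Nat.mul_le_mul_right _ (by omega)
      rw [hlow _ (by omega)]; exact r.arr b hb j hj
    · intro f hf j hj
      have := hbl f hf
      rw [hlow _ (by omega)]; exact r.buf f (by omega) j hj
    · intro f hf l hl j hj hne
      have h1 : (f * p.Z + l + 1) * p.B ≤ 9 * p.Z * p.B := by
        refine Nat.mul_le_mul_right _ ?_
        have : f * p.Z ≤ 8 * p.Z := Nat.mul_le_mul_right _ (by omega)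
        omega
      have h2 : 9 * p.Z * p.B ≤ (9 * p.Z + a.tag 9) * p.B := Nat.mul_le_mul_right _ (by omega)
      rw [add_mul _ 1] at h1
      rw [sh1.memLow _ (by omega)]
      simp only [hσ1, State.flush]
      rw [if_neg (by omega)]
      exact r.mem f (by omega) l hl j hj hne
  refine ⟨_, _, _, ?_, rep1.setv (by omega) hx⟩
  have := Run.seq w1 (Run.seq a1 (Run.seq a2 (Run.seq a3 (Run.seq a4 (Run.seq hρ1 hfin)))))
  rw [show k + 1 = 1 + (0 + (0 + (0 + (0 + (k + 0))))) by omega]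
  exact this

/-! ### Distances from potentials -/

section potential
variable {V : Type*} {G : SimpleGraph V}

theorem le_length_of_lipschitz {φ : V → ℕ} (hL : ∀ x y, G.Adj x y → φ y ≤ φ x + 1) {x y : V}
    (w : G.Walk x y) : φ y ≤ φ x + w.length := by
  induction w with
  | nil => simp
  | cons h w ih =>
    have := hL _ _ h
    rw [SimpleGraph.Walk.length_cons]; omega

theorem reachable_of_descent {φ : V → ℕ} {a : V} (ha : ∀ x, φ x = 0 → x = a)
    (hD : ∀ x, φ x ≠ 0 → ∃ y, G.Adj y x ∧ φ y + 1 = φ x) (x : V) :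
    ∃ w : G.Walk a x, w.length = φ x := by
  induction hk : φ x generalizing x with
  | zero => obtain rfl := ha x hk; exact ⟨.nil, rfl⟩
  | succ k ih =>
    obtain ⟨y, hy, e⟩ := hD x (by omega)
    obtain ⟨w, hw⟩ := ih y (by omega)
    exact ⟨w.concat hy, by rw [SimpleGraph.Walk.length_concat, hw]⟩

/-- A function that vanishes exactly at `a`, changes by at most one along edges, and decreases along
some edge at every other vertex is the distance from `a`. -/
theorem dist_eq_of_potential {φ : V → ℕ} {a : V} (h0 : φ a = 0) (ha : ∀ x, φ x = 0 → x = a)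
    (hL : ∀ x y, G.Adj x y → φ y ≤ φ x + 1)
    (hD : ∀ x, φ x ≠ 0 → ∃ y, G.Adj y x ∧ φ y + 1 = φ x) (x : V) : G.dist a x = φ x := by
  obtain ⟨w, hw⟩ := reachable_of_descent ha hD x
  refine le_antisymm (hw ▸ SimpleGraph.dist_le w) ?_
  obtain ⟨p, hp⟩ := w.reachable.exists_walk_length_eq_dist
  have := le_length_of_lipschitz hL p
  omega

end potential

/-! ### Radius at most three -/

/-- `Near G v w`: the vertices are equal or adjacent. -/
def Near {V : Type*} (G : SimpleGraph V) (v w : V) : Prop := v = w ∨ G.Adj v w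

/-- There is a walk of length at most two. -/
def Near2 {V : Type*} (G : SimpleGraph V) (v u : V) : Prop := ∃ w, Near G v w ∧ Near G w u

/-- There is a walk of length at most three. -/
def Near3 {V : Type*} (G : SimpleGraph V) (v u : V) : Prop := ∃ w, Near2 G v w ∧ Near G w u

section near
variable {V : Type*} {G : SimpleGraph V}

theorem Near.symm {v w : V} (h : Near G v w) : Near G w v := h.imp Eq.symm fun h => h.symm

theorem near_refl (v : V) : Near G v v := Or.inl rfl

theorem Near.edist_le {v w : V} (h : Near G v w) : G.edist v w ≤ 1 := by
  rcases h with rfl | h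
  · simp
  · exact SimpleGraph.edist_le_one_iff_adj_or_eq.2 (Or.inl h)

theorem near3_of_walk {v u : V} (p : G.Walk v u) (hp : p.length ≤ 3) : Near3 G v u := by
  have r := near_refl (G := G)
  match p with
  | .nil => exact ⟨v, ⟨v, r v, r v⟩, r v⟩
  | .cons h .nil => exact ⟨v, ⟨v, r v, r v⟩, .inr h⟩
  | .cons h (.cons h' .nil) => exact ⟨_, ⟨v, r v, .inr h⟩, .inr h'⟩
  | .cons h (.cons h' (.cons h'' .nil)) => exact ⟨_, ⟨_, .inr h, .inr h'⟩, .inr h''⟩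
  | .cons h (.cons h' (.cons h'' (.cons h3 p))) =>
    simp only [SimpleGraph.Walk.length_cons] at hp; omega

theorem near3_iff_edist_le {v u : V} : Near3 G v u ↔ G.edist v u ≤ 3 := by
  constructor
  · rintro ⟨w, ⟨x, h1, h2⟩, h3⟩
    calc G.edist v u ≤ G.edist v w + G.edist w u := SimpleGraph.edist_triangle
      _ ≤ (G.edist v x + G.edist x w) + G.edist w u := by gcongr; exact SimpleGraph.edist_triangle
      _ ≤ (1 + 1) + 1 := by gcongr <;> exact Near.edist_le ‹_›
      _ = 3 := by norm_num
  · intro h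
    have hne : G.edist v u ≠ ⊤ := ne_top_of_le_ne_top (by decide) h
    obtain ⟨p, hp⟩ := (SimpleGraph.edist_ne_top_iff_reachable.1 hne).exists_walk_length_eq_edist
    rw [← hp] at h
    exact near3_of_walk p (by exact_mod_cast h)

theorem radius_le_three_iff [Finite V] : G.radius ≤ 3 ↔ ∃ v, ∀ u, Near3 G v u := by
  constructor
  · intro h
    rcases isEmpty_or_nonempty V with hV | hV
    · rw [SimpleGraph.radius_eq_top_of_isEmpty] at h
      exact absurd h (by decide)
    · obtain ⟨v, hv⟩ := G.exists_eccent_eq_radius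
      exact ⟨v, fun u => near3_iff_edist_le.2
        ((SimpleGraph.edist_le_eccent).trans (hv.trans_le h))⟩
  · rintro ⟨v, hv⟩
    exact SimpleGraph.radius_le_eccent.trans
      (iSup_le fun u => near3_iff_edist_le.1 (hv u) : G.eccent v ≤ 3)

end near

/-! ### The gadget graph -/

/-- Vertices of the gadget graph for a graph with `n` vertices: four copies `a, b, c, d` of its vertex
set; the counter vertices `l, x` for the low digit and `h, y` for the high digit of numbers in base
`Q`, where the vertices `y` are numbered from `0` to `Q * Q - 1`; three hubs with `N` pendant vertices
each; and one further vertex `star`. -/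
inductive Vtx (n Q N : ℕ) : Type
  | a (v : Fin n) : Vtx n Q N
  | b (v : Fin n) : Vtx n Q N
  | c (v : Fin n) : Vtx n Q N
  | d (v : Fin n) : Vtx n Q N
  | l (i : Fin Q) : Vtx n Q N
  | x (i : Fin Q) : Vtx n Q N
  | h (i : Fin Q) : Vtx n Q N
  | y (i : Fin (Q * Q)) : Vtx n Q N
  | hub (i : Fin 3) : Vtx n Q N
  | star : Vtx n Q N
  | pend (i : Fin N) (j : Fin 3) : Vtx n Q N

namespace Vtx
variable {n Q N : ℕ}

/-- The vertices of the gadget graph as a disjoint union. -/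
def equivSum : Vtx n Q N ≃ (Fin n ⊕ Fin n ⊕ Fin n ⊕ Fin n) ⊕ (Fin Q ⊕ Fin Q ⊕ Fin Q ⊕ Fin (Q * Q)) ⊕
    Fin 3 ⊕ Unit ⊕ (Fin N × Fin 3) where
  toFun
    | a v => .inl (.inl v)
    | b v => .inl (.inr (.inl v))
    | c v => .inl (.inr (.inr (.inl v)))
    | d v => .inl (.inr (.inr (.inr v)))
    | l i => .inr (.inl (.inl i))
    | x i => .inr (.inl (.inr (.inl i)))
    | h i => .inr (.inl (.inr (.inr (.inl i))))
    | y i => .inr (.inl (.inr (.inr (.inr i))))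
    | hub i => .inr (.inr (.inl i))
    | star => .inr (.inr (.inr (.inl ())))
    | pend i j => .inr (.inr (.inr (.inr (i, j))))
  invFun
    | .inl (.inl v) => a v
    | .inl (.inr (.inl v)) => b v
    | .inl (.inr (.inr (.inl v))) => c v
    | .inl (.inr (.inr (.inr v))) => d v
    | .inr (.inl (.inl i)) => l i
    | .inr (.inl (.inr (.inl i))) => x i
    | .inr (.inl (.inr (.inr (.inl i)))) => h i
    | .inr (.inl (.inr (.inr (.inr i)))) => y i
    | .inr (.inr (.inl i)) => hub i
    | .inr (.inr (.inr (.inl _))) => star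
    | .inr (.inr (.inr (.inr (i, j)))) => pend i j
  left_inv z := by cases z <;> rfl
  right_inv z := by rcases z with (_ | _ | _ | _) | (_ | _ | _ | _) | _ | _ | _ <;> rfl

noncomputable instance : Fintype (Vtx n Q N) := Fintype.ofEquiv _ equivSum.symm

theorem sum_eq (f : Vtx n Q N → ℕ) : ∑ z, f z =
    (∑ v, f (a v) + (∑ v, f (b v) + (∑ v, f (c v) + ∑ v, f (d v)))) +
    ((∑ i, f (l i) + (∑ i, f (x i) + (∑ i, f (h i) + ∑ i, f (y i)))) +
      (∑ i, f (hub i) + (f star + ∑ i, ∑ j, f (pend i j)))) := by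
  rw [← equivSum.symm.sum_comp f]
  simp only [Fintype.sum_sum_type, Fintype.sum_prod_type, Finset.univ_unique, Finset.sum_singleton]
  rfl

end Vtx

/-- The number of vertices of the gadget graph that are not pendant. -/
def coreSize (n Q : ℕ) : ℕ := 4 * n + 3 * Q + Q * Q + 4

theorem Vtx.card (n Q N : ℕ) : Fintype.card (Vtx n Q N) = coreSize n Q + 3 * N := by
  rw [Fintype.card_eq_sum_ones, Vtx.sum_eq]
  simp [coreSize]
  omega

section gadget
variable {n Q N : ℕ} (G : SimpleGraph (Fin n)) (lo hi : Fin n → Fin Q)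

/-- The edges of the gadget graph, directed away from the layer of `a` and `star`.  A digit vertex `l i`
is adjacent to the `i + 1` vertices `x j` with `j ≤ i`, and `h i` is adjacent to the first vertices of
`i + 1` rows of `Q` vertices `y`; the vertex `star` keeps all distances from `a v` small. -/
inductive GadgetEdge : Vtx n Q N → Vtx n Q N → Prop
  | ab {v w : Fin n} (h : Near G v w) : GadgetEdge (.a v) (.b w)
  | bc {v w : Fin n} (h : Near G v w) : GadgetEdge (.b v) (.c w)
  | cd {v w : Fin n} (h : Near G v w) : GadgetEdge (.c v) (.d w)
  | aHub (v : Fin n) (i : Fin 3) : GadgetEdge (.a v) (.hub i)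
  | al (v : Fin n) : GadgetEdge (.a v) (.l (lo v))
  | ah (v : Fin n) : GadgetEdge (.a v) (.h (hi v))
  | starB (v : Fin n) : GadgetEdge .star (.b v)
  | starHub : GadgetEdge .star (.hub 0)
  | starL (i : Fin Q) : GadgetEdge .star (.l i)
  | starH (i : Fin Q) : GadgetEdge .star (.h i)
  | lx {i j : Fin Q} (h : j ≤ i) : GadgetEdge (.l i) (.x j)
  | hy {i : Fin Q} {r : Fin (Q * Q)} (h0 : (r : ℕ) % Q = 0) (h : (r : ℕ) / Q ≤ i) :
      GadgetEdge (.h i) (.y r)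
  | yy {r t : Fin (Q * Q)} (hr : (r : ℕ) % Q = 0) (ht : (t : ℕ) % Q ≠ 0)
      (h : (r : ℕ) / Q = (t : ℕ) / Q) : GadgetEdge (.y r) (.y t)
  | hubPend (i : Fin N) (j : Fin 3) : GadgetEdge (.hub j) (.pend i j)

/-- The gadget graph. -/
def gadget : SimpleGraph (Vtx n Q N) := SimpleGraph.fromRel (GadgetEdge G lo hi)

variable {G lo hi}

theorem GadgetEdge.ne {z w : Vtx n Q N} (h : GadgetEdge G lo hi z w) : z ≠ w := by
  cases h with
  | yy hr ht h => rintro ⟨⟩; exact ht hr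
  | _ => simp

theorem GadgetEdge.adj {z w : Vtx n Q N} (h : GadgetEdge G lo hi z w) :
    (gadget G lo hi).Adj z w := ⟨h.ne, Or.inl h⟩

theorem gadget_lipschitz {φ : Vtx n Q N → ℕ}
    (h : ∀ z w, GadgetEdge G lo hi z w → φ w ≤ φ z + 1 ∧ φ z ≤ φ w + 1) (z w : Vtx n Q N)
    (hzw : (gadget G lo hi).Adj z w) : φ w ≤ φ z + 1 := by
  rcases hzw.2 with e | e
  · exact (h _ _ e).1
  · exact (h _ _ e).2

variable (G lo hi)

open Classical in
/-- The distances from `a v` in the gadget graph. -/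
noncomputable def gadgetDist (v : Fin n) : Vtx n Q N → ℕ
  | .a u => if u = v then 0 else 2
  | .b u => if Near G v u then 1 else 3
  | .c u => if Near2 G v u then 2 else 4
  | .d u => if Near3 G v u then 3 else 5
  | .l i => if i = lo v then 1 else 3
  | .x j => if j ≤ lo v then 2 else 4
  | .h i => if i = hi v then 1 else 3
  | .y r => (if (r : ℕ) / Q ≤ hi v then 0 else 2) + if (r : ℕ) % Q = 0 then 2 else 3
  | .hub _ => 1
  | .star => 2
  | .pend _ _ => 2

theorem gadgetDist_edge (v : Fin n) (z w : Vtx n Q N) (h : GadgetEdge G lo hi z w) :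
    gadgetDist G lo hi v w ≤ gadgetDist G lo hi v z + 1 ∧
      gadgetDist G lo hi v z ≤ gadgetDist G lo hi v w + 1 := by
  cases h with
  | @ab u w hr =>
    simp only [gadgetDist]
    by_cases hu : u = v
    · subst hu; simp [hr]
    · split_ifs <;> omega
  | @bc u w hr =>
    simp only [gadgetDist]
    have : Near G v u → Near2 G v w := fun h => ⟨u, h, hr⟩
    split_ifs <;> first | omega | tauto
  | @cd u w hr =>
    simp only [gadgetDist]
    have : Near2 G v u → Near3 G v w := fun h => ⟨u, h, hr⟩
    split_ifs <;> first | omega | tauto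
  | al u =>
    simp only [gadgetDist]
    by_cases hu : u = v
    · subst hu; simp
    · split_ifs <;> omega
  | ah u =>
    simp only [gadgetDist]
    by_cases hu : u = v
    · subst hu; simp
    · split_ifs <;> omega
  | @lx i j hij =>
    simp only [gadgetDist]
    split_ifs with h1 h2 h2
    any_goals omega
  | @hy i r h0 hr =>
    simp only [gadgetDist, h0, if_true]
    split_ifs with h1 h2 h2
    any_goals omega
  | yy hr ht hrt =>
    simp only [gadgetDist, hr, ht, hrt, if_true, if_false]
    split_ifs <;> omega
  | aHub | starB | starHub | starL | starH | hubPend =>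
    simp only [gadgetDist]
    first | omega | (split_ifs <;> omega)

theorem gadgetDist_descent (v : Fin n) (z : Vtx n Q N) (hz : gadgetDist G lo hi v z ≠ 0) :
    ∃ w, (gadget G lo hi).Adj w z ∧ gadgetDist G lo hi v w + 1 = gadgetDist G lo hi v z := by
  have hn := near_refl (G := G)
  cases z with
  | a u =>
    refine ⟨.hub 0, (GadgetEdge.aHub u 0).adj.symm, ?_⟩
    by_cases hu : u = v
    · simp [gadgetDist, hu] at hz
    · simp [gadgetDist, hu]
  | b u =>
    by_cases hu : Near G v u
    · exact ⟨.a v, (GadgetEdge.ab hu).adj, by simp [gadgetDist, hu]⟩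
    · exact ⟨.star, (GadgetEdge.starB u).adj, by simp [gadgetDist, hu]⟩
  | c u =>
    by_cases hu : Near2 G v u
    · obtain ⟨w, h1, h2⟩ := id hu
      exact ⟨.b w, (GadgetEdge.bc h2).adj, by simp [gadgetDist, hu, h1]⟩
    · have : ¬ Near G v u := fun h => hu ⟨u, h, hn u⟩
      exact ⟨.b u, (GadgetEdge.bc (hn u)).adj, by simp [gadgetDist, hu, this]⟩
  | d u =>
    by_cases hu : Near3 G v u
    · obtain ⟨w, h1, h2⟩ := id hu
      exact ⟨.c w, (GadgetEdge.cd h2).adj, by simp [gadgetDist, hu, h1]⟩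
    · have : ¬ Near2 G v u := fun h => hu ⟨u, h, hn u⟩
      exact ⟨.c u, (GadgetEdge.cd (hn u)).adj, by simp [gadgetDist, hu, this]⟩
  | l i =>
    by_cases hi' : i = lo v
    · subst hi'; exact ⟨.a v, (GadgetEdge.al v).adj, by simp [gadgetDist]⟩
    · exact ⟨.star, (GadgetEdge.starL i).adj, by simp [gadgetDist, hi']⟩
  | x j =>
    by_cases hj : j ≤ lo v
    · exact ⟨.l (lo v), (GadgetEdge.lx hj).adj, by simp [gadgetDist, hj]⟩
    · have : j ≠ lo v := fun h => hj h.le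
      exact ⟨.l j, (GadgetEdge.lx le_rfl).adj, by simp [gadgetDist, hj, this]⟩
  | h i =>
    by_cases hi' : i = hi v
    · subst hi'; exact ⟨.a v, (GadgetEdge.ah v).adj, by simp [gadgetDist]⟩
    · exact ⟨.star, (GadgetEdge.starH i).adj, by simp [gadgetDist, hi']⟩
  | y r =>
    have hQ : 0 < Q := by
      rcases Nat.eq_zero_or_pos Q with h | h
      · subst h; exact (lo v).elim0
      · exact h
    by_cases h0 : (r : ℕ) % Q = 0
    · by_cases hr : (r : ℕ) / Q ≤ hi v
      · exact ⟨.h (hi v), (GadgetEdge.hy h0 hr).adj, by simp [gadgetDist, h0, hr]⟩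
      · have hlt : (r : ℕ) / Q < Q := Nat.div_lt_of_lt_mul r.2
        have : (⟨(r : ℕ) / Q, hlt⟩ : Fin Q) ≠ hi v := by
          intro h; apply hr; rw [← h]
        exact ⟨.h ⟨(r : ℕ) / Q, hlt⟩, (GadgetEdge.hy h0 le_rfl).adj,
          by simp [gadgetDist, h0, hr, this]⟩
    · have hle : (r : ℕ) / Q * Q ≤ r := Nat.div_mul_le_self _ _
      refine ⟨.y ⟨(r : ℕ) / Q * Q, lt_of_le_of_lt hle r.2⟩,
        (GadgetEdge.yy (Nat.mul_mod_left _ _) h0 (Nat.mul_div_cancel _ hQ)).adj, ?_⟩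
      simp only [gadgetDist, Nat.mul_mod_left, Nat.mul_div_cancel _ hQ, h0, if_true, if_false]
  | hub i => exact ⟨.a v, (GadgetEdge.aHub v i).adj, by simp [gadgetDist]⟩
  | star => exact ⟨.hub 0, GadgetEdge.starHub.adj.symm, by simp [gadgetDist]⟩
  | pend i j => exact ⟨.hub j, (GadgetEdge.hubPend i j).adj, by simp [gadgetDist]⟩

theorem eq_a_of_gadgetDist_eq_zero (v : Fin n) (z : Vtx n Q N) (hz : gadgetDist G lo hi v z = 0) :
    z = .a v := by
  cases z <;> simp only [gadgetDist] at hz <;> first | omega | (split_ifs at hz <;> simp_all)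

theorem gadget_dist_a (v : Fin n) (z : Vtx n Q N) :
    (gadget G lo hi).dist (.a v) z = gadgetDist G lo hi v z :=
  dist_eq_of_potential (by simp [gadgetDist]) (eq_a_of_gadgetDist_eq_zero G lo hi v)
    (gadget_lipschitz (gadgetDist_edge G lo hi v)) (gadgetDist_descent G lo hi v) z

theorem gadget_connected (v : Fin n) : (gadget G lo hi : SimpleGraph (Vtx n Q N)).Connected := by
  have hr : ∀ z, (gadget G lo hi : SimpleGraph (Vtx n Q N)).Reachable (.a v) z := fun z =>
    (reachable_of_descent (eq_a_of_gadgetDist_eq_zero G lo hi v)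
      (gadgetDist_descent G lo hi v) z).choose.reachable
  have : Nonempty (Vtx n Q N) := ⟨.a v⟩
  exact ⟨fun z w => (hr z).symm.trans (hr w)⟩

open Classical in
/-- A lower bound for the distance from `pend i j`. -/
noncomputable def pendBound (i : Fin N) (j : Fin 3) : Vtx n Q N → ℕ
  | .a _ => 2
  | .hub j' => if j' = j then 1 else 3
  | .star => if j = 0 then 2 else 3
  | .pend i' j' => if j' = j then (if i' = i then 0 else 2) else 4
  | _ => 3

theorem pendBound_edge (i : Fin N) (j : Fin 3) (z w : Vtx n Q N) (h : GadgetEdge G lo hi z w) :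
    pendBound i j w ≤ pendBound i j z + 1 ∧ pendBound i j z ≤ pendBound i j w + 1 := by
  cases h <;> simp only [pendBound] <;> first | omega | (split_ifs <;> omega)

theorem pendBound_le_dist (v : Fin n) (i : Fin N) (j : Fin 3) (z : Vtx n Q N) :
    pendBound i j z ≤ (gadget G lo hi).dist z (.pend i j) := by
  rw [SimpleGraph.dist_comm]
  obtain ⟨p, hp⟩ := (gadget_connected G lo hi v).exists_walk_length_eq_dist (.pend i j) z
  have := le_length_of_lipschitz (gadget_lipschitz (pendBound_edge G lo hi i j)) p
  have h0 : pendBound i j (.pend i j : Vtx n Q N) = 0 := by simp [pendBound]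
  omega

/-- The three pendant vertices with the same number are together at distance at least `7` from
vertices outside the layer `a`, as opposed to `6` for vertices of this layer. -/
theorem seven_le_pendBound (i : Fin N) (z : Vtx n Q N) (hz : ∀ v, z ≠ .a v) :
    7 ≤ ∑ j, pendBound i j z := by
  rw [Fin.sum_univ_three]
  cases z with
  | a v => exact absurd rfl (hz v)
  | hub j => fin_cases j <;> simp [pendBound]
  | star => simp [pendBound]
  | pend i' j => fin_cases j <;> simp [pendBound] <;> omega
  | _ => simp [pendBound]

/-- The sum of the distances from a vertex. -/
noncomputable def distSum {V : Type*} [Fintype V] (G : SimpleGraph V) (z : V) : ℕ :=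
  ∑ w, G.dist z w

theorem le_distSum (v : Fin n) (z : Vtx n Q N) (hz : ∀ v, z ≠ .a v) :
    7 * N ≤ distSum (gadget G lo hi) z := by
  have h1 : ∑ _i : Fin N, 7 ≤ ∑ i : Fin N, ∑ j, (gadget G lo hi).dist z (.pend i j) :=
    Finset.sum_le_sum fun i _ => (seven_le_pendBound i z hz).trans
      (Finset.sum_le_sum fun j _ => pendBound_le_dist G lo hi v i j z)
  rw [distSum, Vtx.sum_eq]
  simp only [Finset.sum_const, Finset.card_univ, Fintype.card_fin, smul_eq_mul] at h1
  omega

theorem distSum_a_le (v : Fin n) :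
    distSum (gadget G lo hi : SimpleGraph (Vtx n Q N)) (.a v) ≤ 6 * N + 5 * coreSize n Q := by
  have h5 : ∀ z : Vtx n Q N, gadgetDist G lo hi v z ≤ 5 := by
    intro z
    cases z <;> simp only [gadgetDist] <;> first | omega | (split_ifs <;> omega)
  simp only [distSum, gadget_dist_a]
  rw [Vtx.sum_eq]
  have hb : ∀ {m : ℕ} (f : Fin m → Vtx n Q N), ∑ i, gadgetDist G lo hi v (f i) ≤ m * 5 :=
    fun f => (Finset.sum_le_sum fun i _ => h5 (f i)).trans (by simp)
  have hp : ∑ i : Fin N, ∑ j : Fin 3, gadgetDist G lo hi v (.pend i j : Vtx n Q N) = 6 * N := by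
    simp [gadgetDist]; omega
  have := hb Vtx.a
  have := hb Vtx.b
  have := hb Vtx.c
  have := hb Vtx.d
  have := hb Vtx.l
  have := hb Vtx.x
  have := hb Vtx.h
  have := hb Vtx.y
  have := hb Vtx.hub
  have := h5 Vtx.star
  rw [hp, coreSize]
  omega

theorem sum_ite_add_two {m : ℕ} (P : Fin m → Prop) [DecidablePred P] (k : ℕ) :
    ∑ i, (if P i then k else k + 2) + 2 * (Finset.univ.filter P).card = m * (k + 2) := by
  have : ∀ i, (if P i then k else k + 2) + 2 * (if P i then 1 else 0) = k + 2 := by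
    intro i; split_ifs <;> omega
  rw [Finset.card_filter, Finset.mul_sum, ← Finset.sum_add_distrib, Finset.sum_congr rfl
    fun i _ => this i]
  simp

open Classical in
/-- The number of vertices within distance one. -/
noncomputable def ball1 (v : Fin n) : ℕ := (Finset.univ.filter (Near G v)).card

open Classical in
/-- The number of vertices within distance two. -/
noncomputable def ball2 (v : Fin n) : ℕ := (Finset.univ.filter (Near2 G v)).card

open Classical in
/-- The number of vertices within distance three. -/
noncomputable def ball3 (v : Fin n) : ℕ := (Finset.univ.filter (Near3 G v)).card

theorem card_fin_filter_lt {m k : ℕ} (hk : k ≤ m) [DecidablePred fun i : Fin m => (i : ℕ) < k] :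
    (Finset.univ.filter fun i : Fin m => (i : ℕ) < k).card = k := by
  have := Fin.card_filter_val_lt (m := k) (n := m)
  rw [min_eq_right hk] at this
  convert this

/-- The distance sums of the vertices `a v`, up to a constant: by `gadgetDist`, every vertex within the
distance in question and every unit of the encoded number reduces a distance by two. -/
theorem distSum_a (v : Fin n) :
    distSum (gadget G lo hi : SimpleGraph (Vtx n Q N)) (.a v) +
      2 * (ball1 G v + ball2 G v + ball3 G v + (lo v + hi v * Q)) =
    14 * n + 10 * Q + ∑ r : Fin (Q * Q), (2 + if (r : ℕ) % Q = 0 then 2 else 3) + 6 * N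
      - 2 * Q - 3 := by
  classical
  simp only [distSum, gadget_dist_a]
  rw [Vtx.sum_eq]
  have hQ : 0 < Q := by
    rcases Nat.eq_zero_or_pos Q with h | h
    · subst h; exact (lo v).elim0
    · exact h
  have hp : ∑ i : Fin N, ∑ j : Fin 3, gadgetDist G lo hi v (.pend i j : Vtx n Q N) = 6 * N := by
    simp [gadgetDist]; omega
  have hh : ∑ i : Fin 3, gadgetDist G lo hi v (.hub i : Vtx n Q N) = 3 := by simp [gadgetDist]
  have hs : gadgetDist G lo hi v (.star : Vtx n Q N) = 2 := rfl
  have ha : ∑ u, gadgetDist G lo hi v (.a u : Vtx n Q N) + 2 = n * 2 := by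
    have := sum_ite_add_two (fun u => u = v) 0
    simpa [gadgetDist, Finset.filter_eq'] using this
  have hb : ∑ u, gadgetDist G lo hi v (.b u : Vtx n Q N) + 2 * ball1 G v = n * 3 :=
    sum_ite_add_two (fun u => Near G v u) 1
  have hc : ∑ u, gadgetDist G lo hi v (.c u : Vtx n Q N) + 2 * ball2 G v = n * 4 :=
    sum_ite_add_two (fun u => Near2 G v u) 2
  have hd : ∑ u, gadgetDist G lo hi v (.d u : Vtx n Q N) + 2 * ball3 G v = n * 5 :=
    sum_ite_add_two (fun u => Near3 G v u) 3
  have hl : ∑ u, gadgetDist G lo hi v (.l u : Vtx n Q N) + 2 = Q * 3 := by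
    have := sum_ite_add_two (fun u => u = lo v) 1
    simpa [gadgetDist, Finset.filter_eq'] using this
  have hhh : ∑ u, gadgetDist G lo hi v (.h u : Vtx n Q N) + 2 = Q * 3 := by
    have := sum_ite_add_two (fun u => u = hi v) 1
    simpa [gadgetDist, Finset.filter_eq'] using this
  have hx : ∑ u, gadgetDist G lo hi v (.x u : Vtx n Q N) + 2 * (lo v + 1) = Q * 4 := by
    have := sum_ite_add_two (fun u => u ≤ lo v) 2
    have e : (Finset.univ.filter fun u => u ≤ lo v).card = (lo v : ℕ) + 1 := by
      rw [← card_fin_filter_lt (m := Q) (k := lo v + 1) (lo v).2]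
      congr 1
      ext u
      simp only [Finset.mem_filter, Finset.mem_univ, true_and, Fin.le_def]
      omega
    rw [e] at this
    exact this
  have hy : ∑ u, gadgetDist G lo hi v (.y u : Vtx n Q N) + 2 * ((hi v + 1) * Q) =
      ∑ r : Fin (Q * Q), (2 + if (r : ℕ) % Q = 0 then 2 else 3) := by
    have := sum_ite_add_two (fun u : Fin (Q * Q) => (u : ℕ) / Q ≤ hi v) 0
    have e : (Finset.univ.filter fun u : Fin (Q * Q) => (u : ℕ) / Q ≤ hi v).card
        = (hi v + 1) * Q := by
      rw [← card_fin_filter_lt (m := Q * Q) (k := (hi v + 1) * Q)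
        (Nat.mul_le_mul_right _ (by omega))]
      congr 1
      ext u
      simp [← Nat.div_lt_iff_lt_mul hQ]
    rw [e] at this
    simp only [gadgetDist, Finset.sum_add_distrib]
    simp only [zero_add] at this
    simp only [Finset.sum_const, Finset.card_univ, Fintype.card_fin, smul_eq_mul]
    omega
  rw [add_mul] at hy
  rw [hp, hh, hs]
  omega

/-- If the digits `lo v` and `hi v` complement the sizes of the balls of radius one and two, and if
there are enough pendant vertices, then a median of the gadget graph is a vertex `a v` such that `v`
has as many vertices within distance three as possible. -/
theorem near3_of_median (hdig : ∀ v, ball1 G v + ball2 G v + (lo v + hi v * Q) = 2 * n)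
    (hN : 5 * coreSize n Q < N) {z : Vtx n Q N}
    (hz : ∀ w : Vtx n Q N, distSum (gadget G lo hi) z ≤ distSum (gadget G lo hi) w)
    {v : Fin n} (hv : ∀ u, Near3 G v u) : ∃ v', z = .a v' ∧ ∀ u, Near3 G v' u := by
  classical
  have h1 := distSum_a_le G lo hi (N := N) v
  by_cases hza : ∀ v', z ≠ .a v'
  · have := le_distSum G lo hi v z hza
    have := hz (.a v)
    omega
  · push Not at hza
    obtain ⟨v', rfl⟩ := hza
    refine ⟨v', rfl, ?_⟩
    have e1 := distSum_a G lo hi (N := N) v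
    have e2 := distSum_a G lo hi (N := N) v'
    have e3 := hdig v
    have e4 := hdig v'
    have e5 := hz (.a v)
    have e6 : ball3 G v = n := by
      rw [ball3, Finset.filter_true_of_mem fun u _ => hv u]; simp
    have e7 : n ≤ ball3 G v' := by omega
    intro u
    rw [ball3] at e7
    have e8 : Finset.univ.filter (Near3 G v') = Finset.univ :=
      Finset.eq_univ_of_card _ (le_antisymm (Finset.card_le_univ _)
        (by rw [Fintype.card_fin]; convert e7))
    have := Finset.mem_univ u
    rw [← e8] at this
    exact (Finset.mem_filter.1 this).2

end gadget

/-! ### Reasoning about commands -/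

section simps
variable (a : AState) (p : Par) (x k b i f : ℕ) (c : Prop)
@[simp] theorem setv_v : (a.setv p x k).v = Function.update a.v x k := rfl
@[simp] theorem setv_arr : (a.setv p x k).arr = a.arr := rfl
@[simp] theorem setv_file : (a.setv p x k).file = a.file := rfl
@[simp] theorem setv_tag : (a.setv p x k).tag = a.tag := rfl
@[simp] theorem setv_io : (a.setv p x k).io = a.io := rfl
@[simp] theorem setv_ok : (a.setv p x k).ok = (a.ok ∧ k < p.W) := rfl
@[simp] theorem setArr_v : (a.setArr p b i k).v = a.v := rfl
@[simp] theorem setArr_arr : (a.setArr p b i k).arr =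
    Function.update a.arr b (Function.update (a.arr b) i k) := rfl
@[simp] theorem setArr_file : (a.setArr p b i k).file = a.file := rfl
@[simp] theorem setArr_tag : (a.setArr p b i k).tag = a.tag := rfl
@[simp] theorem setArr_io : (a.setArr p b i k).io = a.io := rfl
@[simp] theorem setArr_ok : (a.setArr p b i k).ok = (a.ok ∧ i < p.M ∧ k < p.W) := rfl
@[simp] theorem touch_v : (a.touch p f i).v = a.v := rfl
@[simp] theorem touch_arr : (a.touch p f i).arr = a.arr := rfl
@[simp] theorem touch_file : (a.touch p f i).file = a.file := rfl
@[simp] theorem touch_ok : (a.touch p f i).ok = (a.ok ∧ i < p.Z) := rfl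
@[simp] theorem setFile_v : (a.setFile p f i k).v = a.v := rfl
@[simp] theorem setFile_arr : (a.setFile p f i k).arr = a.arr := rfl
@[simp] theorem setFile_file : (a.setFile p f i k).file =
    Function.update a.file f (Function.update (a.file f) i k) := rfl
@[simp] theorem setFile_tag : (a.setFile p f i k).tag = a.tag := rfl
@[simp] theorem setFile_io : (a.setFile p f i k).io = a.io := rfl
@[simp] theorem setFile_ok : (a.setFile p f i k).ok = (a.ok ∧ k < p.W) := rfl
@[simp] theorem require_v : (a.require c).v = a.v := rfl
@[simp] theorem require_arr : (a.require c).arr = a.arr := rfl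
@[simp] theorem require_file : (a.require c).file = a.file := rfl
@[simp] theorem require_tag : (a.require c).tag = a.tag := rfl
@[simp] theorem require_io : (a.require c).io = a.io := rfl
@[simp] theorem require_ok : (a.require c).ok = (a.ok ∧ c) := rfl
end simps

/-- `a` has been obtained from `a₀` by accesses to file `f` at nondecreasing indices up to `q`, which
took as many I/Os as the change of the buffered line permits. -/
def Scan (p : Par) (f : ℕ) (a₀ : AState) (q : ℕ) (a : AState) : Prop :=
  a.io f = a₀.io f ∨ a.tag f ≤ q / p.B ∧ a.io f ≤ a₀.io f + 2 + 2 * a.tag f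

section scan
variable {p : Par} {f q i x k : ℕ} {a₀ a a' : AState}

theorem Scan.refl (a : AState) (q : ℕ) : Scan p f a q a := Or.inl rfl

theorem Scan.congr (h : Scan p f a₀ q a) (hio : a'.io f = a.io f) (ht : a'.tag f = a.tag f) :
    Scan p f a₀ q a' := by
  unfold Scan; rw [hio, ht]; exact h

theorem Scan.mono {q' : ℕ} (h : Scan p f a₀ q a) (hq : q ≤ q') : Scan p f a₀ q' a :=
  h.imp_right fun h => ⟨h.1.trans (Nat.div_le_div_right hq), h.2⟩

theorem Scan.touch (h : Scan p f a₀ q a) (hq : q ≤ i) : Scan p f a₀ i (a.touch p f i) := by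
  have hd : q / p.B ≤ i / p.B := Nat.div_le_div_right hq
  right
  simp only [AState.touch, Function.update_self]
  refine ⟨le_rfl, ?_⟩
  rcases h with h | h <;> split_ifs <;> omega

theorem Scan.touch_ne {g : ℕ} (h : Scan p f a₀ q a) (hg : f ≠ g) :
    Scan p f a₀ q (a.touch p g i) :=
  h.congr (by simp [AState.touch, hg]) (by simp [AState.touch, hg])

theorem Scan.io_le (h : Scan p f a₀ q a) : a.io f ≤ a₀.io f + 2 + 2 * (q / p.B) := by
  rcases h with h | h <;> omega

theorem Scan.exec (h : Scan p f a₀ q a) (c : Cmd) (hc : c.usesFile f = false) :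
    Scan p f a₀ q (c.exec p a) :=
  h.congr (c.exec_frame_io p f a hc).1 (c.exec_frame_io p f a hc).2

theorem Scan.setFile {g : ℕ} (h : Scan p f a₀ q a) : Scan p f a₀ q (a.setFile p g x k) := h

theorem Scan.setArr {g : ℕ} (h : Scan p f a₀ q a) : Scan p f a₀ q (a.setArr p g x k) := h

end scan

/-- What a loop with counter `x` and body `c` leaves unchanged. -/
structure Frame (x : ℕ) (c : Cmd) (a s : AState) : Prop where
  v : ∀ z, z ≠ x → c.writesVar z = false → s.v z = a.v z
  arr : ∀ b, c.writesArr b = false → s.arr b = a.arr b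
  file : ∀ f, c.writesFile f = false → s.file f = a.file f
  io : ∀ f, c.usesFile f = false → s.io f = a.io f
  tag : ∀ f, c.usesFile f = false → s.tag f = a.tag f

/-- Induction principle for loops; in the induction step, everything that the loop does not write is
known to be as before the loop. -/
theorem exec_for_frame (p : Par) {x y N : ℕ} {c : Cmd} {a : AState} (I : ℕ → AState → Prop)
    (hN : a.v y = N) (hNW : N < p.W) (h0 : I 0 a) (hok : a.ok)
    (hs : ∀ i s, i < N → i < p.W → Frame x c a s → s.ok → I i s →
      I (i + 1) (c.exec p (s.setv p x i)) ∧ (c.exec p (s.setv p x i)).ok) :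
    ∃ s, I N s ∧ ((Cmd.iter x y c).exec p a).ok ∧ (Cmd.iter x y c).exec p a = s.setv p x N := by
  have F0 : Frame x c a a := ⟨fun _ _ _ => rfl, fun _ _ => rfl, fun _ _ => rfl, fun _ _ => rfl,
    fun _ _ => rfl⟩
  obtain ⟨s, ⟨_, hs, hI⟩, e⟩ := Cmd.exec_for p (x := x) (y := y) (c := c)
    (fun i s => Frame x c a s ∧ s.ok ∧ I i s) hN ⟨F0, hok, h0⟩ (by
    rintro i s hi ⟨hF, hok, hI⟩
    obtain ⟨h1, h2⟩ := hs i s hi (hi.trans hNW) hF hok hI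
    refine ⟨⟨fun z hz hc => ?_, fun b hc => ?_, fun f hc => ?_, fun f hc => ?_, fun f hc => ?_⟩,
      h2, h1⟩
    · rw [c.exec_frame_v p z _ hc, setv_v, Function.update_of_ne hz, hF.v z hz hc]
    · rw [c.exec_frame_arr p b _ hc]; exact hF.arr b hc
    · rw [c.exec_frame_file p f _ hc]; exact hF.file f hc
    · rw [(c.exec_frame_io p f _ hc).1]; exact hF.io f hc
    · rw [(c.exec_frame_io p f _ hc).2]; exact hF.tag f hc)
  exact ⟨s, hI, by rw [e]; exact ⟨hs, hNW⟩, e⟩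

/-! ### Registers and sizes -/

/-- The register holding `n`. -/
notation "rgN" => (0 : ℕ)
/-- The register holding the number of edges. -/
notation "rgE" => (1 : ℕ)
/-- The register holding the cache size. -/
notation "rgM" => (2 : ℕ)
/-- The register holding the number of keys. -/
notation "rgS" => (3 : ℕ)
/-- The register holding the block size. -/
notation "rgD" => (4 : ℕ)
/-- The register holding the number of blocks. -/
notation "rgR" => (5 : ℕ)
/-- The register holding `n + 1`. -/
notation "rgC" => (6 : ℕ)
/-- The register holding the base of the digits. -/
notation "rgQ" => (7 : ℕ)
/-- The register holding the number of pendant vertices at each hub. -/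
notation "rgP" => (8 : ℕ)
/-- The register holding the number of words written to the output file. -/
notation "rgPos" => (9 : ℕ)
/-- The register holding the output of the called program. -/
notation "rgOut" => (10 : ℕ)
/-- The register holding the number of vertices of the gadget graph. -/
notation "rgV" => (11 : ℕ)
/-- The register holding the number of edges of the gadget graph. -/
notation "rgF" => (12 : ℕ)
/-- The counter of loops over a file. -/
notation "rgI" => (13 : ℕ)
/-- The counter of loops over a block. -/
notation "rgJ" => (14 : ℕ)
/-- The counter of loops over all blocks. -/
notation "rgK" => (15 : ℕ)
/-- A register for intermediate values. -/
notation "rgX" => (16 : ℕ)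
/-- A register for intermediate values. -/
notation "rgY" => (17 : ℕ)
/-- A register for intermediate values. -/
notation "rgZ" => (18 : ℕ)
/-- A register for intermediate values. -/
notation "rgU" => (19 : ℕ)
/-- A register for intermediate values. -/
notation "rgW" => (20 : ℕ)
/-- A register for intermediate values. -/
notation "rgL" => (21 : ℕ)

open AExpr (var)

/-- The sizes that occur: `s` keys are cut into `R` blocks of `D` keys. -/
structure Dims (p : Par) (n m s D R : ℕ) : Prop where
  hs : s = 2 * m + 2 * n
  hD : 0 < D
  hDs : D ≤ s
  hDM : D ≤ p.M
  hR : s < R * D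
  hR2 : R * D ≤ 2 * s
  hZ : p.Z = 1000 * (n + m + 1)
  hW : p.Z * p.Z ≤ p.W

/-- The registers that hold these sizes. -/
structure Regs (n m s D R : ℕ) (a : AState) : Prop where
  N : a.v rgN = n
  E : a.v rgE = m
  S : a.v rgS = s
  D : a.v rgD = D
  R : a.v rgR = R
  C : a.v rgC = n + 1

section dims
variable {p : Par} {n m s D R : ℕ} {a : AState}

theorem Regs.exec (h : Regs n m s D R a) (c : Cmd)
    (hc : ∀ x ∈ [0, 1, 3, 4, 5, 6], c.writesVar x = false) : Regs n m s D R (c.exec p a) := by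
  have := fun x hx => c.exec_frame_v p x a (hc x hx)
  constructor <;> rw [this _ (by simp)]
  exacts [h.N, h.E, h.S, h.D, h.R, h.C]

theorem Regs.frame {a' : AState} {x : ℕ} {c : Cmd} (h : Regs n m s D R a) (hF : Frame x c a a')
    (hx : x ∉ [0, 1, 3, 4, 5, 6]) (hc : ∀ x ∈ [0, 1, 3, 4, 5, 6], c.writesVar x = false) :
    Regs n m s D R a' := by
  have : ∀ z ∈ [0, 1, 3, 4, 5, 6], a'.v z = a.v z := fun z hz =>
    hF.v z (fun e => hx (e ▸ hz)) (hc z hz)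
  constructor <;> rw [this _ (by simp)]
  exacts [h.N, h.E, h.S, h.D, h.R, h.C]

theorem Regs.setv {x k : ℕ} (h : Regs n m s D R a) (hx : x ∉ [0, 1, 3, 4, 5, 6]) :
    Regs n m s D R (a.setv p x k) := by
  have : ∀ z ∈ [0, 1, 3, 4, 5, 6], (a.setv p x k).v z = a.v z := fun z hz => by
    rw [setv_v, Function.update_of_ne]
    rintro rfl
    exact hx hz
  constructor <;> rw [this _ (by simp)]
  exacts [h.N, h.E, h.S, h.D, h.R, h.C]

theorem Dims.Z_le_W (d : Dims p n m s D R) : p.Z ≤ p.W :=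
  (Nat.le_mul_of_pos_left _ (by have := d.hZ; omega)).trans d.hW

theorem Dims.mul_lt (d : Dims p n m s D R) {x y : ℕ} (hx : x < p.Z) (hy : y < p.Z) :
    x * p.Z + y < p.W := by
  have : (x + 1) * p.Z ≤ p.Z * p.Z := Nat.mul_le_mul_right _ hx
  have := d.hW
  rw [add_mul] at *
  omega

/-- The positions in a block; the last block may extend beyond the keys. -/
theorem Dims.block (d : Dims p n m s D R) {k : ℕ} (hk : k < R) : k * D + D ≤ 2 * s := by
  have : (k + 1) * D ≤ R * D := Nat.mul_le_mul_right _ hk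
  have := d.hR2
  rw [add_mul] at *
  omega

theorem Dims.R_le (d : Dims p n m s D R) : R ≤ 2 * s :=
  (Nat.le_mul_of_pos_right _ d.hD).trans d.hR2

theorem Dims.two_s_lt (d : Dims p n m s D R) : 2 * s + 10 < p.Z := by
  have := d.hs; have := d.hZ; omega

end dims

/-! ### Moving blocks between files and arrays -/

/-- Copy block number `rgK` of file `f` to array `b`. -/
def loadBlock (f b : ℕ) : Cmd :=
  .iter rgJ rgD (.read rgX f (var rgK * var rgD + var rgJ) ;; .put b (var rgJ) (var rgX))

/-- Copy array `b` to block number `rgK` of file `f`. -/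
def storeBlock (b f : ℕ) : Cmd :=
  .iter rgJ rgD (.get rgX b (var rgJ) ;; .write f (var rgK * var rgD + var rgJ) (var rgX))

/-- Store the content of register `y` everywhere in array `b`. -/
def fillBlock (b y : ℕ) : Cmd :=
  .iter rgJ rgD (.put b (var rgJ) (var y))

section blocks
variable {p : Par} {n m s D R : ℕ} {a : AState}

theorem loadBlock_spec (d : Dims p n m s D R) (r : Regs n m s D R a) (ok : a.ok) {f b k : ℕ}
    (hk : a.v rgK = k) (hkR : k < R) (hf : ∀ i < k * D + D, a.file f i < p.W) :
    ((loadBlock f b).exec p a).ok ∧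
    (∀ j < D, ((loadBlock f b).exec p a).arr b j = a.file f (k * D + j)) ∧
    Scan p f a (2 * s) ((loadBlock f b).exec p a) := by
  have hZ := d.two_s_lt
  have hblk := d.block hkR
  have hZW := d.Z_le_W
  have hDM := d.hDM
  have hDs := d.hDs
  obtain ⟨t, ⟨h1, h2⟩, h3, e⟩ := exec_for_frame p (x := rgJ) (y := rgD)
    (c := .read rgX f (var rgK * var rgD + var rgJ) ;; .put b (var rgJ) (var rgX)) (a := a)
    (fun i t => (∀ j < i, t.arr b j = a.file f (k * D + j)) ∧ Scan p f a (k * D + i) t)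
    r.D (by omega) ⟨by simp, Scan.refl _ _⟩ ok (by
      rintro i t hi hiW F hok ⟨h1, h2⟩
      have e1 := F.v 15 (by decide) rfl
      have e2 := F.v 4 (by decide) rfl
      have e3 := F.file f rfl
      have e4 := hf (k * D + i) (by omega)
      simp only [Cmd.exec, AExpr.eval_add, AExpr.eval_mul, AExpr.eval_var, setv_v, touch_v,
        Function.update_self, Function.update_of_ne (show (15 : ℕ) ≠ 14 by decide),
        Function.update_of_ne (show (4 : ℕ) ≠ 14 by decide),
        Function.update_of_ne (show (14 : ℕ) ≠ 16 by decide), e1, e2, hk, r.D, e3, setv_file]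
      refine ⟨⟨?_, ?_⟩, ?_⟩
      · intro j hj
        simp only [setArr_arr, setv_arr, touch_arr, Function.update_self]
        by_cases hji : j = i
        · subst hji; simp
        · rw [Function.update_of_ne hji]; exact h1 j (by omega)
      · exact ((h2.touch (a := t) (le_refl _)).mono (by omega))
      · simp; exact ⟨⟨⟨⟨hok, by omega⟩, by omega⟩, e4⟩, by omega, e4⟩)
  rw [loadBlock, e]
  exact ⟨e ▸ h3, h1, h2.mono (by omega)⟩

theorem storeBlock_spec (d : Dims p n m s D R) (r : Regs n m s D R a) (ok : a.ok) {f b k : ℕ}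
    (hk : a.v rgK = k) (hkR : k < R) (hb : ∀ j < D, a.arr b j < p.W) :
    ((storeBlock b f).exec p a).ok ∧
    (∀ i, ((storeBlock b f).exec p a).file f i =
      if k * D ≤ i ∧ i < k * D + D then a.arr b (i - k * D) else a.file f i) ∧
    Scan p f a (2 * s) ((storeBlock b f).exec p a) := by
  have hZ := d.two_s_lt
  have hblk := d.block hkR
  have hZW := d.Z_le_W
  have hDM := d.hDM
  have hDs := d.hDs
  obtain ⟨t, ⟨h1, h2⟩, h3, e⟩ := exec_for_frame p (x := rgJ) (y := rgD)
    (c := .get rgX b (var rgJ) ;; .write f (var rgK * var rgD + var rgJ) (var rgX)) (a := a)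
    (fun j t => (∀ i, t.file f i =
      if k * D ≤ i ∧ i < k * D + j then a.arr b (i - k * D) else a.file f i) ∧
      Scan p f a (k * D + j) t)
    r.D (by omega) ⟨fun i => by rw [if_neg (by omega)], Scan.refl _ _⟩ ok (by
      rintro j t hj hjW F hok ⟨h1, h2⟩
      have e1 := F.v 15 (by decide) rfl
      have e2 := F.v 4 (by decide) rfl
      have e3 := F.arr b rfl
      have e4 := hb j hj
      simp only [Cmd.exec, AExpr.eval_add, AExpr.eval_mul, AExpr.eval_var, setv_v, require_v,
        Function.update_self, Function.update_of_ne (show (15 : ℕ) ≠ 14 by decide),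
        Function.update_of_ne (show (4 : ℕ) ≠ 14 by decide),
        Function.update_of_ne (show (15 : ℕ) ≠ 16 by decide),
        Function.update_of_ne (show (4 : ℕ) ≠ 16 by decide),
        Function.update_of_ne (show (14 : ℕ) ≠ 16 by decide), e1, e2, hk, r.D, e3, setv_arr]
      refine ⟨⟨?_, ?_⟩, ?_⟩
      · intro i
        simp only [setFile_file, touch_file, setv_file, require_file, Function.update_self]
        by_cases hji : i = k * D + j
        · subst hji
          rw [Function.update_self, if_pos (by omega)]; congr 1; omega
        · rw [Function.update_of_ne hji, h1 i]
          by_cases hi : k * D ≤ i ∧ i < k * D + j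
          · rw [if_pos hi, if_pos (by omega)]
          · rw [if_neg hi, if_neg (by omega)]
      · exact ((h2.touch (le_refl _)).mono (by omega))
      · simp; exact ⟨⟨⟨⟨⟨hok, by omega⟩, by omega⟩, e4⟩, by omega⟩, e4⟩)
  rw [storeBlock, e]
  exact ⟨e ▸ h3, h1, h2.mono (by omega)⟩

theorem fillBlock_spec (d : Dims p n m s D R) (r : Regs n m s D R a) (ok : a.ok) {b y k : ℕ}
    (hy : y ≠ rgJ) (hk : a.v y = k) (hkW : k < p.W) :
    ((fillBlock b y).exec p a).ok ∧ ∀ j < D, ((fillBlock b y).exec p a).arr b j = k := by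
  have hZ := d.two_s_lt
  have hZW := d.Z_le_W
  have hDM := d.hDM
  have hDs := d.hDs
  obtain ⟨t, h1, h3, e⟩ := exec_for_frame p (x := rgJ) (y := rgD)
    (c := .put b (var rgJ) (var y)) (a := a)
    (fun i t => ∀ j < i, t.arr b j = k)
    r.D (by omega) (by simp) ok (by
      rintro i t hi hiW F hok h1
      have e1 := F.v y hy rfl
      simp only [Cmd.exec, AExpr.eval_var, setv_v, Function.update_self, Function.update_of_ne hy,
        e1, hk]
      refine ⟨?_, ?_⟩
      · intro j hj
        simp only [setArr_arr, setv_arr, Function.update_self]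
        by_cases hji : j = i
        · subst hji; simp
        · rw [Function.update_of_ne hji]; exact h1 j (by omega)
      · simp; exact ⟨⟨hok, by omega⟩, by omega, hkW⟩)
  rw [fillBlock, e]
  exact ⟨e ▸ h3, h1⟩

end blocks

/-! ### The list of keys -/

/-- Write to file `1` the keys `v * (n + 1) + w` for all pairs of adjacent vertices, and the keys
`v * (n + 1) + v` and `v * (n + 1) + n` for all vertices `v`. -/
def keysCmd : Cmd :=
  .iter rgI rgE (.read rgX 0 (2 * var rgI) ;; .read rgY 0 (2 * var rgI + 1) ;;
    .write 1 (2 * var rgI) (var rgX * var rgC + var rgY) ;;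
    .write 1 (2 * var rgI + 1) (var rgY * var rgC + var rgX)) ;;
  .iter rgI rgN (.write 1 (2 * var rgE + 2 * var rgI) (var rgI * var rgC + var rgI) ;;
    .write 1 (2 * var rgE + 2 * var rgI + 1) (var rgI * var rgC + var rgN))

section keys
variable {p : Par} {n m s D R : ℕ} {a : AState}

theorem keysCmd_spec (d : Dims p n m s D R) (r : Regs n m s D R a) (ok : a.ok)
    (hin : ∀ i < 2 * m, a.file 0 i < n) (h1 : ∀ i, a.file 1 i = 0) :
    (keysCmd.exec p a).ok ∧
    (∀ i < m, (keysCmd.exec p a).file 1 (2 * i) =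
        a.file 0 (2 * i) * (n + 1) + a.file 0 (2 * i + 1) ∧
      (keysCmd.exec p a).file 1 (2 * i + 1) =
        a.file 0 (2 * i + 1) * (n + 1) + a.file 0 (2 * i)) ∧
    (∀ v < n, (keysCmd.exec p a).file 1 (2 * m + 2 * v) = v * (n + 1) + v ∧
      (keysCmd.exec p a).file 1 (2 * m + 2 * v + 1) = v * (n + 1) + n) ∧
    (∀ i, s ≤ i → (keysCmd.exec p a).file 1 i = 0) ∧
    (keysCmd.exec p a).io 0 ≤ a.io 0 + 2 + 2 * (2 * s / p.B) ∧
    (keysCmd.exec p a).io 1 ≤ a.io 1 + 2 * (2 + 2 * (2 * s / p.B)) := by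
  have hZ := d.two_s_lt
  have hZW := d.Z_le_W
  have hs := d.hs
  have hnZ : n + 1 < p.Z := by omega
  have hmul : ∀ x y, x < n → y ≤ n → x * (n + 1) + y < p.W := by
    intro x y hx hy
    refine lt_of_le_of_lt ?_ (d.mul_lt (x := x) (y := y) (by omega) (by omega))
    exact Nat.add_le_add_right (Nat.mul_le_mul_left _ hnZ.le) _
  obtain ⟨t, ⟨A1, A2, A3, A4⟩, ok1, e1⟩ := exec_for_frame p (x := rgI) (y := rgE)
    (c := .read rgX 0 (2 * var rgI) ;; .read rgY 0 (2 * var rgI + 1) ;;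
      .write 1 (2 * var rgI) (var rgX * var rgC + var rgY) ;;
      .write 1 (2 * var rgI + 1) (var rgY * var rgC + var rgX)) (a := a)
    (fun i t => (∀ j < i, t.file 1 (2 * j) =
        a.file 0 (2 * j) * (n + 1) + a.file 0 (2 * j + 1) ∧
      t.file 1 (2 * j + 1) = a.file 0 (2 * j + 1) * (n + 1) + a.file 0 (2 * j)) ∧
      (∀ j, 2 * i ≤ j → t.file 1 j = 0) ∧ Scan p 0 a (2 * i) t ∧ Scan p 1 a (2 * i) t)
    r.E (by omega) ⟨by simp, fun j _ => h1 j, Scan.refl _ _, Scan.refl _ _⟩ ok (by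
      rintro i t hi hiW F hok ⟨A1, A2, A3, A4⟩
      have e6 := (F.v 6 (by decide) rfl).trans r.C
      have e0 := F.file 0 rfl
      have b1 := hin (2 * i) (by omega)
      have b2 := hin (2 * i + 1) (by omega)
      have c1 := hmul _ _ b1 b2.le
      have c2 := hmul _ _ b2 b1.le
      refine ⟨⟨?_, ?_, ?_, ?_⟩, ?_⟩
      · intro j hj
        by_cases hji : j = i
        · subst hji; simp [Cmd.exec, e0, e6]
        · have := A1 j (by omega)
          simp only [Cmd.exec, AExpr.eval_mul, AExpr.eval_add, AExpr.eval_var, AExpr.eval_ofNat,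
            setFile_file, touch_file, setv_file, setv_v, touch_v, setFile_v, Function.update_self]
          simp
          rw [Function.update_of_ne (by omega), Function.update_of_ne (by omega),
            Function.update_of_ne (by omega), Function.update_of_ne (by omega)]
          exact this
      · intro j hj
        simp [Cmd.exec]
        rw [Function.update_of_ne (by omega), Function.update_of_ne (by omega)]
        exact A2 j (by omega)
      · simp [Cmd.exec]
        have := (A3.touch (i := 2 * i) le_rfl).touch (i := 2 * i + 1) (by omega)
        exact (((this.touch_ne (g := 1) (i := 2 * i) (by decide)).touch_ne (g := 1)
          (i := 2 * i + 1) (by decide)).mono (by omega)).congr rfl rfl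
      · simp [Cmd.exec]
        have := (((A4.touch_ne (g := 0) (i := 2 * i) (by decide)).touch_ne (g := 0)
          (i := 2 * i + 1) (by decide)).touch (i := 2 * i) le_rfl).touch (i := 2 * i + 1) (by omega)
        exact (this.mono (by omega)).congr rfl rfl
      · simp [Cmd.exec, e0, e6]
        refine ⟨⟨⟨⟨⟨⟨⟨⟨⟨hok, ?_⟩, ?_⟩, ?_⟩, ?_⟩, ?_⟩, ?_⟩, c1⟩, ?_⟩, c2⟩ <;> omega)
  change (Cmd.iter rgI rgE _).exec p a = _ at e1
  rw [keysCmd, Cmd.exec, e1]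
  rw [e1] at ok1
  have r1 : Regs n m s D R (t.setv p rgI m) := by
    have := r.exec (p := p) (Cmd.iter rgI rgE (.read rgX 0 (2 * var rgI) ;;
      .read rgY 0 (2 * var rgI + 1) ;; .write 1 (2 * var rgI) (var rgX * var rgC + var rgY) ;;
      .write 1 (2 * var rgI + 1) (var rgY * var rgC + var rgX))) (by decide)
    rwa [e1] at this
  generalize hb : t.setv p rgI m = b at *
  have B1 : b.file = t.file := by rw [← hb]; rfl
  have B2 : b.io = t.io := by rw [← hb]; rfl
  have B3 : b.tag = t.tag := by rw [← hb]; rfl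
  rw [← B1] at A1 A2
  replace A3 : Scan p 0 a (2 * m) b := A3.congr (by rw [B2]) (by rw [B3])
  replace A4 : Scan p 1 a (2 * m) b := A4.congr (by rw [B2]) (by rw [B3])
  clear B1 B2 B3 hb e1
  obtain ⟨u, ⟨C1, C2, C3, C4⟩, ok2, e2⟩ := exec_for_frame p (x := rgI) (y := rgN)
    (c := .write 1 (2 * var rgE + 2 * var rgI) (var rgI * var rgC + var rgI) ;;
      .write 1 (2 * var rgE + 2 * var rgI + 1) (var rgI * var rgC + var rgN)) (a := b)
    (fun i t => (∀ v < i, t.file 1 (2 * m + 2 * v) = v * (n + 1) + v ∧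
      t.file 1 (2 * m + 2 * v + 1) = v * (n + 1) + n) ∧ (∀ j < 2 * m, t.file 1 j = b.file 1 j) ∧
      (∀ j, 2 * m + 2 * i ≤ j → t.file 1 j = 0) ∧ Scan p 1 a (2 * m + 2 * i) t)
    r1.N (by omega) ⟨by simp, by simp, fun j hj => A2 j (by omega), A4⟩ ok1 (by
      rintro i t hi hiW F hok ⟨C1, C2, C3, C4⟩
      have e6 := (F.v 6 (by decide) rfl).trans r1.C
      have eE := (F.v 1 (by decide) rfl).trans r1.E
      have eN := (F.v 0 (by decide) rfl).trans r1.N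
      have c1 := hmul _ _ hi hi.le
      have c2 := hmul _ _ hi le_rfl
      refine ⟨⟨?_, ?_, ?_, ?_⟩, ?_⟩
      · intro j hj
        simp [Cmd.exec, e6, eE, eN]
        by_cases hji : j = i
        · subst hji; simp
        · rw [Function.update_of_ne (by omega), Function.update_of_ne (by omega),
            Function.update_of_ne (by omega), Function.update_of_ne (by omega)]
          exact C1 j (by omega)
      · intro j hj
        simp [Cmd.exec, e6, eE, eN]
        rw [Function.update_of_ne (by omega), Function.update_of_ne (by omega)]
        exact C2 j hj
      · intro j hj
        simp [Cmd.exec, e6, eE, eN]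
        rw [Function.update_of_ne (by omega), Function.update_of_ne (by omega)]
        exact C3 j (by omega)
      · simp [Cmd.exec, e6, eE, eN]
        have := (C4.touch le_rfl).touch (i := 2 * m + 2 * i + 1) (by omega)
        exact (this.mono (by omega)).congr rfl rfl
      · simp [Cmd.exec, e6, eE, eN]
        refine ⟨⟨⟨⟨⟨hok, ?_⟩, ?_⟩, c1⟩, ?_⟩, c2⟩ <;> omega)
  have io0 := (Cmd.exec_frame_io p 0 (.iter rgI rgN
    (.write 1 (2 * var rgE + 2 * var rgI) (var rgI * var rgC + var rgI) ;;
      .write 1 (2 * var rgE + 2 * var rgI + 1) (var rgI * var rgC + var rgN))) b rfl).1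
  rw [e2] at ok2 io0 ⊢
  refine ⟨ok2, ?_, C1, ?_, ?_, ?_⟩
  · intro i hi
    simp only [setv_file]
    rw [C2 _ (by omega), C2 _ (by omega)]
    exact A1 i hi
  · exact fun i hi => C3 i (by omega)
  · rw [io0]
    exact (A3.mono (q' := 2 * s) (by omega)).io_le
  · have := (C4.mono (q' := 2 * s) (by omega)).io_le
    simp only [setv_io]
    omega

end keys

/-! ### Sorting the keys -/

/-- Increase the counter in array `1` of each key in array `0` that is larger than the key in `rgX`. -/
def countBelow : Cmd :=
  .iter rgJ rgD (.get rgY 0 (var rgJ) ;;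
    .ite (.lt (var rgX) (var rgY)) (.get rgZ 1 (var rgJ) ;; .put 1 (var rgJ) (var rgZ + 1)) .skip)

/-- Apply `countBelow` to all keys. -/
def rankStream : Cmd := .iter rgI rgS (.read rgX 1 (var rgI) ;; countBelow)

/-- Write the ranks of a block of keys to file `2`. -/
def rankBlock : Cmd :=
  loadBlock 1 0 ;; .set rgZ 0 ;; fillBlock 1 rgZ ;; rankStream ;; storeBlock 1 2

/-- Write the ranks of all keys to file `2`. -/
def rankCmd : Cmd := .iter rgK rgR rankBlock

/-- Place all keys whose rank belongs to block `rgK` into array `0`. -/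
def placeStream : Cmd :=
  .iter rgI rgS (.read rgX 1 (var rgI) ;; .read rgY 2 (var rgI) ;;
    .ite (.lt (var rgK * var rgD) (var rgY + 1) * .lt (var rgY) (var rgK * var rgD + var rgD))
      (.put 0 (var rgY - var rgK * var rgD) (var rgX)) .skip)

/-- Write one block of the sorted list of keys to file `3`. -/
def placeBlock : Cmd := fillBlock 0 rgN ;; placeStream ;; storeBlock 0 3

/-- Write the sorted list of keys to file `3`, padded with the key `n`. -/
def placeCmd : Cmd := .iter rgK rgR placeBlock

/-- The number of keys among the first `s` that are less than `x`. -/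
def rank (K : ℕ → ℕ) (s x : ℕ) : ℕ := ((Finset.range s).filter fun i => K i < x).card

theorem rank_zero (K : ℕ → ℕ) (x : ℕ) : rank K 0 x = 0 := by simp [rank]

theorem rank_succ (K : ℕ → ℕ) (s x : ℕ) :
    rank K (s + 1) x = rank K s x + if K s < x then 1 else 0 := by
  rw [rank, rank, Finset.range_add_one, Finset.filter_insert]
  split_ifs
  · rw [Finset.card_insert_of_notMem (by simp)]
  · rfl

theorem rank_le (K : ℕ → ℕ) (s x : ℕ) : rank K s x ≤ s :=
  (Finset.card_filter_le _ _).trans (Finset.card_range s).le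

theorem rank_lt_rank {K : ℕ → ℕ} {s i y : ℕ} (hi : i < s) (h : K i < y) :
    rank K s (K i) < rank K s y := by
  refine Finset.card_lt_card (Finset.ssubset_iff_of_subset ?_ |>.2 ⟨i, ?_, ?_⟩)
  · exact fun t ht => by
      simp only [Finset.mem_filter] at ht ⊢
      exact ⟨ht.1, ht.2.trans h⟩
  · simp [hi, h]
  · simp

theorem rank_lt {K : ℕ → ℕ} {s i : ℕ} (hi : i < s) : rank K s (K i) < s := by
  have := rank_lt_rank hi (Nat.lt_succ_self (K i))
  exact this.trans_le (rank_le _ _ _)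

section rank
variable {p : Par} {n m s D R : ℕ} {a : AState}

theorem countBelow_spec (d : Dims p n m s D R) (r : Regs n m s D R a) (ok : a.ok) {x : ℕ}
    (hx : a.v rgX = x) (h0 : ∀ j < D, a.arr 0 j < p.W) (h1 : ∀ j < D, a.arr 1 j + 1 < p.W) :
    (countBelow.exec p a).ok ∧ ∀ j < D, (countBelow.exec p a).arr 1 j =
      a.arr 1 j + if x < a.arr 0 j then 1 else 0 := by
  have hZ := d.two_s_lt
  have hZW := d.Z_le_W
  have hDM := d.hDM
  have hDs := d.hDs
  obtain ⟨t, ⟨A1, A2⟩, h3, e⟩ := exec_for_frame p (x := rgJ) (y := rgD)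
    (c := .get rgY 0 (var rgJ) ;;
      .ite (.lt (var rgX) (var rgY)) (.get rgZ 1 (var rgJ) ;; .put 1 (var rgJ) (var rgZ + 1)) .skip)
    (a := a)
    (fun i t => (∀ j < i, t.arr 1 j = a.arr 1 j + if x < a.arr 0 j then 1 else 0) ∧
      ∀ j, i ≤ j → t.arr 1 j = a.arr 1 j)
    r.D (by omega) ⟨by simp, fun _ _ => rfl⟩ ok (by
      rintro i t hi hiW F hok ⟨A1, A2⟩
      have e1 := (F.v 16 (by decide) rfl).trans hx
      have e2 := F.arr 0 rfl
      have b0 := h0 i hi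
      have b1 := h1 i hi
      have e3 := A2 i le_rfl
      by_cases hlt : x < a.arr 0 i
      · refine ⟨⟨?_, ?_⟩, ?_⟩
        · intro j hj
          simp [Cmd.exec, AExpr.eval_lt_eq_zero, e1, e2, hlt]
          by_cases hji : j = i
          · subst hji; simp [hlt, e3]
          · rw [Function.update_of_ne hji]; exact A1 j (by omega)
        · intro j hj
          simp [Cmd.exec, AExpr.eval_lt_eq_zero, e1, e2, hlt]
          rw [Function.update_of_ne (by omega)]
          exact A2 j (by omega)
        · simp [Cmd.exec, AExpr.eval_lt_eq_zero, e1, e2, hlt, e3, hok, b0, b1]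
          omega
      · refine ⟨⟨?_, ?_⟩, ?_⟩
        · intro j hj
          simp [Cmd.exec, AExpr.eval_lt_eq_zero, e1, e2, hlt]
          by_cases hji : j = i
          · subst hji; simp [hlt, e3]
          · exact A1 j (by omega)
        · intro j hj
          simp [Cmd.exec, AExpr.eval_lt_eq_zero, e1, e2, hlt]
          exact A2 j (by omega)
        · simp [Cmd.exec, AExpr.eval_lt_eq_zero, e1, e2, hlt, hok, b0]
          omega)
  rw [countBelow, e]
  exact ⟨e ▸ h3, A1⟩

theorem rankStream_spec (d : Dims p n m s D R) (r : Regs n m s D R a) (ok : a.ok)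
    (h0 : ∀ j < D, a.arr 0 j < p.W) (h1 : ∀ j < D, a.arr 1 j = 0)
    (hf : ∀ i < s, a.file 1 i < p.W) :
    (rankStream.exec p a).ok ∧
    (∀ j < D, (rankStream.exec p a).arr 1 j = rank (a.file 1) s (a.arr 0 j)) ∧
    Scan p 1 a (2 * s) (rankStream.exec p a) := by
  have hZ := d.two_s_lt
  have hZW := d.Z_le_W
  obtain ⟨t, ⟨A1, A2⟩, h3, e⟩ := exec_for_frame p (x := rgI) (y := rgS)
    (c := .read rgX 1 (var rgI) ;; countBelow) (a := a)
    (fun i t => (∀ j < D, t.arr 1 j = rank (a.file 1) i (a.arr 0 j)) ∧ Scan p 1 a i t)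
    r.S (by omega) ⟨fun j hj => by rw [rank_zero, h1 j hj], Scan.refl _ _⟩ ok (by
      rintro i t hi hiW F hok ⟨A1, A2⟩
      have e1 := F.file 1 rfl
      have e2 := F.arr 0 rfl
      have b1 := hf i hi
      rw [Cmd.exec]
      generalize hu : (Cmd.read rgX 1 (var rgI)).exec p (t.setv p rgI i) = u
      have uok : u.ok := by
        rw [← hu]; simp [Cmd.exec, hok, e1, b1]; omega
      have ur : Regs n m s D R u := by
        rw [← hu]
        exact ((r.frame F (by decide) (by decide)).setv (by decide)).exec _ (by decide)
      have ux : u.v rgX = a.file 1 i := by rw [← hu]; simp [Cmd.exec, e1]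
      have ua : u.arr = t.arr := by rw [← hu]; simp [Cmd.exec]
      have us : Scan p 1 a i u := by
        rw [← hu]; simp [Cmd.exec]; exact (A2.touch le_rfl).congr rfl rfl
      obtain ⟨c1, c2⟩ := countBelow_spec d ur uok ux (by rw [ua, e2]; exact h0) (by
        intro j hj
        rw [ua, A1 j hj]
        have := rank_le (a.file 1) i (a.arr 0 j)
        omega)
      refine ⟨⟨fun j hj => ?_, ?_⟩, c1⟩
      · rw [c2 j hj, ua, A1 j hj, e2, rank_succ]
      · exact ((us.exec countBelow rfl).mono (by omega)))
  rw [rankStream, e]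
  exact ⟨e ▸ h3, A1, A2.mono (by omega)⟩

theorem rankBlock_spec (d : Dims p n m s D R) (r : Regs n m s D R a) (ok : a.ok) {k : ℕ}
    (hk : a.v rgK = k) (hkR : k < R) (hf : ∀ i, a.file 1 i < p.W) :
    (rankBlock.exec p a).ok ∧
    (∀ i, (rankBlock.exec p a).file 2 i = if k * D ≤ i ∧ i < k * D + D then
      rank (a.file 1) s (a.file 1 i) else a.file 2 i) ∧
    (rankBlock.exec p a).io 1 ≤ a.io 1 + 2 * (2 + 2 * (2 * s / p.B)) ∧
    (rankBlock.exec p a).io 2 ≤ a.io 2 + (2 + 2 * (2 * s / p.B)) := by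
  have hZ := d.two_s_lt
  have hZW := d.Z_le_W
  simp only [rankBlock, Cmd.exec]
  obtain ⟨ok1, A1, S1⟩ := loadBlock_spec d r ok (f := 1) (b := 0) hk hkR fun i _ => hf i
  have r1 := r.exec (p := p) (loadBlock 1 0) (by decide)
  have k1 := ((loadBlock 1 0).exec_frame_v p rgK a rfl).trans hk
  have f1 := (loadBlock 1 0).exec_frame_file p 1 a rfl
  have f2 := (loadBlock 1 0).exec_frame_file p 2 a rfl
  have i2 := ((loadBlock 1 0).exec_frame_io p 2 a rfl).1
  generalize (loadBlock 1 0).exec p a = b at *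
  have ok2 : (b.setv p rgZ 0).ok := ⟨ok1, by omega⟩
  have r2 := r1.setv (p := p) (x := rgZ) (k := 0) (by decide)
  obtain ⟨ok3, A3⟩ := fillBlock_spec d r2 ok2 (b := 1) (y := rgZ) (k := 0) (by decide) (by simp)
    (by omega)
  have r3 := r2.exec (p := p) (fillBlock 1 rgZ) (by decide)
  have k3 := (fillBlock 1 rgZ).exec_frame_v p rgK (b.setv p rgZ 0) rfl
  have f3 := fun f => (fillBlock 1 rgZ).exec_frame_file p f (b.setv p rgZ 0) rfl
  have a3 := (fillBlock 1 rgZ).exec_frame_arr p 0 (b.setv p rgZ 0) rfl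
  have i3 := fun f => (fillBlock 1 rgZ).exec_frame_io p f (b.setv p rgZ 0) rfl
  rw [AExpr.eval_ofNat]
  generalize (fillBlock 1 rgZ).exec p (b.setv p rgZ (OfNat.ofNat 0)) = c at *
  have k3' : c.v rgK = k := by rw [k3]; simpa using k1
  simp only [setv_file, setv_arr, setv_io] at f3 a3 i3
  obtain ⟨ok4, A4, S4⟩ := rankStream_spec d r3 ok3 (by
    intro j hj; rw [a3, A1 j hj]; exact hf _) A3 (by intro i _; rw [f3, f1]; exact hf _)
  have r4 := r3.exec (p := p) rankStream (by decide)
  have k4 := (rankStream.exec_frame_v p rgK c rfl).trans k3'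
  have f4 := rankStream.exec_frame_file p 2 c rfl
  have i4 := (rankStream.exec_frame_io p 2 c rfl).1
  generalize rankStream.exec p c = e at *
  obtain ⟨ok5, A5, S5⟩ := storeBlock_spec d r4 ok4 (f := 2) (b := 1) k4 hkR (by
    intro j hj; rw [A4 j hj]
    have := rank_le (c.file 1) s (c.arr 0 j)
    omega)
  have i5 := ((storeBlock 1 2).exec_frame_io p 1 e rfl).1
  refine ⟨ok5, ?_, ?_, ?_⟩
  · intro i
    rw [A5 i]
    split_ifs with hi
    · rw [A4 _ (by omega), f3, f1, a3, A1 _ (by omega), Nat.add_sub_cancel' hi.1]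
    · rw [f4, f3, f2]
  · have := S1.io_le
    have := S4.io_le
    rw [(i3 1).1] at this
    omega
  · have := S5.io_le
    rw [i4, (i3 2).1, i2] at this
    omega

theorem rankCmd_spec (d : Dims p n m s D R) (r : Regs n m s D R a) (ok : a.ok)
    (hf : ∀ i, a.file 1 i < p.W) :
    (rankCmd.exec p a).ok ∧
    (∀ i < R * D, (rankCmd.exec p a).file 2 i = rank (a.file 1) s (a.file 1 i)) ∧
    (rankCmd.exec p a).io 1 ≤ a.io 1 + R * (2 * (2 + 2 * (2 * s / p.B))) ∧
    (rankCmd.exec p a).io 2 ≤ a.io 2 + R * (2 + 2 * (2 * s / p.B)) := by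
  have hZ := d.two_s_lt
  have hZW := d.Z_le_W
  have hR := d.R_le
  obtain ⟨t, ⟨A1, A2, A3⟩, h3, e⟩ := exec_for_frame p (x := rgK) (y := rgR)
    (c := rankBlock) (a := a)
    (fun k t => (∀ i < k * D, t.file 2 i = rank (a.file 1) s (a.file 1 i)) ∧
      t.io 1 ≤ a.io 1 + k * (2 * (2 + 2 * (2 * s / p.B))) ∧
      t.io 2 ≤ a.io 2 + k * (2 + 2 * (2 * s / p.B)))
    r.R (by omega) ⟨by simp, by simp, by simp⟩ ok (by
      rintro k t hk hkW F hok ⟨A1, A2, A3⟩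
      have e1 := F.file 1 rfl
      have rt := (r.frame F (by decide) (by decide)).setv (p := p) (x := rgK) (k := k) (by decide)
      obtain ⟨B0, B1, B2, B3⟩ := rankBlock_spec d rt ⟨hok, hkW⟩ (k := k) (by simp) hk
        (by rw [setv_file, e1]; exact hf)
      simp only [setv_file, e1, setv_io] at B1 B2 B3
      refine ⟨⟨?_, ?_, ?_⟩, B0⟩
      · intro i hi
        rw [B1 i]
        split_ifs with hik
        · rfl
        · rw [add_mul] at hi; exact A1 i (by omega)
      · rw [add_mul]; omega
      · rw [add_mul]; omega)
  rw [rankCmd, e]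
  exact ⟨e ▸ h3, A1, A2, A3⟩

end rank

section place
variable {p : Par} {n m s D R : ℕ} {a : AState}

theorem placeStream_spec (d : Dims p n m s D R) (r : Regs n m s D R a) (ok : a.ok) {k : ℕ}
    (hk : a.v rgK = k) (h0 : ∀ j < D, a.arr 0 j = n)
    (hf : ∀ i < s, a.file 1 i < p.W) (hr : ∀ i < s, a.file 2 i < s)
    (hinj : ∀ i < s, ∀ j < s, a.file 2 i = a.file 2 j → i = j) :
    (placeStream.exec p a).ok ∧
    (∀ j < D, (∀ i < s, a.file 2 i = k * D + j → (placeStream.exec p a).arr 0 j = a.file 1 i) ∧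
      ((∀ i < s, a.file 2 i ≠ k * D + j) → (placeStream.exec p a).arr 0 j = n)) ∧
    Scan p 1 a (2 * s) (placeStream.exec p a) ∧ Scan p 2 a (2 * s) (placeStream.exec p a) := by
  have hZ := d.two_s_lt
  have hZW := d.Z_le_W
  have hDM := d.hDM
  obtain ⟨t, ⟨A1, A2, A3⟩, h3, e⟩ := exec_for_frame p (x := rgI) (y := rgS)
    (c := .read rgX 1 (var rgI) ;; .read rgY 2 (var rgI) ;;
      .ite (.lt (var rgK * var rgD) (var rgY + 1) * .lt (var rgY) (var rgK * var rgD + var rgD))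
      (.put 0 (var rgY - var rgK * var rgD) (var rgX)) .skip) (a := a)
    (fun i t => (∀ j < D, (∀ i' < i, a.file 2 i' = k * D + j → t.arr 0 j = a.file 1 i') ∧
      ((∀ i' < i, a.file 2 i' ≠ k * D + j) → t.arr 0 j = n)) ∧ Scan p 1 a i t ∧ Scan p 2 a i t)
    r.S (by omega) ⟨fun j hj => ⟨by simp, fun _ => h0 j hj⟩, Scan.refl _ _, Scan.refl _ _⟩ ok (by
      rintro i t hi hiW F hok ⟨A1, A2, A3⟩
      have e1 := F.file 1 rfl
      have e2 := F.file 2 rfl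
      have ek := (F.v 15 (by decide) rfl).trans hk
      have eD := (F.v 4 (by decide) rfl).trans r.D
      have b1 := hf i hi
      have b2 := hr i hi
      rw [Cmd.exec_seq, Cmd.exec_seq]
      generalize hu : (Cmd.read rgY 2 (var rgI)).exec p ((Cmd.read rgX 1 (var rgI)).exec p
        (t.setv p rgI i)) = u
      have uok : u.ok := by
        rw [← hu]; simp [Cmd.exec, hok, e1, e2, b1]; omega
      have uD : u.v rgD = D := by rw [← hu]; simp [Cmd.exec, eD]
      have uK : u.v rgK = k := by rw [← hu]; simp [Cmd.exec, ek]
      have ux : u.v rgX = a.file 1 i := by rw [← hu]; simp [Cmd.exec, e1]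
      have uy : u.v rgY = a.file 2 i := by rw [← hu]; simp [Cmd.exec, e2]
      have ua : u.arr = t.arr := by rw [← hu]; simp [Cmd.exec]
      have us1 : Scan p 1 a (i + 1) u := by
        rw [← hu]; simp [Cmd.exec]
        exact (((A2.touch le_rfl).touch_ne (g := 2) (i := i) (by decide)).mono (by omega)).congr
          rfl rfl
      have us2 : Scan p 2 a (i + 1) u := by
        rw [← hu]; simp [Cmd.exec]
        exact (((A3.touch_ne (g := 1) (i := i) (by decide)).touch le_rfl).mono (by omega)).congr
          rfl rfl
      by_cases hb : k * D < a.file 2 i + 1 ∧ a.file 2 i < k * D + D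
      · rw [Cmd.exec_ite_of_ne (by simp [AExpr.eval_lt_eq_zero, uD, uK, uy]; omega)]
        refine ⟨⟨?_, ?_, ?_⟩, ?_⟩
        · intro j hj
          simp only [Cmd.exec, AExpr.eval_sub, AExpr.eval_mul, AExpr.eval_var, uD, uK, ux, uy,
            setArr_arr, Function.update_self, ua]
          by_cases hji : j = a.file 2 i - k * D
          · subst hji
            rw [Function.update_self]
            refine ⟨?_, ?_⟩
            · intro i' hi' h'
              rw [hinj i' (by omega) i hi (by omega)]
            · intro h'; exact absurd (by omega) (h' i (by omega))
          · rw [Function.update_of_ne hji]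
            refine ⟨?_, ?_⟩
            · intro i' hi' h'
              refine (A1 j hj).1 i' ?_ h'
              rcases Nat.lt_succ_iff_lt_or_eq.1 hi' with h | h
              · exact h
              · subst h; omega
            · intro h'; exact (A1 j hj).2 fun i' hi' => h' i' (by omega)
        · exact us1.setArr
        · exact us2.setArr
        · simp [Cmd.exec, uD, uK, ux, uy, uok, b1]
          omega
      · rw [Cmd.exec_ite_of_eq (by simp [AExpr.eval_lt_eq_zero, uD, uK, uy]; omega), Cmd.exec]
        refine ⟨⟨?_, us1, us2⟩, uok⟩
        intro j hj
        rw [ua]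
        refine ⟨?_, ?_⟩
        · intro i' hi' h'
          refine (A1 j hj).1 i' ?_ h'
          rcases Nat.lt_succ_iff_lt_or_eq.1 hi' with h | h
          · exact h
          · subst h; omega
        · intro h'; exact (A1 j hj).2 fun i' hi' => h' i' (by omega))
  rw [placeStream, e]
  exact ⟨e ▸ h3, A1, A2.mono (by omega), A3.mono (by omega)⟩

theorem placeBlock_spec (d : Dims p n m s D R) (r : Regs n m s D R a) (ok : a.ok) {k : ℕ}
    (hk : a.v rgK = k) (hkR : k < R) (hf : ∀ i < s, a.file 1 i < p.W)
    (hr : ∀ i < s, a.file 2 i < s)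
    (hinj : ∀ i < s, ∀ j < s, a.file 2 i = a.file 2 j → i = j) :
    (placeBlock.exec p a).ok ∧
    (∀ q, if k * D ≤ q ∧ q < k * D + D then
      (∀ i < s, a.file 2 i = q → (placeBlock.exec p a).file 3 q = a.file 1 i) ∧
      ((∀ i < s, a.file 2 i ≠ q) → (placeBlock.exec p a).file 3 q = n)
      else (placeBlock.exec p a).file 3 q = a.file 3 q) ∧
    (placeBlock.exec p a).io 1 ≤ a.io 1 + (2 + 2 * (2 * s / p.B)) ∧
    (placeBlock.exec p a).io 2 ≤ a.io 2 + (2 + 2 * (2 * s / p.B)) ∧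
    (placeBlock.exec p a).io 3 ≤ a.io 3 + (2 + 2 * (2 * s / p.B)) := by
  have hZ := d.two_s_lt
  have hZW := d.Z_le_W
  have hs := d.hs
  simp only [placeBlock, Cmd.exec]
  obtain ⟨ok1, A1⟩ := fillBlock_spec d r ok (b := 0) (y := rgN) (by decide) r.N (by omega)
  have r1 := r.exec (p := p) (fillBlock 0 rgN) (by decide)
  have k1 := ((fillBlock 0 rgN).exec_frame_v p rgK a rfl).trans hk
  have f1 := fun f => (fillBlock 0 rgN).exec_frame_file p f a rfl
  have i1 := fun f => ((fillBlock 0 rgN).exec_frame_io p f a rfl).1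
  generalize (fillBlock 0 rgN).exec p a = b at *
  obtain ⟨ok2, A2, S1, S2⟩ := placeStream_spec d r1 ok1 k1 A1 (by rwa [f1]) (by rwa [f1])
    (by rwa [f1])
  have r2 := r1.exec (p := p) placeStream (by decide)
  have k2 := (placeStream.exec_frame_v p rgK b rfl).trans k1
  have f2 := placeStream.exec_frame_file p 3 b rfl
  have i2 := (placeStream.exec_frame_io p 3 b rfl).1
  generalize placeStream.exec p b = c at *
  simp only [f1] at A2
  obtain ⟨ok3, A3, S3⟩ := storeBlock_spec d r2 ok2 (f := 3) (b := 0) k2 hkR (by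
    intro j hj
    by_cases h : ∀ i < s, a.file 2 i ≠ k * D + j
    · rw [(A2 j hj).2 h]; omega
    · push Not at h
      obtain ⟨i, hi, h⟩ := h
      rw [(A2 j hj).1 i hi h]; exact hf i hi)
  have j1 := ((storeBlock 0 3).exec_frame_io p 1 c rfl).1
  have j2 := ((storeBlock 0 3).exec_frame_io p 2 c rfl).1
  refine ⟨ok3, ?_, ?_, ?_, ?_⟩
  · intro q
    rw [A3 q]
    split_ifs with hq
    · have := A2 (q - k * D) (by omega)
      rwa [Nat.add_sub_cancel' hq.1] at this
    · rw [f2, f1]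
  · have := S1.io_le; rw [i1] at this; omega
  · have := S2.io_le; rw [i1] at this; omega
  · have := S3.io_le; rw [i2, i1] at this; omega

theorem placeCmd_spec (d : Dims p n m s D R) (r : Regs n m s D R a) (ok : a.ok)
    (hf : ∀ i < s, a.file 1 i < p.W) (hr : ∀ i < s, a.file 2 i < s)
    (hinj : ∀ i < s, ∀ j < s, a.file 2 i = a.file 2 j → i = j) :
    (placeCmd.exec p a).ok ∧
    (∀ q < R * D,
      (∀ i < s, a.file 2 i = q → (placeCmd.exec p a).file 3 q = a.file 1 i) ∧
      ((∀ i < s, a.file 2 i ≠ q) → (placeCmd.exec p a).file 3 q = n)) ∧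
    (placeCmd.exec p a).io 1 ≤ a.io 1 + R * (2 + 2 * (2 * s / p.B)) ∧
    (placeCmd.exec p a).io 2 ≤ a.io 2 + R * (2 + 2 * (2 * s / p.B)) ∧
    (placeCmd.exec p a).io 3 ≤ a.io 3 + R * (2 + 2 * (2 * s / p.B)) := by
  have hZ := d.two_s_lt
  have hZW := d.Z_le_W
  have hR := d.R_le
  obtain ⟨t, ⟨A1, A2, A3, A4⟩, h3, e⟩ := exec_for_frame p (x := rgK) (y := rgR)
    (c := placeBlock) (a := a)
    (fun k t => (∀ q < k * D,
      (∀ i < s, a.file 2 i = q → t.file 3 q = a.file 1 i) ∧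
      ((∀ i < s, a.file 2 i ≠ q) → t.file 3 q = n)) ∧
      t.io 1 ≤ a.io 1 + k * (2 + 2 * (2 * s / p.B)) ∧
      t.io 2 ≤ a.io 2 + k * (2 + 2 * (2 * s / p.B)) ∧
      t.io 3 ≤ a.io 3 + k * (2 + 2 * (2 * s / p.B)))
    r.R (by omega) ⟨by simp, by simp, by simp, by simp⟩ ok (by
      rintro k t hk hkW F hok ⟨A1, A2, A3, A4⟩
      have e1 := F.file 1 rfl
      have e2 := F.file 2 rfl
      have rt := (r.frame F (by decide) (by decide)).setv (p := p) (x := rgK) (k := k) (by decide)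
      obtain ⟨B0, B1, B2, B3, B4⟩ := placeBlock_spec d rt ⟨hok, hkW⟩ (k := k) (by simp) hk
        (by rw [setv_file, e1]; exact hf) (by rw [setv_file, e2]; exact hr)
        (by rw [setv_file, e2]; exact hinj)
      simp only [setv_file, e1, e2, setv_io] at B1 B2 B3 B4
      refine ⟨⟨?_, ?_, ?_, ?_⟩, B0⟩
      · intro q hq
        have := B1 q
        split_ifs at this with hik
        · exact this
        · rw [add_mul] at hq
          rw [this]; exact A1 q (by omega)
      all_goals rw [add_mul]; omega)
  rw [placeCmd, e]
  exact ⟨e ▸ h3, A1, A2, A3, A4⟩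

end place

/-! ### Properties of the sorted list of keys -/

/-- `F` lists, without repetition, the keys of a relation `A` on `0, …, n - 1`: the numbers
`v * (n + 1) + w` with `A v w`, and the sentinels `v * (n + 1) + n` for `v < n`. -/
structure Keys (n s : ℕ) (A : ℕ → ℕ → Prop) (F : ℕ → ℕ) : Prop where
  inj : ∀ i < s, ∀ j < s, F i = F j → i = j
  lt : ∀ i < s, F i / (n + 1) < n
  mem : ∀ v < n, ∀ w ≤ n, (∃ i < s, F i = v * (n + 1) + w) ↔ w = n ∨ A v w

/-- The keys are listed in increasing order, and up to index `e` they are followed by `n`. -/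
structure SortedKeys (n s e : ℕ) (A : ℕ → ℕ → Prop) (F : ℕ → ℕ) : Prop extends Keys n s A F where
  lt_of_lt : ∀ i j, i < j → j < s → F i < F j
  tail : ∀ i, s ≤ i → i < e → F i = n

theorem Keys.sorted {n s e : ℕ} {A : ℕ → ℕ → Prop} {K F : ℕ → ℕ} (h : Keys n s A K) (he : s ≤ e)
    (hF : ∀ q < e, (∀ i < s, rank K s (K i) = q → F q = K i) ∧
      ((∀ i < s, rank K s (K i) ≠ q) → F q = n)) : SortedKeys n s e A F := by
  -- ranks are a permutation of the indices
  have hinj : Set.InjOn (fun i => rank K s (K i)) (Finset.range s) := by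
    intro i hi j hj hij
    simp only [Finset.coe_range, Set.mem_Iio] at hi hj
    by_contra hne
    rcases lt_or_gt_of_ne (fun e => hne (h.inj i hi j hj e)) with hl | hl
    · exact absurd hij (rank_lt_rank hi hl).ne
    · exact absurd hij (rank_lt_rank hj hl).ne'
  have himg : (Finset.range s).image (fun i => rank K s (K i)) = Finset.range s := by
    refine Finset.eq_of_subset_of_card_le ?_ ?_
    · intro q hq
      obtain ⟨i, hi, rfl⟩ := Finset.mem_image.1 hq
      exact Finset.mem_range.2 (rank_lt (Finset.mem_range.1 hi))
    · rw [Finset.card_image_of_injOn hinj]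
  have hsurj : ∀ q < s, ∃ i < s, rank K s (K i) = q ∧ F q = K i := by
    intro q hq
    have : q ∈ (Finset.range s).image (fun i => rank K s (K i)) := by
      rw [himg]; exact Finset.mem_range.2 hq
    obtain ⟨i, hi, hiq⟩ := Finset.mem_image.1 this
    exact ⟨i, Finset.mem_range.1 hi, hiq,
      (hF q (by omega)).1 i (Finset.mem_range.1 hi) hiq⟩
  have hrk : ∀ i < s, F (rank K s (K i)) = K i := fun i hi =>
    (hF _ ((rank_lt hi).trans_le he)).1 i hi rfl
  have hlt : ∀ i j, i < j → j < s → F i < F j := by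
    intro i j hij hj
    obtain ⟨i', hi', e1, e2⟩ := hsurj i (by omega)
    obtain ⟨j', hj', e3, e4⟩ := hsurj j hj
    rw [e2, e4]
    by_contra hle
    rcases Nat.lt_or_eq_of_le (not_lt.1 hle) with hl | hl
    · have := rank_lt_rank hj' hl; omega
    · rw [hl] at e3; omega
  refine ⟨⟨?_, ?_, ?_⟩, hlt, ?_⟩
  · intro i hi j hj hij
    by_contra hne
    rcases lt_or_gt_of_ne hne with hl | hl
    · exact absurd hij (hlt i j hl hj).ne
    · exact absurd hij (hlt j i hl hi).ne'
  · intro i hi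
    obtain ⟨i', hi', -, e2⟩ := hsurj i hi
    rw [e2]; exact h.lt i' hi'
  · intro v hv w hw
    rw [← h.mem v hv w hw]
    constructor
    · rintro ⟨i, hi, hie⟩
      obtain ⟨i', hi', -, e2⟩ := hsurj i hi
      exact ⟨i', hi', by rw [← e2, hie]⟩
    · rintro ⟨i, hi, hie⟩
      exact ⟨_, rank_lt hi, by rw [hrk i hi, hie]⟩
  · intro i hi hie
    exact (hF i hie).2 fun j hj => by have := rank_lt (K := K) hj; omega

section sorted
variable {n s e : ℕ} {A : ℕ → ℕ → Prop} {F : ℕ → ℕ}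

theorem key_div (v : ℕ) {w : ℕ} (hw : w ≤ n) : (v * (n + 1) + w) / (n + 1) = v := by
  rw [mul_comm, Nat.mul_add_div (by omega), Nat.div_eq_of_lt (by omega), add_zero]

theorem key_mod (v : ℕ) {w : ℕ} (hw : w ≤ n) : (v * (n + 1) + w) % (n + 1) = w := by
  rw [mul_comm, Nat.mul_add_mod, Nat.mod_eq_of_lt (by omega)]

theorem Keys.rel (h : Keys n s A F) {i : ℕ} (hi : i < s) (hw : F i % (n + 1) < n) :
    A (F i / (n + 1)) (F i % (n + 1)) := by
  have := (h.mem _ (h.lt i hi) _ hw.le).1 ⟨i, hi, (Nat.div_add_mod' _ _).symm⟩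
  exact this.resolve_left hw.ne

theorem Keys.lt_sq (h : Keys n s A F) {i : ℕ} (hi : i < s) : F i < n * (n + 1) :=
  (Nat.div_lt_iff_lt_mul (by omega)).1 (h.lt i hi)

/-- Between the last sentinel and the sentinel of `v`, one finds exactly the keys of the vertices
related to `v`. -/
theorem SortedKeys.since_sentinel (h : SortedKeys n s e A F) {i v : ℕ} (hi : i < s)
    (hv : F i = v * (n + 1) + n) (hvn : v < n) {w : ℕ} (hw : w < n) :
    (∃ i' < i, (∀ t, i' ≤ t → t < i → F t % (n + 1) < n) ∧ F i' % (n + 1) = w) ↔ A v w := by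
  constructor
  · rintro ⟨i', hi', ht, hwi⟩
    have hlt := h.lt_of_lt i' i hi' hi
    have hdiv : F i' / (n + 1) ≤ v := by
      have := Nat.div_le_div_right (c := n + 1) hlt.le
      rwa [hv, key_div v le_rfl] at this
    rcases hdiv.lt_or_eq with hl | hl
    · obtain ⟨t, hts, hte⟩ := (h.mem (F i' / (n + 1)) (by omega) n le_rfl).2 (Or.inl rfl)
      have hd := Nat.div_add_mod' (F i') (n + 1)
      have h1 : i' ≤ t := by
        by_contra hc
        have := h.lt_of_lt t i' (not_le.1 hc) (by omega)
        have := ht i' le_rfl hi'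
        omega
      have h2 : t < i := by
        by_contra hc
        rcases Nat.lt_or_eq_of_le (not_lt.1 hc) with hc | hc
        · have h3 := h.lt_of_lt i t hc hts
          have h4 : (F i' / (n + 1) + 1) * (n + 1) ≤ v * (n + 1) := Nat.mul_le_mul_right _ hl
          rw [add_mul] at h4
          omega
        · rw [hc, hte] at hv
          have := congrArg (· / (n + 1)) hv
          simp only [key_div _ (le_refl n)] at this
          omega
      have h3 := ht t h1 h2
      rw [hte, key_mod _ le_rfl] at h3
      omega
    · have := h.rel (i := i') (by omega) (by omega)
      rwa [hl, hwi] at this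
  · intro hA
    obtain ⟨i', hi's, hi'e⟩ := (h.mem v hvn w hw.le).2 (Or.inr hA)
    have hii : i' < i := by
      by_contra hc
      rcases Nat.lt_or_eq_of_le (not_lt.1 hc) with hc | hc
      · have := h.lt_of_lt i i' hc hi's; omega
      · rw [hc, hi'e] at hv; omega
    refine ⟨i', hii, ?_, by rw [hi'e, key_mod v hw.le]⟩
    intro t h1 h2
    have h3 := h.lt_of_lt t i h2 hi
    have h4 : F i' ≤ F t := by
      rcases h1.lt_or_eq with hl | hl
      · exact (h.lt_of_lt i' t hl (by omega)).le
      · rw [hl]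
    obtain ⟨w', hw'⟩ : ∃ w', F t = v * (n + 1) + w' := ⟨F t - v * (n + 1), by omega⟩
    rw [hw', key_mod v (by omega)]
    omega

end sorted

/-! ### Counting vertices at distance at most two -/

/-- Some of the first `P` keys shows that `u` is related to a vertex to which `v` is related. -/
def Hit (n : ℕ) (A : ℕ → ℕ → Prop) (F : ℕ → ℕ) (v u P : ℕ) : Prop :=
  ∃ q < P, F q / (n + 1) = u ∧ F q % (n + 1) < n ∧ A v (F q % (n + 1))

open Classical in
/-- The state of the count for vertex `v` when the first `P` keys have been taken into account: `cnt`
is the number of vertices hit by `v` plus the number of keys of `v`, and `last` is the largest vertex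
hit by `v`, increased by one. -/
structure Counted (n : ℕ) (A : ℕ → ℕ → Prop) (F : ℕ → ℕ) (v P cnt last : ℕ) : Prop where
  le : last ≤ n
  hit_lt : ∀ u, Hit n A F v u P → u < last
  last_hit : last = 0 ∨ Hit n A F v (last - 1) P
  cnt_eq : cnt = ((Finset.range n).filter fun u => Hit n A F v u P).card +
    ((Finset.range P).filter fun q => F q / (n + 1) = v ∧ F q % (n + 1) < n).card

section counted
variable {n s e : ℕ} {A : ℕ → ℕ → Prop} {F : ℕ → ℕ} {v P cnt last : ℕ}

theorem Counted.zero (n : ℕ) (A : ℕ → ℕ → Prop) (F : ℕ → ℕ) (v : ℕ) : Counted n A F v 0 0 0 :=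
  ⟨by omega, by simp [Hit], Or.inl rfl, by simp [Hit]⟩

theorem Counted.cnt_le (h : Counted n A F v P cnt last) : cnt ≤ n + P := by
  classical
  rw [h.cnt_eq]
  gcongr
  · exact (Finset.card_filter_le _ _).trans (Finset.card_range n).le
  · exact (Finset.card_filter_le _ _).trans (Finset.card_range P).le

theorem hit_succ {u : ℕ} : Hit n A F v u (P + 1) ↔ Hit n A F v u P ∨
    F P / (n + 1) = u ∧ F P % (n + 1) < n ∧ A v (F P % (n + 1)) := by
  constructor
  · rintro ⟨q, hq, h⟩
    rcases Nat.lt_succ_iff_lt_or_eq.1 hq with hq | rfl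
    · exact Or.inl ⟨q, hq, h⟩
    · exact Or.inr h
  · rintro (⟨q, hq, h⟩ | h)
    · exact ⟨q, by omega, h⟩
    · exact ⟨P, by omega, h⟩

open Classical in
/-- One step of the count.  As the keys are sorted, a vertex has been hit before iff it is the largest
one that has been hit. -/
theorem Counted.step (h : Counted n A F v P cnt last) (hF : SortedKeys n s e A F) (hP : P < e) :
    Counted n A F v (P + 1)
      ((if (F P % (n + 1) < n ∧ A v (F P % (n + 1))) ∧ last < F P / (n + 1) + 1
        then cnt + 1 else cnt) + if F P / (n + 1) = v ∧ F P % (n + 1) < n then 1 else 0)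
      (if (F P % (n + 1) < n ∧ A v (F P % (n + 1))) ∧ last < F P / (n + 1) + 1
        then F P / (n + 1) + 1 else last) := by
  have hr : ((Finset.range (P + 1)).filter fun q => F q / (n + 1) = v ∧ F q % (n + 1) < n).card =
      ((Finset.range P).filter fun q => F q / (n + 1) = v ∧ F q % (n + 1) < n).card +
        if F P / (n + 1) = v ∧ F P % (n + 1) < n then 1 else 0 := by
    rw [Finset.range_add_one, Finset.filter_insert]
    split_ifs
    · rw [Finset.card_insert_of_notMem (by simp)]
    · rfl
  have hPs : F P % (n + 1) < n → P < s := by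
    intro hw
    by_contra hc
    rw [hF.tail P (not_lt.1 hc) hP, Nat.mod_eq_of_lt (by omega)] at hw
    omega
  by_cases hm : F P % (n + 1) < n ∧ A v (F P % (n + 1))
  · have hun := hF.lt P (hPs hm.1)
    by_cases hl : last < F P / (n + 1) + 1
    · have hc : (F P % (n + 1) < n ∧ A v (F P % (n + 1))) ∧ last < F P / (n + 1) + 1 := ⟨hm, hl⟩
      simp only [if_pos hc]
      refine ⟨by omega, ?_, Or.inr ?_, ?_⟩
      · intro u hu
        rcases hit_succ.1 hu with hu | hu
        · have := h.hit_lt u hu; omega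
        · omega
      · exact hit_succ.2 (Or.inr ⟨by omega, hm⟩)
      · rw [hr, h.cnt_eq]
        have hnot : ¬ Hit n A F v (F P / (n + 1)) P := fun hh => by
          have := h.hit_lt _ hh; omega
        have : ((Finset.range n).filter fun u => Hit n A F v u (P + 1)) =
            insert (F P / (n + 1)) ((Finset.range n).filter fun u => Hit n A F v u P) := by
          ext u
          simp only [Finset.mem_filter, Finset.mem_range, Finset.mem_insert, hit_succ]
          constructor
          · rintro ⟨h1, h2 | h2⟩
            · exact Or.inr ⟨h1, h2⟩
            · exact Or.inl h2.1.symm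
          · rintro (rfl | h2)
            · exact ⟨hun, Or.inr ⟨rfl, hm⟩⟩
            · exact ⟨h2.1, Or.inl h2.2⟩
        rw [this, Finset.card_insert_of_notMem (by simp [hnot])]
        omega
    · have hc : ¬ ((F P % (n + 1) < n ∧ A v (F P % (n + 1))) ∧ last < F P / (n + 1) + 1) :=
        fun hc => hl hc.2
      simp only [if_neg hc]
      have hold : Hit n A F v (F P / (n + 1)) P := by
        rcases h.last_hit with h0 | h0
        · rw [h0] at hl
          exact absurd (Nat.succ_pos _) hl
        · obtain ⟨q, hq, h1, h2⟩ := id h0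
          have h3 : F q / (n + 1) ≤ F P / (n + 1) :=
            Nat.div_le_div_right (hF.lt_of_lt q P hq (hPs hm.1)).le
          have h4 : last - 1 = F P / (n + 1) := by omega
          rwa [h4] at h0
      have hiff : ∀ u, Hit n A F v u (P + 1) ↔ Hit n A F v u P := by
        intro u
        rw [hit_succ]
        constructor
        · rintro (h1 | h1)
          · exact h1
          · rwa [← h1.1]
        · exact Or.inl
      refine ⟨h.le, fun u hu => h.hit_lt u ((hiff u).1 hu), ?_, ?_⟩
      · rw [hiff]; exact h.last_hit
      · simp only [hiff]; rw [hr, h.cnt_eq, add_assoc]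
  · have hc : ¬ ((F P % (n + 1) < n ∧ A v (F P % (n + 1))) ∧ last < F P / (n + 1) + 1) :=
      fun hc => hm hc.1
    simp only [if_neg hc]
    have hiff : ∀ u, Hit n A F v u (P + 1) ↔ Hit n A F v u P := by
      intro u
      rw [hit_succ]
      exact or_iff_left fun hc => hm hc.2
    refine ⟨h.le, fun u hu => h.hit_lt u ((hiff u).1 hu), ?_, ?_⟩
    · rw [hiff]; exact h.last_hit
    · simp only [hiff]; rw [hr, h.cnt_eq, add_assoc]

open Classical in
/-- Once all keys have been taken into account, the vertices hit are those at distance at most two, and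
the keys of `v` correspond to the vertices at distance at most one. -/
theorem Counted.cnt_final (h : Counted n A F v e cnt last) (hF : SortedKeys n s e A F)
    (hse : s ≤ e) (hv : v < n) (hA : ∀ u w, A u w → u < n ∧ w < n) :
    cnt = ((Finset.range n).filter fun u => ∃ w, A v w ∧ A u w).card +
      ((Finset.range n).filter fun u => A v u).card := by
  have hs : ∀ q < e, F q % (n + 1) < n → q < s := by
    intro q hq hw
    by_contra hc
    rw [hF.tail q (not_lt.1 hc) hq, Nat.mod_eq_of_lt (by omega)] at hw
    omega
  rw [h.cnt_eq]
  congr 1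
  · congr 1
    ext u
    simp only [Finset.mem_filter, Finset.mem_range, and_congr_right_iff]
    intro hu
    constructor
    · rintro ⟨q, hq, rfl, h2, h3⟩
      exact ⟨_, h3, hF.rel (hs q hq h2) h2⟩
    · rintro ⟨w, h1, h2⟩
      have hw := (hA _ _ h2).2
      obtain ⟨q, hq, hq'⟩ := (hF.mem u hu w hw.le).2 (Or.inr h2)
      exact ⟨q, by omega, by rw [hq', key_div _ hw.le], by rwa [hq', key_mod _ hw.le],
        by rwa [hq', key_mod _ hw.le]⟩
  · refine Finset.card_bij (fun q _ => F q % (n + 1)) ?_ ?_ ?_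
    · intro q hq
      simp only [Finset.mem_filter, Finset.mem_range] at hq ⊢
      obtain ⟨h1, rfl, h3⟩ := hq
      exact ⟨h3, hF.rel (hs q h1 h3) h3⟩
    · intro q hq q' hq' he
      simp only [Finset.mem_filter, Finset.mem_range] at hq hq'
      refine hF.inj q (hs q hq.1 hq.2.2) q' (hs q' hq'.1 hq'.2.2) ?_
      rw [← Nat.div_add_mod' (F q) (n + 1), ← Nat.div_add_mod' (F q') (n + 1), hq.2.1, hq'.2.1, he]
    · intro w hw
      simp only [Finset.mem_filter, Finset.mem_range] at hw ⊢
      obtain ⟨q, hq, hq'⟩ := (hF.mem v hv w hw.1.le).2 (Or.inr hw.2)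
      exact ⟨q, ⟨by omega, by rw [hq', key_div _ hw.1.le], by rw [hq', key_mod _ hw.1.le]; exact hw.1⟩,
        by rw [hq', key_mod _ hw.1.le]⟩

end counted

/-- Mark in array `1` the keys of the block whose second vertex is in `rgW`. -/
def markLoop : Cmd :=
  .iter rgJ rgD (.get rgY 0 (var rgJ) ;;
    .ite (.eq (var rgY % var rgC) (var rgW)) (.put 1 (var rgJ) 1) .skip)

/-- Update the count for vertex `rgU` by means of the marks, and remove the marks. -/
def countLoop : Cmd :=
  .iter rgJ rgD (.get rgY 0 (var rgJ) ;; .get rgZ 1 (var rgJ) ;; .put 1 (var rgJ) 0 ;;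
    .ite (var rgZ * .lt (var rgL) (var rgY / var rgC + 1))
      (.set rgX (var rgX + 1) ;; .set rgL (var rgY / var rgC + 1)) .skip ;;
    .ite (.eq (var rgY / var rgC) (var rgU) * .lt (var rgY % var rgC) (var rgN))
      (.set rgX (var rgX + 1)) .skip)

/-- Update the entry of vertex `rgU` in file `4`. -/
def countVertex : Cmd :=
  .read rgZ 4 (var rgU) ;; .set rgX (var rgZ / var rgC) ;; .set rgL (var rgZ % var rgC) ;;
  countLoop ;; .write 4 (var rgU) (var rgX * var rgC + var rgL)

/-- Compare all keys with the block of keys in array `0`.  The keys of a vertex `v` mark the keys of the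
block with the same second vertex; when the sentinel of `v` follows, the first vertices of the marked
keys are those that `v` hits within the block. -/
def countStream : Cmd :=
  .iter rgI rgS (.read rgX 3 (var rgI) ;; .set rgU (var rgX / var rgC) ;;
    .set rgW (var rgX % var rgC) ;; .ite (.lt (var rgW) (var rgN)) markLoop countVertex)

/-- Take one block of keys into account. -/
def countBlock : Cmd := loadBlock 3 0 ;; .set rgZ 0 ;; fillBlock 1 rgZ ;; countStream

/-- For every vertex, write to file `4` the total number of vertices within distance one and of
vertices within distance two, combined with the largest of the latter into one word. -/
def countCmd : Cmd := .iter rgK rgR countBlock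

section count
variable {p : Par} {n m s D R : ℕ} {a : AState}

theorem markLoop_spec (d : Dims p n m s D R) (r : Regs n m s D R a) (ok : a.ok) {w : ℕ}
    (hw : a.v rgW = w) (h0 : ∀ j < D, a.arr 0 j < p.W) :
    (markLoop.exec p a).ok ∧ ∀ j < D, (markLoop.exec p a).arr 1 j =
      if a.arr 0 j % (n + 1) = w then 1 else a.arr 1 j := by
  have hZ := d.two_s_lt
  have hZW := d.Z_le_W
  have hDM := d.hDM
  have hDs := d.hDs
  obtain ⟨t, ⟨A1, A2⟩, h3, e⟩ := exec_for_frame p (x := rgJ) (y := rgD)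
    (c := .get rgY 0 (var rgJ) ;;
      .ite (.eq (var rgY % var rgC) (var rgW)) (.put 1 (var rgJ) 1) .skip) (a := a)
    (fun i t => (∀ j < i, t.arr 1 j = if a.arr 0 j % (n + 1) = w then 1 else a.arr 1 j) ∧
      ∀ j, i ≤ j → t.arr 1 j = a.arr 1 j)
    r.D (by omega) ⟨by simp, fun _ _ => rfl⟩ ok (by
      rintro i t hi hiW F hok ⟨A1, A2⟩
      have e1 := (F.v 20 (by decide) rfl).trans hw
      have e6 := (F.v 6 (by decide) rfl).trans r.C
      have e2 := F.arr 0 rfl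
      have b0 := h0 i hi
      have b1 : 1 < p.W := by omega
      rw [Cmd.exec_seq]
      generalize hu : (Cmd.get rgY 0 (var rgJ)).exec p (t.setv p rgJ i) = u
      have uok : u.ok := by
        rw [← hu]; simp [Cmd.exec, hok, e2, b0]; omega
      have uy : u.v rgY = a.arr 0 i := by rw [← hu]; simp [Cmd.exec, e2]
      have uj : u.v rgJ = i := by rw [← hu]; simp [Cmd.exec]
      have uc : u.v rgC = n + 1 := by rw [← hu]; simp [Cmd.exec, e6]
      have uw : u.v rgW = w := by rw [← hu]; simp [Cmd.exec, e1]
      have ua : u.arr = t.arr := by rw [← hu]; simp [Cmd.exec]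
      by_cases hm : a.arr 0 i % (n + 1) = w
      · rw [Cmd.exec_ite_of_ne (by simp [AExpr.eval_eq_eq_zero, uy, uc, uw, hm])]
        refine ⟨⟨?_, ?_⟩, ?_⟩
        · intro j hj
          simp only [Cmd.exec, AExpr.eval_var, AExpr.eval_ofNat, uj, setArr_arr,
            Function.update_self, ua]
          by_cases hji : j = i
          · subst hji; simp [hm]
          · rw [Function.update_of_ne hji]; exact A1 j (by omega)
        · intro j hj
          simp only [Cmd.exec, AExpr.eval_var, AExpr.eval_ofNat, uj, setArr_arr,
            Function.update_self, ua]
          rw [Function.update_of_ne (by omega)]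
          exact A2 j (by omega)
        · simp [Cmd.exec, uok, uj, b1]; omega
      · rw [Cmd.exec_ite_of_eq (by simp [AExpr.eval_eq_eq_zero, uy, uc, uw, hm]), Cmd.exec, ua]
        refine ⟨⟨?_, fun j hj => A2 j (by omega)⟩, uok⟩
        intro j hj
        rcases Nat.lt_succ_iff_lt_or_eq.1 hj with hj | rfl
        · exact A1 j hj
        · rw [if_neg hm]; exact A2 j le_rfl)
  rw [markLoop, e]
  exact ⟨e ▸ h3, A1⟩

theorem countLoop_spec (d : Dims p n m s D R) (r : Regs n m s D R a) (ok : a.ok)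
    {A : ℕ → ℕ → Prop} {F : ℕ → ℕ} (hF : SortedKeys n s (R * D) A F) {k v cnt last : ℕ}
    (hkR : k < R) (hv : a.v rgU = v) (hFW : ∀ i < R * D, F i < p.W)
    (h0 : ∀ j < D, a.arr 0 j = F (k * D + j))
    (h1 : ∀ j < D, a.arr 1 j ≤ 1 ∧
      (a.arr 1 j ≠ 0 ↔ F (k * D + j) % (n + 1) < n ∧ A v (F (k * D + j) % (n + 1))))
    (hx : a.v rgX = cnt) (hl : a.v rgL = last) (hc : Counted n A F v (k * D) cnt last) :
    (countLoop.exec p a).ok ∧ (∀ j < D, (countLoop.exec p a).arr 1 j = 0) ∧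
    Counted n A F v (k * D + D) ((countLoop.exec p a).v rgX) ((countLoop.exec p a).v rgL) := by
  classical
  have hZ := d.two_s_lt
  have hZW := d.Z_le_W
  have hZ' := d.hZ
  have hDM := d.hDM
  have hDs := d.hDs
  have hs := d.hs
  have hblk := d.block hkR
  have hkD : k * D + D ≤ R * D := by
    have : (k + 1) * D ≤ R * D := Nat.mul_le_mul_right _ hkR
    rwa [add_mul, one_mul] at this
  obtain ⟨t, ⟨A1, A2, A3⟩, h3, e⟩ := exec_for_frame p (x := rgJ) (y := rgD)
    (c := .get rgY 0 (var rgJ) ;; .get rgZ 1 (var rgJ) ;; .put 1 (var rgJ) 0 ;;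
      .ite (var rgZ * .lt (var rgL) (var rgY / var rgC + 1))
        (.set rgX (var rgX + 1) ;; .set rgL (var rgY / var rgC + 1)) .skip ;;
      .ite (.eq (var rgY / var rgC) (var rgU) * .lt (var rgY % var rgC) (var rgN))
        (.set rgX (var rgX + 1)) .skip) (a := a)
    (fun i t => (∀ j < i, t.arr 1 j = 0) ∧ (∀ j, i ≤ j → t.arr 1 j = a.arr 1 j) ∧
      Counted n A F v (k * D + i) (t.v rgX) (t.v rgL))
    r.D (by omega) ⟨by simp, fun _ _ => rfl, by rw [hx, hl]; exact hc⟩ ok (by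
      rintro i t hi hiW Fr hok ⟨A1, A2, A3⟩
      have eU := (Fr.v 19 (by decide) rfl).trans hv
      have eC := (Fr.v 6 (by decide) rfl).trans r.C
      have eN := (Fr.v 0 (by decide) rfl).trans r.N
      have e0 := Fr.arr 0 rfl
      have f0 := h0 i hi
      have f1 := h1 i hi
      have f2 := hFW (k * D + i) (by omega)
      have f3 := A2 i le_rfl
      have f4 := A3.cnt_le
      have hst := A3.step hF (by omega)
      have f5 := hst.cnt_le
      have f6 := hst.le
      rw [Cmd.exec_seq, Cmd.exec_seq, Cmd.exec_seq, Cmd.exec_seq]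
      generalize hu : (Cmd.put 1 (var rgJ) 0).exec p ((Cmd.get rgZ 1 (var rgJ)).exec p
        ((Cmd.get rgY 0 (var rgJ)).exec p (t.setv p rgJ i))) = u
      have uok : u.ok := by
        rw [← hu]; simp [Cmd.exec, hok, e0, f0, f2, f3]; omega
      have uy : u.v rgY = F (k * D + i) := by rw [← hu]; simp [Cmd.exec, e0, f0]
      have uz : u.v rgZ = a.arr 1 i := by rw [← hu]; simp [Cmd.exec, f3]
      have uc : u.v rgC = n + 1 := by rw [← hu]; simp [Cmd.exec, eC]
      have un : u.v rgN = n := by rw [← hu]; simp [Cmd.exec, eN]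
      have uu : u.v rgU = v := by rw [← hu]; simp [Cmd.exec, eU]
      have ux : u.v rgX = t.v rgX := by rw [← hu]; simp [Cmd.exec]
      have ul : u.v rgL = t.v rgL := by rw [← hu]; simp [Cmd.exec]
      have ua1 : ∀ j < i + 1, u.arr 1 j = 0 := by
        intro j hj
        rw [← hu]; simp [Cmd.exec]
        by_cases hji : j = i
        · subst hji; simp
        · rw [Function.update_of_ne hji]; exact A1 j (by omega)
      have ua2 : ∀ j, i + 1 ≤ j → u.arr 1 j = a.arr 1 j := by
        intro j hj
        rw [← hu]; simp [Cmd.exec]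
        rw [Function.update_of_ne (by omega)]; exact A2 j (by omega)
      clear hu
      generalize hw : (Cmd.ite (var rgZ * .lt (var rgL) (var rgY / var rgC + 1))
        (.set rgX (var rgX + 1) ;; .set rgL (var rgY / var rgC + 1)) .skip).exec p u = w
      have key : w.ok ∧ w.v rgX = (if (F (k * D + i) % (n + 1) < n ∧
          A v (F (k * D + i) % (n + 1))) ∧ t.v rgL < F (k * D + i) / (n + 1) + 1
            then t.v rgX + 1 else t.v rgX) ∧
          w.v rgL = (if (F (k * D + i) % (n + 1) < n ∧
          A v (F (k * D + i) % (n + 1))) ∧ t.v rgL < F (k * D + i) / (n + 1) + 1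
            then F (k * D + i) / (n + 1) + 1 else t.v rgL) := by
        by_cases hm : (F (k * D + i) % (n + 1) < n ∧ A v (F (k * D + i) % (n + 1))) ∧
            t.v rgL < F (k * D + i) / (n + 1) + 1
        · rw [if_pos hm] at f5 f6 ⊢
          rw [if_pos hm]
          have hz : a.arr 1 i ≠ 0 := f1.2.2 hm.1
          rw [Cmd.exec_ite_of_ne (by
            simp only [AExpr.eval_mul, AExpr.eval_var, ne_eq, mul_eq_zero, AExpr.eval_lt_eq_zero,
              AExpr.eval_add, AExpr.eval_div, AExpr.eval_ofNat, uz, uy, ul, uc]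
            have := hm.2
            omega)] at hw
          rw [← hw]
          simp [Cmd.exec, uok, ux, uy, uc]
          omega
        · rw [if_neg hm, if_neg hm]
          rw [Cmd.exec_ite_of_eq (by
            simp only [AExpr.eval_mul, AExpr.eval_var, mul_eq_zero, AExpr.eval_lt_eq_zero,
              AExpr.eval_add, AExpr.eval_div, AExpr.eval_ofNat, uz, uy, ul, uc]
            by_cases hz : a.arr 1 i = 0
            · exact Or.inl hz
            · exact Or.inr fun hc => hm ⟨f1.2.1 hz, hc⟩), Cmd.exec] at hw
          rw [← hw]
          exact ⟨uok, ux, ul⟩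
      have wfr : ∀ z, z ≠ rgX → z ≠ rgL → w.v z = u.v z := by
        intro z hz1 hz2
        rw [← hw]
        exact Cmd.exec_frame_v p z _ u (by simp [Cmd.writesVar, hz1, hz2])
      have wa : w.arr = u.arr := by
        rw [← hw]; funext b; exact Cmd.exec_frame_arr p b _ u rfl
      obtain ⟨wok, wx, wl⟩ := key
      rw [← wx, ← wl] at hst
      have wy := (wfr rgY (by decide) (by decide)).trans uy
      have wc := (wfr rgC (by decide) (by decide)).trans uc
      have wn := (wfr rgN (by decide) (by decide)).trans un
      have wu := (wfr rgU (by decide) (by decide)).trans uu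
      clear hw wfr
      by_cases hm : F (k * D + i) / (n + 1) = v ∧ F (k * D + i) % (n + 1) < n
      · rw [if_pos hm] at hst
        have f5 := hst.cnt_le
        rw [Cmd.exec_ite_of_ne (by
          simp [AExpr.eval_lt_eq_zero, AExpr.eval_eq_eq_zero, wy, wc, wu, wn, hm])]
        refine ⟨⟨?_, ?_, ?_⟩, ?_⟩
        · simpa [Cmd.exec, wa] using ua1
        · simpa [Cmd.exec, wa] using ua2
        · simpa [Cmd.exec, add_assoc] using hst
        · simp [Cmd.exec, wok]; omega
      · rw [if_neg hm] at hst
        rw [Cmd.exec_ite_of_eq (by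
          simp only [AExpr.eval_mul, AExpr.eval_var, mul_eq_zero, AExpr.eval_lt_eq_zero,
            AExpr.eval_div, AExpr.eval_mod, AExpr.eval_eq_eq_zero, wy, wc, wu, wn]
          tauto), Cmd.exec, wa]
        exact ⟨⟨ua1, ua2, hst⟩, wok⟩)
  rw [countLoop, e]
  exact ⟨e ▸ h3, A1, by simpa using A3⟩

theorem countVertex_spec (d : Dims p n m s D R) (r : Regs n m s D R a) (ok : a.ok)
    {A : ℕ → ℕ → Prop} {F : ℕ → ℕ} (hF : SortedKeys n s (R * D) A F) {k v cnt last : ℕ}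
    (hkR : k < R) (hv : a.v rgU = v) (hvn : v < n) (hFW : ∀ i < R * D, F i < p.W)
    (h0 : ∀ j < D, a.arr 0 j = F (k * D + j))
    (h1 : ∀ j < D, a.arr 1 j ≤ 1 ∧
      (a.arr 1 j ≠ 0 ↔ F (k * D + j) % (n + 1) < n ∧ A v (F (k * D + j) % (n + 1))))
    (h4 : a.file 4 v = cnt * (n + 1) + last) (hc : Counted n A F v (k * D) cnt last)
    {a₀ : AState} {q : ℕ} (hq : q ≤ v) (hS : Scan p 4 a₀ q a) :
    (countVertex.exec p a).ok ∧ (∀ j < D, (countVertex.exec p a).arr 1 j = 0) ∧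
    (∃ cnt' last', (countVertex.exec p a).file 4 v = cnt' * (n + 1) + last' ∧
      Counted n A F v (k * D + D) cnt' last') ∧
    (∀ u, u ≠ v → (countVertex.exec p a).file 4 u = a.file 4 u) ∧
    Scan p 4 a₀ v (countVertex.exec p a) := by
  have hZ := d.two_s_lt
  have hZW := d.Z_le_W
  have hs := d.hs
  have hblk := d.block hkR
  have hpack : ∀ P cnt last, P ≤ 2 * s → Counted n A F v P cnt last →
      cnt * (n + 1) + last < p.W := by
    intro P cnt last hP hc
    have h1 := hc.cnt_le
    have h2 := hc.le
    have hZ' := d.hZ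
    refine lt_of_le_of_lt ?_ (d.mul_lt (x := cnt) (y := last) (by omega) (by omega))
    exact Nat.add_le_add_right (Nat.mul_le_mul_left _ (by omega)) _
  have hle := hc.le
  have hcl := hc.cnt_le
  have e1 := hpack _ _ _ (by omega) hc
  rw [countVertex, Cmd.exec_seq, Cmd.exec_seq, Cmd.exec_seq, Cmd.exec_seq]
  generalize hu : (Cmd.set rgL (var rgZ % var rgC)).exec p ((Cmd.set rgX (var rgZ / var rgC)).exec p
    ((Cmd.read rgZ 4 (var rgU)).exec p a)) = u
  have uok : u.ok := by
    rw [← hu]; simp [Cmd.exec, ok, hv, h4, e1, r.C]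
    rw [key_div _ hle]
    have := Nat.mod_le last (n + 1)
    have := Nat.le_mul_of_pos_right cnt (show 0 < n + 1 by omega)
    omega
  have ux : u.v rgX = cnt := by
    rw [← hu]; simp only [Cmd.exec, setv_v]; simp [hv, h4, r.C]; rw [key_div _ hle]
  have ul : u.v rgL = last := by
    rw [← hu]; simp only [Cmd.exec, setv_v]; simp [hv, h4, r.C]; exact hle
  have uu : u.v rgU = v := by rw [← hu]; simp [Cmd.exec, hv]
  have uc : u.v rgC = n + 1 := by rw [← hu]; simp [Cmd.exec, r.C]
  have ua : u.arr = a.arr := by rw [← hu]; simp [Cmd.exec]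
  have uf : u.file = a.file := by rw [← hu]; simp [Cmd.exec]
  have ur : Regs n m s D R u := by
    rw [← hu]; exact ((r.exec _ (by decide)).exec _ (by decide)).exec _ (by decide)
  have us : Scan p 4 a₀ v u := by
    rw [← hu]; simp [Cmd.exec, hv]; exact (hS.touch hq).congr rfl rfl
  clear hu
  obtain ⟨B1, B2, B3⟩ := countLoop_spec d ur uok hF hkR uu hFW (by rwa [ua]) (by rwa [ua]) ux ul hc
  have wc := (countLoop.exec_frame_v p rgC u rfl).trans uc
  have wu := (countLoop.exec_frame_v p rgU u rfl).trans uu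
  have wf := countLoop.exec_frame_file p 4 u rfl
  have ws := us.exec countLoop rfl
  generalize countLoop.exec p u = w at *
  have e2 := hpack _ _ _ hblk B3
  refine ⟨?_, ?_, ⟨w.v rgX, w.v rgL, ?_, B3⟩, ?_, ?_⟩
  · simp [Cmd.exec, B1, wu, wc, e2]; omega
  · simpa [Cmd.exec] using B2
  · simp [Cmd.exec, wu, wc]
  · intro x hx
    simp [Cmd.exec, wu, wc, hx, wf, uf]
  · simp [Cmd.exec, wu, wc]
    exact (ws.touch le_rfl).congr rfl rfl

theorem countStream_spec (d : Dims p n m s D R) (r : Regs n m s D R a) (ok : a.ok)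
    {A : ℕ → ℕ → Prop} {F : ℕ → ℕ} (hF : SortedKeys n s (R * D) A F) {k : ℕ}
    (hkR : k < R) (hFW : ∀ i < R * D, F i < p.W) (h3 : ∀ i < R * D, a.file 3 i = F i)
    (h0 : ∀ j < D, a.arr 0 j = F (k * D + j)) (h1 : ∀ j < D, a.arr 1 j = 0)
    (h4 : ∀ v < n, ∃ cnt last, a.file 4 v = cnt * (n + 1) + last ∧
      Counted n A F v (k * D) cnt last) :
    (countStream.exec p a).ok ∧
    (∀ v < n, ∃ cnt last, (countStream.exec p a).file 4 v = cnt * (n + 1) + last ∧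
      Counted n A F v (k * D + D) cnt last) ∧
    Scan p 3 a (2 * s) (countStream.exec p a) ∧ Scan p 4 a (2 * s) (countStream.exec p a) := by
  classical
  have hZ := d.two_s_lt
  have hZW := d.Z_le_W
  have hs := d.hs
  have hblk := d.block hkR
  have hkD : k * D + D ≤ R * D := by
    have : (k + 1) * D ≤ R * D := Nat.mul_le_mul_right _ hkR
    rwa [add_mul, one_mul] at this
  have hR := d.hR
  obtain ⟨t, ⟨A1, A2, A3, q, A4, A5, A6⟩, h5, e⟩ := exec_for_frame p (x := rgI) (y := rgS)
    (c := .read rgX 3 (var rgI) ;; .set rgU (var rgX / var rgC) ;;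
      .set rgW (var rgX % var rgC) ;; .ite (.lt (var rgW) (var rgN)) markLoop countVertex) (a := a)
    (fun i t =>
      (∀ j < D, t.arr 1 j ≤ 1 ∧ (t.arr 1 j ≠ 0 ↔ ∃ i' < i,
        (∀ t, i' ≤ t → t < i → F t % (n + 1) < n) ∧
        F i' % (n + 1) = F (k * D + j) % (n + 1))) ∧
      (∀ v < n, ∃ cnt last, t.file 4 v = cnt * (n + 1) + last ∧
        Counted n A F v (if ∃ i' < i, F i' = v * (n + 1) + n then k * D + D else k * D) cnt last) ∧
      Scan p 3 a i t ∧
      ∃ q, Scan p 4 a q t ∧ q ≤ n ∧ ∀ i', i ≤ i' → i' < s → q ≤ F i' / (n + 1))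
    r.S (by omega) ⟨fun j hj => by simp [h1 j hj], by simpa using h4, Scan.refl _ _, 0,
      Scan.refl _ _, by omega, fun _ _ _ => Nat.zero_le _⟩ ok (by
      rintro i t hi hiW Fr hok ⟨A1, A2, A3, q, A4, A5, A6⟩
      have e3 := Fr.file 3 rfl
      have e0 := Fr.arr 0 rfl
      have g3 := h3 i (by omega)
      have b3 := hFW i (by omega)
      have eN := (Fr.v 0 (by decide) rfl).trans r.N
      have eC := (Fr.v 6 (by decide) rfl).trans r.C
      rw [Cmd.exec_seq, Cmd.exec_seq, Cmd.exec_seq]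
      have hun := hF.lt i hi
      generalize hu : (Cmd.set rgW (var rgX % var rgC)).exec p
        ((Cmd.set rgU (var rgX / var rgC)).exec p
          ((Cmd.read rgX 3 (var rgI)).exec p (t.setv p rgI i))) = u
      have uu : u.v rgU = F i / (n + 1) := by
        rw [← hu]; simp [Cmd.exec, e3, g3, eC]
      have uw : u.v rgW = F i % (n + 1) := by
        rw [← hu]; simp [Cmd.exec, e3, g3, eC]
      have un : u.v rgN = n := by rw [← hu]; simp [Cmd.exec, eN]
      have uok : u.ok := by
        have := Nat.mod_le (F i) (n + 1)
        rw [← hu]; simp [Cmd.exec, e3, g3, eC, hok]; omega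
      have ur : Regs n m s D R u := by
        rw [← hu]
        exact ((((r.frame Fr (by decide) (by decide)).setv (by decide)).exec _ (by decide)).exec _
          (by decide)).exec _ (by decide)
      have ua : u.arr = t.arr := by rw [← hu]; simp [Cmd.exec]
      have uf : u.file = t.file := by rw [← hu]; simp [Cmd.exec]
      have us3 : Scan p 3 a i u := by
        rw [← hu]; simp [Cmd.exec]; exact (A3.touch le_rfl).congr rfl rfl
      have us4 : Scan p 4 a q u := by
        rw [← hu]; simp [Cmd.exec]
        exact (A4.touch_ne (g := 3) (i := i) (by decide)).congr rfl rfl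
      clear hu
      have hlast := Nat.div_add_mod' (F i) (n + 1)
      by_cases hw : F i % (n + 1) < n
      · rw [Cmd.exec_ite_of_ne (by
          rw [Ne, AExpr.eval_lt_eq_zero, AExpr.eval_var, AExpr.eval_var, uw, un, not_not]
          exact hw)]
        obtain ⟨C1, C2⟩ := markLoop_spec d ur uok uw (by
          intro j hj; rw [ua, e0, h0 j hj]; exact hFW _ (by omega))
        have cf := markLoop.exec_frame_file p 4 u rfl
        have cs3 := us3.exec markLoop rfl
        have cs4 := us4.exec markLoop rfl
        generalize markLoop.exec p u = w at *
        refine ⟨⟨?_, ?_, cs3.mono (by omega), q, cs4, A5, fun i' h1 => A6 i' (by omega)⟩, C1⟩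
        · intro j hj
          obtain ⟨D1, D2⟩ := A1 j hj
          rw [C2 j hj, ua, e0, h0 j hj]
          split_ifs with hc
          · refine ⟨le_rfl, iff_of_true one_ne_zero ⟨i, by omega, fun t h1 h2 => ?_, hc.symm⟩⟩
            rwa [show t = i by omega]
          · refine ⟨D1, D2.trans ?_⟩
            constructor
            · rintro ⟨i', h1, h2, h3⟩
              refine ⟨i', by omega, fun t h4 h5 => ?_, h3⟩
              rcases Nat.lt_succ_iff_lt_or_eq.1 h5 with h5 | rfl
              · exact h2 t h4 h5
              · exact hw
            · rintro ⟨i', h1, h2, h3⟩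
              refine ⟨i', ?_, fun t h4 h5 => h2 t h4 (by omega), h3⟩
              rcases Nat.lt_succ_iff_lt_or_eq.1 h1 with h1 | rfl
              · exact h1
              · exact absurd h3.symm hc
        · intro v hv
          obtain ⟨cnt, last, E1, E2⟩ := A2 v hv
          refine ⟨cnt, last, by rw [cf, uf, E1], ?_⟩
          convert E2 using 1
          congr 1
          refine propext ⟨?_, ?_⟩
          · rintro ⟨i', h1, h2⟩
            rcases Nat.lt_succ_iff_lt_or_eq.1 h1 with h1 | rfl
            · exact ⟨i', h1, h2⟩
            · rw [h2, key_mod _ le_rfl] at hw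
              omega
          · rintro ⟨i', h1, h2⟩
            exact ⟨i', by omega, h2⟩
      · rw [Cmd.exec_ite_of_eq (by
          rw [AExpr.eval_lt_eq_zero, AExpr.eval_var, AExpr.eval_var, uw, un]
          exact hw)]
        have hwn : F i % (n + 1) = n := by
          have := Nat.mod_lt (F i) (show 0 < n + 1 by omega)
          omega
        generalize hv : F i / (n + 1) = v at *
        have hFi : F i = v * (n + 1) + n := by rw [← hlast, hwn]
        obtain ⟨cnt, last, E1, E2⟩ := A2 v hun
        rw [if_neg (by
          rintro ⟨i', h1, h2⟩
          have := hF.lt_of_lt i' i h1 hi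
          omega)] at E2
        obtain ⟨C1, C2, C3, C4, C5⟩ := countVertex_spec d ur uok hF hkR uu hun hFW
          (by rwa [ua, e0]) (by
            intro j hj
            obtain ⟨D1, D2⟩ := A1 j hj
            rw [ua]
            refine ⟨D1, D2.trans ?_⟩
            by_cases hj' : F (k * D + j) % (n + 1) < n
            · rw [hF.since_sentinel hi hFi hun hj']
              exact (and_iff_right hj').symm
            · refine iff_of_false ?_ fun hc => hj' hc.1
              rintro ⟨i', h1, h2, h3⟩
              exact hj' (h3 ▸ h2 i' le_rfl h1)) (by rw [uf]; exact E1) E2 (by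
            rw [← hv]; exact A6 i le_rfl hi) us4
        have cs3 := us3.exec countVertex rfl
        generalize countVertex.exec p u = w at *
        refine ⟨⟨?_, ?_, cs3.mono (by omega), v, C5, hun.le, ?_⟩, C1⟩
        · intro j hj
          rw [C2 j hj]
          refine ⟨by omega, iff_of_false (by simp) ?_⟩
          rintro ⟨i', h1, h2, -⟩
          exact hw (h2 i (by omega) (by omega))
        · intro u' hu'
          by_cases huv : u' = v
          · subst huv
            obtain ⟨cnt', last', E3, E4⟩ := C3
            exact ⟨cnt', last', E3, by rwa [if_pos ⟨i, by omega, hFi⟩]⟩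
          · obtain ⟨cnt, last, E1, E2⟩ := A2 u' hu'
            refine ⟨cnt, last, by rw [C4 u' huv, uf, E1], ?_⟩
            convert E2 using 1
            congr 1
            refine propext ⟨?_, ?_⟩
            · rintro ⟨i', h1, h2⟩
              rcases Nat.lt_succ_iff_lt_or_eq.1 h1 with h1 | rfl
              · exact ⟨i', h1, h2⟩
              · rw [h2, key_div _ le_rfl] at hv
                exact absurd hv huv
            · rintro ⟨i', h1, h2⟩
              exact ⟨i', by omega, h2⟩
        · intro i' h1 h2
          rw [← hv]
          exact Nat.div_le_div_right (hF.lt_of_lt i i' (by omega) h2).le)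
  rw [countStream, e]
  refine ⟨e ▸ h5, ?_, A3.mono (by omega), A4.mono (by omega)⟩
  intro v hv
  obtain ⟨cnt, last, E1, E2⟩ := A2 v hv
  rw [if_pos ((hF.mem v hv n le_rfl).2 (Or.inl rfl))] at E2
  exact ⟨cnt, last, E1, E2⟩

theorem countBlock_spec (d : Dims p n m s D R) (r : Regs n m s D R a) (ok : a.ok)
    {A : ℕ → ℕ → Prop} {F : ℕ → ℕ} (hF : SortedKeys n s (R * D) A F) {k : ℕ}
    (hk : a.v rgK = k) (hkR : k < R) (hFW : ∀ i < R * D, F i < p.W)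
    (h3 : ∀ i < R * D, a.file 3 i = F i)
    (h4 : ∀ v < n, ∃ cnt last, a.file 4 v = cnt * (n + 1) + last ∧
      Counted n A F v (k * D) cnt last) :
    (countBlock.exec p a).ok ∧
    (∀ v < n, ∃ cnt last, (countBlock.exec p a).file 4 v = cnt * (n + 1) + last ∧
      Counted n A F v (k * D + D) cnt last) ∧
    (countBlock.exec p a).io 3 ≤ a.io 3 + 2 * (2 + 2 * (2 * s / p.B)) ∧
    (countBlock.exec p a).io 4 ≤ a.io 4 + (2 + 2 * (2 * s / p.B)) := by
  have hZ := d.two_s_lt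
  have hZW := d.Z_le_W
  have hkD : k * D + D ≤ R * D := by
    have : (k + 1) * D ≤ R * D := Nat.mul_le_mul_right _ hkR
    rwa [add_mul, one_mul] at this
  simp only [countBlock, Cmd.exec]
  obtain ⟨ok1, A1, S1⟩ := loadBlock_spec d r ok (f := 3) (b := 0) hk hkR fun i hi => by
    rw [h3 i (by omega)]; exact hFW i (by omega)
  have r1 := r.exec (p := p) (loadBlock 3 0) (by decide)
  have f1 := fun f => (loadBlock 3 0).exec_frame_file p f a rfl
  have i1 := ((loadBlock 3 0).exec_frame_io p 4 a rfl).1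
  generalize (loadBlock 3 0).exec p a = b at *
  have ok2 : (b.setv p rgZ 0).ok := ⟨ok1, by omega⟩
  have r2 := r1.setv (p := p) (x := rgZ) (k := 0) (by decide)
  obtain ⟨ok3, A3⟩ := fillBlock_spec d r2 ok2 (b := 1) (y := rgZ) (k := 0) (by decide) (by simp)
    (by omega)
  have r3 := r2.exec (p := p) (fillBlock 1 rgZ) (by decide)
  have f3 := fun f => (fillBlock 1 rgZ).exec_frame_file p f (b.setv p rgZ 0) rfl
  have a3 := (fillBlock 1 rgZ).exec_frame_arr p 0 (b.setv p rgZ 0) rfl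
  have i3 := fun f => (fillBlock 1 rgZ).exec_frame_io p f (b.setv p rgZ 0) rfl
  rw [AExpr.eval_ofNat]
  generalize (fillBlock 1 rgZ).exec p (b.setv p rgZ (OfNat.ofNat 0)) = c at *
  simp only [setv_file, setv_arr, setv_io] at f3 a3 i3
  obtain ⟨ok4, A4, S3, S4⟩ := countStream_spec d r3 ok3 hF hkR hFW (by
    intro i hi; rw [f3, f1, h3 i hi]) (by
    intro j hj; rw [a3, A1 j hj, h3 _ (by omega)]) A3 (by simpa only [f3, f1] using h4)
  refine ⟨ok4, A4, ?_, ?_⟩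
  · have := S1.io_le
    have := S3.io_le
    rw [(i3 3).1] at this
    omega
  · have := S4.io_le
    rw [(i3 4).1, i1] at this
    omega

theorem countCmd_spec (d : Dims p n m s D R) (r : Regs n m s D R a) (ok : a.ok)
    {A : ℕ → ℕ → Prop} {F : ℕ → ℕ} (hF : SortedKeys n s (R * D) A F)
    (hFW : ∀ i < R * D, F i < p.W) (h3 : ∀ i < R * D, a.file 3 i = F i)
    (h4 : ∀ v < n, a.file 4 v = 0) :
    (countCmd.exec p a).ok ∧
    (∀ v < n, ∃ cnt last, (countCmd.exec p a).file 4 v = cnt * (n + 1) + last ∧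
      Counted n A F v (R * D) cnt last) ∧
    (countCmd.exec p a).io 3 ≤ a.io 3 + R * (2 * (2 + 2 * (2 * s / p.B))) ∧
    (countCmd.exec p a).io 4 ≤ a.io 4 + R * (2 + 2 * (2 * s / p.B)) := by
  have hZ := d.two_s_lt
  have hZW := d.Z_le_W
  have hR := d.R_le
  obtain ⟨t, ⟨A1, A2, A3⟩, h5, e⟩ := exec_for_frame p (x := rgK) (y := rgR)
    (c := countBlock) (a := a)
    (fun k t => (∀ v < n, ∃ cnt last, t.file 4 v = cnt * (n + 1) + last ∧
        Counted n A F v (k * D) cnt last) ∧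
      t.io 3 ≤ a.io 3 + k * (2 * (2 + 2 * (2 * s / p.B))) ∧
      t.io 4 ≤ a.io 4 + k * (2 + 2 * (2 * s / p.B)))
    r.R (by omega) ⟨fun v hv => ⟨0, 0, by rw [h4 v hv, zero_mul], by
      rw [zero_mul]; exact Counted.zero n A F v⟩, by simp, by simp⟩ ok (by
      rintro k t hk hkW Fr hok ⟨A1, A2, A3⟩
      have e1 := Fr.file 3 rfl
      have rt := (r.frame Fr (by decide) (by decide)).setv (p := p) (x := rgK) (k := k) (by decide)
      obtain ⟨B0, B1, B2, B3⟩ := countBlock_spec d rt ⟨hok, hkW⟩ hF (k := k) (by simp) hk hFW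
        (by rw [setv_file, e1]; exact h3) A1
      simp only [setv_io] at B2 B3
      refine ⟨⟨?_, ?_, ?_⟩, B0⟩
      · rw [add_mul, one_mul]; exact B1
      · rw [add_mul]; omega
      · rw [add_mul]; omega)
  rw [countCmd, e]
  exact ⟨e ▸ h5, A1, A2, A3⟩

end count

/-! ### The edges of the gadget graph -/

theorem nodup_flatMap_of_key {α β γ : Type*} {l : List α} {f : α → List β} {g : α → γ}
    (key : β → γ) (hl : (l.map g).Nodup) (hf : ∀ x ∈ l, (f x).Nodup)
    (hk : ∀ x ∈ l, ∀ y ∈ f x, key y = g x) : (l.flatMap f).Nodup := by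
  refine List.nodup_flatMap.2 ⟨hf, ?_⟩
  rw [List.Nodup, List.pairwise_map] at hl
  refine hl.imp_of_mem fun hx hy hne z hz hz' => hne ?_
  rw [← hk _ hx z hz, ← hk _ hy z hz']

theorem nodup_append_of_key {β : Type*} {l l' : List β} (key : β → ℕ) (k : ℕ) (hl : l.Nodup)
    (hl' : l'.Nodup) (hk : ∀ x ∈ l, key x < k) (hk' : ∀ x ∈ l', k ≤ key x) : (l ++ l').Nodup :=
  List.nodup_append.2 ⟨hl, hl', fun x hx y hy e =>
    absurd (hk x hx) (not_lt.2 (e ▸ hk' y hy))⟩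

theorem IsEdgeList.ncard {n : ℕ} {G : SimpleGraph (Fin n)} {L : List (Fin n × Fin n)}
    (h : IsEdgeList G L) : G.edgeSet.ncard = L.length := by
  have : G.edgeSet = ((L.map fun e => s(e.1, e.2)).toFinset : Set (Sym2 (Fin n))) := by
    ext x
    rw [← h.2 x]; simp
  rw [this, Set.ncard_coe_finset, List.toFinset_card_of_nodup h.1, List.length_map]

theorem IsEdgeList.adj {n : ℕ} {G : SimpleGraph (Fin n)} {L : List (Fin n × Fin n)}
    (h : IsEdgeList G L) {v w : Fin n} : G.Adj v w ↔ (v, w) ∈ L ∨ (w, v) ∈ L := by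
  rw [← SimpleGraph.mem_edgeSet, ← h.2, List.mem_map]
  constructor
  · rintro ⟨⟨x, y⟩, hL, he⟩
    rcases Sym2.eq_iff.1 he with ⟨rfl, rfl⟩ | ⟨rfl, rfl⟩
    · exact Or.inl hL
    · exact Or.inr hL
  · rintro (hL | hL)
    · exact ⟨_, hL, rfl⟩
    · exact ⟨_, hL, Sym2.eq_swap⟩

section edges
variable {n Q N : ℕ}

/-- The index in `0, …, Q * Q - 1` of row `i` and column `j`. -/
def cell (i j : Fin Q) : Fin (Q * Q) :=
  ⟨i * Q + j, by
    have : (i + 1) * Q ≤ Q * Q := Nat.mul_le_mul_right _ i.2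
    have := j.2
    rw [add_mul] at *; omega⟩

/-- The index in `0, …, Q * Q - 1` of the start of row `i`. -/
def row (i : Fin Q) : Fin (Q * Q) := ⟨i * Q, by
  have := (cell i ⟨0, by have := i.2; omega⟩).2
  simpa [cell] using this⟩

theorem cell_div (i j : Fin Q) : (cell i j : ℕ) / Q = i := by
  change (i * Q + j : ℕ) / Q = i
  rw [mul_comm, Nat.mul_add_div (by have := i.2; omega), Nat.div_eq_of_lt j.2, add_zero]

theorem cell_mod (i j : Fin Q) : (cell i j : ℕ) % Q = j := by
  change (i * Q + j : ℕ) % Q = j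
  rw [mul_comm, Nat.mul_add_mod, Nat.mod_eq_of_lt j.2]

theorem row_div (i : Fin Q) : (row i : ℕ) / Q = i := by
  rw [row, Nat.mul_div_cancel _ (by have := i.2; omega)]

theorem row_mod (i : Fin Q) : (row i : ℕ) % Q = 0 := by
  rw [row, Nat.mul_mod_left]

theorem eq_cell (r : Fin (Q * Q)) : ∃ i j, r = cell i j := by
  have hQ : 0 < Q := by
    rcases Nat.eq_zero_or_pos Q with rfl | h
    · exact absurd r.2 (by simp)
    · exact h
  refine ⟨⟨r / Q, Nat.div_lt_of_lt_mul r.2⟩, ⟨r % Q, Nat.mod_lt _ hQ⟩, Fin.ext ?_⟩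
  exact (Nat.div_add_mod' _ _).symm

theorem eq_row (r : Fin (Q * Q)) (hr : (r : ℕ) % Q = 0) : ∃ i, r = row i := by
  obtain ⟨i, j, rfl⟩ := eq_cell r
  rw [cell_mod] at hr
  exact ⟨i, Fin.ext (by simp [cell, row, hr])⟩

/-- The edges that come from an edge of the graph. -/
def edgeBlock (e : Fin n × Fin n) : List (Vtx n Q N × Vtx n Q N) :=
  [(.a e.1, .b e.2), (.a e.2, .b e.1), (.b e.1, .c e.2), (.b e.2, .c e.1), (.c e.1, .d e.2),
    (.c e.2, .d e.1)]

/-- The edges that come from a vertex of the graph. -/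
def vertexBlock (lo hi : Fin n → Fin Q) (v : Fin n) : List (Vtx n Q N × Vtx n Q N) :=
  [(.a v, .b v), (.b v, .c v), (.c v, .d v), (.a v, .hub 0), (.a v, .hub 1), (.a v, .hub 2),
    (.a v, .l (lo v)), (.a v, .h (hi v)), (.star, .b v)]

/-- The edges that come from a pair of digits. -/
def cellBlock (i j : Fin Q) : List (Vtx n Q N × Vtx n Q N) :=
  (if (j : ℕ) < i + 1 then [(.l i, .x j), (.h i, .y (row j))] else []) ++
    if (j : ℕ) ≠ 0 then [(.y (row i), .y (cell i j))] else []

/-- The edges that come from a digit. -/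
def digitBlock (i : Fin Q) : List (Vtx n Q N × Vtx n Q N) :=
  [(.star, .l i), (.star, .h i)] ++ (List.finRange Q).flatMap (cellBlock i)

/-- The edges to the pendant vertices numbered `i`. -/
def pendBlock (i : Fin N) : List (Vtx n Q N × Vtx n Q N) :=
  [(.hub 0, .pend i 0), (.hub 1, .pend i 1), (.hub 2, .pend i 2)]

/-- The edges of the gadget graph, in the order in which they are written. -/
def gadgetList (L : List (Fin n × Fin n)) (lo hi : Fin n → Fin Q) :
    List (Vtx n Q N × Vtx n Q N) :=
  L.flatMap edgeBlock ++ ((List.finRange n).flatMap (vertexBlock lo hi) ++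
    ([(.star, .hub 0)] ++ ((List.finRange Q).flatMap digitBlock ++
      (List.finRange N).flatMap pendBlock)))

variable {G : SimpleGraph (Fin n)} {L : List (Fin n × Fin n)} (lo hi : Fin n → Fin Q)

theorem mem_gadgetList (hL : IsEdgeList G L) (z w : Vtx n Q N) :
    (z, w) ∈ gadgetList L lo hi ↔ GadgetEdge G lo hi z w := by
  have hn : ∀ e ∈ L, Near G e.1 e.2 := fun e he => Or.inr (hL.adj.2 (Or.inl he))
  constructor
  · intro h
    simp only [gadgetList, edgeBlock, vertexBlock, digitBlock, cellBlock, pendBlock, List.mem_append,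
      List.mem_flatMap, List.mem_finRange, true_and, List.mem_cons, List.not_mem_nil, or_false,
      Prod.mk.injEq, List.mem_ite_nil_right] at h
    rcases h with ⟨e, he, h⟩ | ⟨v, h⟩ | h | ⟨i, h⟩ | ⟨i, h⟩
    · have h1 := hn e he
      have h2 := h1.symm
      rcases h with ⟨rfl, rfl⟩ | ⟨rfl, rfl⟩ | ⟨rfl, rfl⟩ | ⟨rfl, rfl⟩ | ⟨rfl, rfl⟩ | ⟨rfl, rfl⟩ <;>
        first
        | exact .ab ‹_›
        | exact .bc ‹_›
        | exact .cd ‹_›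
    · have h1 := near_refl (G := G) v
      rcases h with ⟨rfl, rfl⟩ | ⟨rfl, rfl⟩ | ⟨rfl, rfl⟩ | ⟨rfl, rfl⟩ | ⟨rfl, rfl⟩ | ⟨rfl, rfl⟩ |
        ⟨rfl, rfl⟩ | ⟨rfl, rfl⟩ | ⟨rfl, rfl⟩ <;>
        first
        | exact .ab h1
        | exact .bc h1
        | exact .cd h1
        | exact .aHub _ _
        | exact .al _
        | exact .ah _
        | exact .starB _
    · obtain ⟨rfl, rfl⟩ := h
      exact .starHub
    · rcases h with (⟨rfl, rfl⟩ | ⟨rfl, rfl⟩) | ⟨j, ⟨hj, ⟨rfl, rfl⟩ | ⟨rfl, rfl⟩⟩ | ⟨hj, rfl, rfl⟩⟩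
      · exact .starL _
      · exact .starH _
      · exact .lx (Fin.le_def.2 (by omega))
      · exact .hy (row_mod _) (by rw [row_div]; omega)
      · exact .yy (row_mod _) (by rwa [cell_mod]) (by rw [row_div, cell_div])
    · rcases h with ⟨rfl, rfl⟩ | ⟨rfl, rfl⟩ | ⟨rfl, rfl⟩ <;> exact .hubPend _ _
  · intro h
    simp only [gadgetList, edgeBlock, vertexBlock, digitBlock, cellBlock, pendBlock, List.mem_append,
      List.mem_flatMap, List.mem_finRange, true_and, List.mem_cons, List.not_mem_nil, or_false,
      Prod.mk.injEq, List.mem_ite_nil_right]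
    cases h with
    | @ab v w h =>
      rcases h with rfl | h
      · exact Or.inr (Or.inl ⟨v, by simp⟩)
      · rcases hL.adj.1 h with h | h
        · exact Or.inl ⟨_, h, by simp⟩
        · exact Or.inl ⟨_, h, by simp⟩
    | @bc v w h =>
      rcases h with rfl | h
      · exact Or.inr (Or.inl ⟨v, by simp⟩)
      · rcases hL.adj.1 h with h | h
        · exact Or.inl ⟨_, h, by simp⟩
        · exact Or.inl ⟨_, h, by simp⟩
    | @cd v w h =>
      rcases h with rfl | h
      · exact Or.inr (Or.inl ⟨v, by simp⟩)
      · rcases hL.adj.1 h with h | h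
        · exact Or.inl ⟨_, h, by simp⟩
        · exact Or.inl ⟨_, h, by simp⟩
    | aHub v i =>
      refine Or.inr (Or.inl ⟨v, ?_⟩)
      fin_cases i <;> simp
    | al v => exact Or.inr (Or.inl ⟨v, by simp⟩)
    | ah v => exact Or.inr (Or.inl ⟨v, by simp⟩)
    | starB v => exact Or.inr (Or.inl ⟨v, by simp⟩)
    | starHub => exact Or.inr (Or.inr (Or.inl (by simp)))
    | starL i => exact Or.inr (Or.inr (Or.inr (Or.inl ⟨i, by simp⟩)))
    | starH i => exact Or.inr (Or.inr (Or.inr (Or.inl ⟨i, by simp⟩)))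
    | @lx i j h =>
      refine Or.inr (Or.inr (Or.inr (Or.inl ⟨i, Or.inr ⟨j, Or.inl ⟨?_, by simp⟩⟩⟩)))
      have := Fin.le_def.1 h
      omega
    | @hy i r h0 h =>
      obtain ⟨j, rfl⟩ := eq_row r h0
      rw [row_div] at h
      exact Or.inr (Or.inr (Or.inr (Or.inl ⟨i, Or.inr ⟨j, Or.inl ⟨by omega, by simp⟩⟩⟩)))
    | @yy r t hr ht h =>
      obtain ⟨i, rfl⟩ := eq_row r hr
      obtain ⟨i', j, rfl⟩ := eq_cell t
      rw [row_div, cell_div] at h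
      rw [cell_mod] at ht
      obtain rfl := Fin.ext h
      exact Or.inr (Or.inr (Or.inr (Or.inl ⟨i, Or.inr ⟨j, Or.inr ⟨ht, by simp⟩⟩⟩)))
    | hubPend i j =>
      refine Or.inr (Or.inr (Or.inr (Or.inr ⟨i, ?_⟩)))
      fin_cases j <;> simp

theorem GadgetEdge.not_swap {z w : Vtx n Q N} (h : GadgetEdge G lo hi z w) :
    ¬ GadgetEdge G lo hi w z := by
  intro h'
  cases h <;> cases h'
  contradiction

/-- The vertex of the graph of which a vertex of the gadget graph is a copy. -/
def Vtx.vert : Vtx n Q N → Option (Fin n)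
  | .a v => some v
  | .b v => some v
  | .c v => some v
  | .d v => some v
  | _ => none

/-- The digit that distinguishes the cells of one row. -/
def Vtx.digit : Vtx n Q N → ℕ
  | .x j => j
  | .y r => if (r : ℕ) % Q = 0 then r / Q else r % Q
  | _ => 0

/-- The part of the list of edges to which an edge belongs. -/
def Vtx.part : Vtx n Q N × Vtx n Q N → ℕ
  | (.a v, .b w) => if v = w then 1 else 0
  | (.b v, .c w) => if v = w then 1 else 0
  | (.c v, .d w) => if v = w then 1 else 0
  | (.star, .hub _) => 2
  | (.star, .l _) => 3
  | (.star, .h _) => 3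
  | (.l _, _) => 3
  | (.h _, _) => 3
  | (.y _, _) => 3
  | (.hub _, .pend _ _) => 4
  | _ => 1

theorem digitBlock_nodup (i : Fin Q) : (digitBlock i : List (Vtx n Q N × Vtx n Q N)).Nodup := by
  refine nodup_append_of_key (fun z => match z.1 with | .star => 0 | _ => 1) 1 (by simp) ?_
    (by simp) ?_
  · refine nodup_flatMap_of_key (g := fun j : Fin Q => (j : ℕ)) (fun z => z.2.digit) ?_ ?_ ?_
    · exact (List.nodup_finRange Q).map Fin.val_injective
    · intro j _
      rw [cellBlock]
      split_ifs <;> simp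
    · intro j _ z hz
      simp only [cellBlock, List.mem_append, List.mem_ite_nil_right, List.mem_cons,
        List.not_mem_nil, or_false] at hz
      rcases hz with ⟨-, rfl | rfl⟩ | ⟨hj, rfl⟩
      · rfl
      · simp [Vtx.digit, row_mod, row_div]
      · simp only [Vtx.digit, cell_mod]; rw [if_neg hj]
  · intro z hz
    simp only [List.mem_flatMap, cellBlock, List.mem_append, List.mem_ite_nil_right, List.mem_cons,
        List.not_mem_nil, or_false] at hz
    rcases hz with ⟨j, -, ⟨-, rfl | rfl⟩ | ⟨hj, rfl⟩⟩ <;> rfl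

theorem gadgetList_nodup (hL : IsEdgeList G L) :
    (gadgetList L lo hi : List (Vtx n Q N × Vtx n Q N)).Nodup := by
  have hne : ∀ e ∈ L, e.1 ≠ e.2 := fun e he => (hL.adj.2 (Or.inl he)).ne
  refine nodup_append_of_key Vtx.part 1 ?_ (nodup_append_of_key Vtx.part 2 ?_
    (nodup_append_of_key Vtx.part 3 (by simp) (nodup_append_of_key Vtx.part 4 ?_ ?_ ?_ ?_) ?_ ?_)
    ?_ ?_) ?_ ?_
  · refine nodup_flatMap_of_key (g := fun e => Sym2.map some s(e.1, e.2))
      (fun z => s(z.1.vert, z.2.vert)) ?_ ?_ ?_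
    · have := hL.1.map (Sym2.map.injective (Option.some_injective (Fin n)))
      rwa [List.map_map] at this
    · intro e he
      have := hne e he
      simp [edgeBlock, this, this.symm]
    · intro e _ z hz
      simp only [edgeBlock, List.mem_cons, List.not_mem_nil, or_false] at hz
      rcases hz with rfl | rfl | rfl | rfl | rfl | rfl <;> simp [Vtx.vert, Sym2.eq_swap]
  · refine nodup_flatMap_of_key (g := some) (fun z => match z.1 with | .star => z.2.vert | _ => z.1.vert)
      ?_ ?_ ?_
    · exact (List.nodup_finRange n).map (Option.some_injective _)
    · intro v _
      simp [vertexBlock]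
    · intro v _ z hz
      simp only [vertexBlock, List.mem_cons, List.not_mem_nil, or_false] at hz
      rcases hz with rfl | rfl | rfl | rfl | rfl | rfl | rfl | rfl | rfl <;> rfl
  · refine nodup_flatMap_of_key (g := fun i : Fin Q => (i : ℕ)) (fun z => match z with
      | (.star, .l i) => i
      | (.star, .h i) => i
      | (.l i, _) => i
      | (.h i, _) => i
      | (.y r, _) => r / Q
      | _ => 0) ?_ ?_ ?_
    · exact (List.nodup_finRange Q).map Fin.val_injective
    · exact fun i _ => digitBlock_nodup i
    · intro i _ z hz
      simp only [digitBlock, List.mem_flatMap, cellBlock, List.mem_append, List.mem_ite_nil_right,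
        List.mem_cons, List.not_mem_nil, or_false] at hz
      rcases hz with (rfl | rfl) | ⟨j, -, ⟨-, rfl | rfl⟩ | ⟨hj, rfl⟩⟩
      all_goals first | rfl | exact row_div i
  · refine nodup_flatMap_of_key (g := some) (fun z => match z.2 with
      | .pend i _ => some i
      | _ => none) ?_ ?_ ?_
    · exact (List.nodup_finRange N).map (Option.some_injective _)
    · intro i _
      simp [pendBlock]
    · intro i _ z hz
      simp only [pendBlock, List.mem_cons, List.not_mem_nil, or_false] at hz
      rcases hz with rfl | rfl | rfl <;> rfl
  all_goals
    intro z hz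
    simp only [edgeBlock, vertexBlock, digitBlock, cellBlock, pendBlock, List.mem_append,
      List.mem_flatMap, List.mem_finRange, true_and, List.mem_cons, List.not_mem_nil, or_false,
      List.mem_ite_nil_right] at hz
  · rcases hz with ⟨i, (rfl | rfl) | ⟨j, ⟨-, rfl | rfl⟩ | ⟨hj, rfl⟩⟩⟩ <;> simp [Vtx.part]
  · rcases hz with ⟨i, rfl | rfl | rfl⟩ <;> simp [Vtx.part]
  · subst hz; simp [Vtx.part]
  · rcases hz with ⟨i, (rfl | rfl) | ⟨j, ⟨-, rfl | rfl⟩ | ⟨hj, rfl⟩⟩⟩ | ⟨i, rfl | rfl | rfl⟩ <;>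
      simp [Vtx.part]
  · rcases hz with ⟨v, rfl | rfl | rfl | rfl | rfl | rfl | rfl | rfl | rfl⟩ <;> simp [Vtx.part]
  · rcases hz with rfl | ⟨i, (rfl | rfl) | ⟨j, ⟨-, rfl | rfl⟩ | ⟨hj, rfl⟩⟩⟩ |
      ⟨i, rfl | rfl | rfl⟩ <;> simp [Vtx.part]
  · rcases hz with ⟨e, he, hz⟩
    have h1 := hne e he
    have h2 := h1.symm
    rcases hz with rfl | rfl | rfl | rfl | rfl | rfl <;> simp [Vtx.part, h1, h2]
  · rcases hz with ⟨v, rfl | rfl | rfl | rfl | rfl | rfl | rfl | rfl | rfl⟩ | rfl |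
      ⟨i, (rfl | rfl) | ⟨j, ⟨-, rfl | rfl⟩ | ⟨hj, rfl⟩⟩⟩ | ⟨i, rfl | rfl | rfl⟩ <;> simp [Vtx.part]

theorem length_gadgetList_le (L : List (Fin n × Fin n)) :
    L.length ≤ (gadgetList L lo hi : List (Vtx n Q N × Vtx n Q N)).length ∧
    (gadgetList L lo hi : List (Vtx n Q N × Vtx n Q N)).length ≤
      6 * L.length + 9 * n + 1 + Q * (2 + 3 * Q) + 3 * N := by
  have h : ∀ {α β : Type} (l : List α) (f : α → List β) (k : ℕ), (∀ x ∈ l, (f x).length ≤ k) →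
      (l.flatMap f).length ≤ l.length * k := by
    intro α β l f k hk
    induction l with
    | nil => simp
    | cons x l ih =>
      have h1 := hk x (by simp)
      have h2 := ih fun y hy => hk y (by simp [hy])
      rw [List.flatMap_cons, List.length_append, List.length_cons, add_mul]
      omega
  have h1 : (L.flatMap (edgeBlock (Q := Q) (N := N))).length = 6 * L.length := by
    induction L with
    | nil => rfl
    | cons x L ih => simp only [List.flatMap_cons, List.length_append, ih, edgeBlock,
        List.length_cons, List.length_nil]; omega
  have h2 := h (List.finRange n) (vertexBlock (N := N) lo hi) 9 (by simp [vertexBlock])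
  have h4 := h (List.finRange N) (pendBlock (n := n) (Q := Q)) 3 (by simp [pendBlock])
  have h3 := h (List.finRange Q) (digitBlock (n := n) (N := N)) (2 + 3 * Q) (by
    intro i _
    have := h (List.finRange Q) (cellBlock (n := n) (N := N) i) 3 (by
      intro j _
      rw [cellBlock]
      split_ifs <;> simp)
    rw [List.length_finRange] at this
    simp only [digitBlock, List.length_append, List.length_cons, List.length_nil]
    omega)
  rw [List.length_finRange] at h2 h3 h4
  simp only [gadgetList, List.length_append, List.length_cons, List.length_nil, h1]
  omega

/-- The number of a vertex of the gadget graph. -/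
def Vtx.code : Vtx n Q N → ℕ
  | .a v => v
  | .b v => n + v
  | .c v => 2 * n + v
  | .d v => 3 * n + v
  | .l i => 4 * n + i
  | .x i => 4 * n + Q + i
  | .h i => 4 * n + 2 * Q + i
  | .y i => 4 * n + 3 * Q + i
  | .hub i => 4 * n + 3 * Q + Q * Q + i
  | .star => 4 * n + 3 * Q + Q * Q + 3
  | .pend i j => 4 * n + 3 * Q + Q * Q + 4 + 3 * i + j

theorem Vtx.code_lt (z : Vtx n Q N) : z.code < coreSize n Q + 3 * N := by
  cases z <;> simp only [Vtx.code, coreSize] <;> omega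

theorem Vtx.code_injective : Function.Injective (Vtx.code : Vtx n Q N → ℕ) := by
  intro z w h
  cases z <;> cases w <;> simp only [Vtx.code] at h <;>
    first
    | (exfalso; omega)
    | (congr 1 <;> exact Fin.ext (by omega))

/-- The numbering of the vertices of the gadget graph. -/
noncomputable def Vtx.equivFin : Vtx n Q N ≃ Fin (coreSize n Q + 3 * N) :=
  Equiv.ofBijective (fun z => ⟨z.code, z.code_lt⟩) <|
    (Fintype.bijective_iff_injective_and_card _).2
      ⟨fun _ _ h => Vtx.code_injective (Fin.mk.inj_iff.1 h), by rw [Vtx.card, Fintype.card_fin]⟩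

/-- The gadget graph on the vertices `0, …, coreSize n Q + 3 * N - 1`. -/
noncomputable def gadgetFin (G : SimpleGraph (Fin n)) (lo hi : Fin n → Fin Q) (N : ℕ) :
    SimpleGraph (Fin (coreSize n Q + 3 * N)) :=
  (gadget G lo hi : SimpleGraph (Vtx n Q N)).comap Vtx.equivFin.symm

/-- The list of the edges of the gadget graph on numbers. -/
noncomputable def gadgetFinList (L : List (Fin n × Fin n)) (lo hi : Fin n → Fin Q) (N : ℕ) :
    List (Fin (coreSize n Q + 3 * N) × Fin (coreSize n Q + 3 * N)) :=
  (gadgetList L lo hi : List (Vtx n Q N × Vtx n Q N)).map (Prod.map Vtx.equivFin Vtx.equivFin)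

theorem gadgetFin_isEdgeList (hL : IsEdgeList G L) :
    IsEdgeList (gadgetFin G lo hi N) (gadgetFinList L lo hi N) := by
  have hmap : (gadgetFinList L lo hi N).map (fun e => s(e.1, e.2)) =
      ((gadgetList L lo hi : List (Vtx n Q N × Vtx n Q N)).map fun e => s(e.1, e.2)).map
        (Sym2.map Vtx.equivFin) := by
    rw [gadgetFinList, List.map_map, List.map_map]; rfl
  constructor
  · rw [hmap]
    refine List.Nodup.map (Sym2.map.injective Vtx.equivFin.injective) ?_
    refine List.Nodup.map_on ?_ (gadgetList_nodup lo hi hL)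
    rintro ⟨z, w⟩ h ⟨z', w'⟩ h' e
    rcases Sym2.eq_iff.1 e with ⟨h1, h2⟩ | ⟨h1, h2⟩
    · exact Prod.ext h1 h2
    · simp only at h1 h2
      subst h1 h2
      exact absurd ((mem_gadgetList lo hi hL _ _).1 h')
        (((mem_gadgetList lo hi hL _ _).1 h).not_swap lo hi)
  · intro e
    rw [hmap]
    induction e using Sym2.ind with
    | _ x y =>
      rw [SimpleGraph.mem_edgeSet, gadgetFin, SimpleGraph.comap_adj, gadget,
        SimpleGraph.fromRel_adj, List.mem_map]
      constructor
      · rintro ⟨e, he, h⟩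
        obtain ⟨⟨z, w⟩, hzw, rfl⟩ := List.mem_map.1 he
        have h1 := (mem_gadgetList lo hi hL _ _).1 hzw
        rcases Sym2.eq_iff.1 h with ⟨h2, h3⟩ | ⟨h2, h3⟩
        · rw [← h2, ← h3, Equiv.symm_apply_apply, Equiv.symm_apply_apply]
          exact ⟨h1.ne, Or.inl h1⟩
        · rw [← h2, ← h3, Equiv.symm_apply_apply, Equiv.symm_apply_apply]
          exact ⟨h1.ne.symm, Or.inr h1⟩
      · rintro ⟨-, h | h⟩
        · exact ⟨_, List.mem_map.2 ⟨_, (mem_gadgetList lo hi hL _ _).2 h, rfl⟩, by simp⟩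
        · exact ⟨_, List.mem_map.2 ⟨_, (mem_gadgetList lo hi hL _ _).2 h, rfl⟩, by
            simp [Sym2.eq_swap]⟩

/-- The gadget graph on numbers is isomorphic to the gadget graph. -/
noncomputable def gadgetIso (G : SimpleGraph (Fin n)) (lo hi : Fin n → Fin Q) (N : ℕ) :
    gadgetFin G lo hi N ≃g (gadget G lo hi : SimpleGraph (Vtx n Q N)) :=
  SimpleGraph.Iso.comap Vtx.equivFin.symm _

theorem gadgetFin_connected (v : Fin n) : (gadgetFin G lo hi N).Connected :=
  (gadgetIso G lo hi N).connected_iff.2 (gadget_connected G lo hi v)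

theorem dist_hom_le {V W : Type*} {G : SimpleGraph V} {H : SimpleGraph W}
    (h : G.Connected) (f : G →g H) (x y : V) : H.dist (f x) (f y) ≤ G.dist x y := by
  obtain ⟨w, hw⟩ := h.exists_walk_length_eq_dist x y
  have := SimpleGraph.dist_le (w.map f)
  rwa [SimpleGraph.Walk.length_map, hw] at this

theorem gadgetFin_sum_dist (v : Fin n) (z : Vtx n Q N) :
    ∑ u, (gadgetFin G lo hi N).dist (Vtx.equivFin z) u = distSum (gadget G lo hi) z := by
  rw [distSum, ← Vtx.equivFin.sum_comp]
  refine Finset.sum_congr rfl fun w _ => le_antisymm ?_ ?_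
  · exact dist_hom_le (gadget_connected G lo hi v) (gadgetIso G lo hi N).symm.toHom z w
  · have := dist_hom_le (gadgetFin_connected (N := N) (G := G) lo hi v) (gadgetIso G lo hi N).toHom
      (Vtx.equivFin z) (Vtx.equivFin w)
    simpa [gadgetIso] using this

/-- The median of the gadget graph tells whether the radius is at most three. -/
theorem radius_le_three_iff_of_median
    (hdig : ∀ v, ball1 G v + ball2 G v + (lo v + hi v * Q) = 2 * n) (hN : 5 * coreSize n Q < N)
    {z : Fin (coreSize n Q + 3 * N)} (hz : ∀ w, ∑ u, (gadgetFin G lo hi N).dist z u ≤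
      ∑ u, (gadgetFin G lo hi N).dist w u) :
    G.radius ≤ 3 ↔ ∃ v : Fin n, (v : ℕ) = z ∧ ∀ u, Near3 G v u := by
  rw [radius_le_three_iff]
  constructor
  · rintro ⟨v, hv⟩
    obtain ⟨z, rfl⟩ := Vtx.equivFin.surjective z
    obtain ⟨v', rfl, h⟩ := near3_of_median G lo hi hdig hN (z := z) (fun w => by
      have := hz (Vtx.equivFin w)
      rwa [gadgetFin_sum_dist lo hi v, gadgetFin_sum_dist lo hi v] at this) hv
    exact ⟨v', rfl, h⟩
  · rintro ⟨v, -, h⟩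
    exact ⟨v, h⟩

end edges

/-! ### Writing a list of edges -/

/-- The words of a list of pairs. -/
def flat (E : List (ℕ × ℕ)) : List ℕ := E.flatMap fun e => [e.1, e.2]

theorem flat_append (E E' : List (ℕ × ℕ)) : flat (E ++ E') = flat E ++ flat E' := by
  rw [flat, List.flatMap_append]; rfl

theorem length_flat (E : List (ℕ × ℕ)) : (flat E).length = 2 * E.length := by
  induction E with
  | nil => rfl
  | cons e E ih =>
    rw [flat, List.flatMap_cons, List.length_append, ← flat, ih]
    simp; omega

theorem words_eq_flat {n : ℕ} (L : List (Fin n × Fin n)) (i : ℕ) :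
    words L i = (flat (L.map (Prod.map Fin.val Fin.val))).getD i 0 := by
  rw [words, flat, List.flatMap_map]; rfl

theorem words_get {n : ℕ} (L : List (Fin n × Fin n)) (i : Fin L.length) :
    words L (2 * i) = (L.get i).1 ∧ words L (2 * i + 1) = (L.get i).2 := by
  obtain ⟨i, hi⟩ := i
  induction L generalizing i with
  | nil => simp at hi
  | cons e L ih =>
    cases i with
    | zero => exact ⟨rfl, rfl⟩
    | succ i => exact ih i (by simpa using hi)

theorem words_lt {n : ℕ} (L : List (Fin n × Fin n)) {i : ℕ} (hi : i < 2 * L.length) :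
    words L i < n := by
  rcases Nat.even_or_odd' i with ⟨j, rfl | rfl⟩
  · rw [(words_get L ⟨j, by omega⟩).1]; exact Fin.is_lt _
  · rw [(words_get L ⟨j, by omega⟩).2]; exact Fin.is_lt _

/-- Whether register `x` does not occur in an expression. -/
def AExpr.free (x : ℕ) : AExpr → Bool
  | .const _ => true
  | .var y => x != y
  | .add e f | .sub e f | .mul e f | .div e f | .mod e f => e.free x && f.free x

theorem AExpr.eval_congr {x : ℕ} {v v' : ℕ → ℕ} (h : ∀ y, x ≠ y → v y = v' y) (e : AExpr)
    (he : e.free x = true) : e.eval v = e.eval v' := by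
  induction e with
  | const => rfl
  | var y => exact h y (by simpa [AExpr.free] using he)
  | add e f h1 h2 | sub e f h1 h2 | mul e f h1 h2 | div e f h1 h2 | mod e f h1 h2 =>
    simp only [AExpr.free, Bool.and_eq_true] at he
    simp only [AExpr.eval, h1 he.1, h2 he.2]

/-- Append a pair to the list in file `9`. -/
def emit (e f : AExpr) : Cmd :=
  .write 9 (var rgPos) e ;; .write 9 (var rgPos + 1) f ;; .set rgPos (var rgPos + 2)

/-- Append pairs to the list in file `9`. -/
def emitAll : List (AExpr × AExpr) → Cmd
  | [] => .skip
  | e :: l => emit e.1 e.2 ;; emitAll l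

/-- Starting from `a₀`, the list of pairs `E` has been written to file `9`. -/
structure Emitted (p : Par) (a₀ : AState) (E : List (ℕ × ℕ)) (a : AState) : Prop where
  ok : a.ok
  pos : a.v rgPos = 2 * E.length
  file : ∀ i, a.file 9 i = (flat E).getD i 0
  scan : Scan p 9 a₀ (2 * E.length) a

/-- In configuration `a`, the command `c` appends `E` to the list in file `9` if there is space. -/
def Emits (p : Par) (a₀ : AState) (c : Cmd) (a : AState) (E : List (ℕ × ℕ)) : Prop :=
  ∀ E₀, Emitted p a₀ E₀ a → 2 * (E₀ ++ E).length ≤ p.Z → Emitted p a₀ (E₀ ++ E) (c.exec p a)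

section emits
variable {p : Par} {a₀ a : AState} {c c' : Cmd} {E E' : List (ℕ × ℕ)} {e f : AExpr}

theorem Emits.skip : Emits p a₀ .skip a [] := fun E₀ h _ => by rwa [List.append_nil]

theorem Emits.seq (h : Emits p a₀ c a E) (h' : Emits p a₀ c' (c.exec p a) E') :
    Emits p a₀ (c ;; c') a (E ++ E') := by
  intro E₀ hE hZ
  rw [← List.append_assoc] at hZ ⊢
  exact h' _ (h _ hE (by rw [List.length_append] at hZ; omega)) hZ

theorem Emits.frame (hf : c.usesFile 9 = false) (hf' : c.writesFile 9 = false)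
    (hv : c.writesVar rgPos = false) (hok : a.ok → (c.exec p a).ok) : Emits p a₀ c a [] := by
  intro E₀ h _
  rw [List.append_nil]
  exact ⟨hok h.ok, by rw [c.exec_frame_v p _ a hv, h.pos],
    by rw [c.exec_frame_file p _ a hf']; exact h.file, h.scan.exec c hf⟩

theorem Emits.ite (P : Prop) [Decidable P] (hP : e.eval a.v = 0 ↔ ¬ P)
    (h : P → Emits p a₀ c a E) : Emits p a₀ (.ite e c .skip) a (if P then E else []) := by
  intro E₀
  by_cases hp : P
  · rw [Cmd.exec_ite_of_ne (fun h0 => hP.1 h0 hp), if_pos hp]; exact h hp E₀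
  · rw [Cmd.exec_ite_of_eq (hP.2 hp), if_neg hp]; exact Emits.skip E₀

theorem emits_emit (hZW : p.Z < p.W)
    (heW : e.eval a.v < p.W) (hfW : f.eval a.v < p.W) :
    Emits p a₀ (emit e f) a [(e.eval a.v, f.eval a.v)] := by
  intro E₀ h hZ
  simp only [List.length_append, List.length_cons, List.length_nil] at hZ
  have hl := length_flat E₀
  refine ⟨?_, ?_, ?_, ?_⟩
  · simp [emit, Cmd.exec, h.ok, h.pos, heW, hfW]; omega
  · simp [emit, Cmd.exec, h.pos]; omega
  · intro i
    simp only [emit, Cmd.exec, AExpr.eval_var, AExpr.eval_add, AExpr.eval_ofNat, setv_file,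
      setFile_file, touch_file, setFile_v, touch_v, Function.update_self, h.pos, flat_append]
    rcases lt_trichotomy i (2 * E₀.length) with hi | hi | hi
    · rw [Function.update_of_ne (by omega), Function.update_of_ne (by omega), h.file,
        List.getD_append _ _ _ _ (by omega)]
    · rw [Function.update_of_ne (by omega), hi, Function.update_self,
        List.getD_append_right _ _ _ _ (by omega), hl, Nat.sub_self]; rfl
    · rw [List.getD_append_right _ _ _ _ (by omega), hl]
      by_cases hi' : i = 2 * E₀.length + 1
      · rw [hi', Function.update_self, Nat.add_sub_cancel_left]; rfl
      · rw [Function.update_of_ne (by omega), Function.update_of_ne (by omega), h.file,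
          List.getD_eq_default _ _ (by omega), List.getD_eq_default _ _ (by simp [flat]; omega)]
  · simp only [List.length_append, List.length_cons, List.length_nil]
    have := (h.scan.touch (i := 2 * E₀.length) le_rfl).touch (i := 2 * E₀.length + 1) (by omega)
    simp only [emit, Cmd.exec, AExpr.eval_var, AExpr.eval_add, AExpr.eval_ofNat, setFile_v, touch_v,
      h.pos]
    exact (this.mono (by omega)).congr rfl rfl

theorem emits_all {n Q N : ℕ} (hZW : p.Z < p.W) (hc : coreSize n Q + 3 * N ≤ p.W)
    (l : List (AExpr × AExpr)) (l' : List (Vtx n Q N × Vtx n Q N))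
    (hl : (l.all fun e => e.1.free rgPos && e.2.free rgPos) = true)
    (he : l.map (fun e => (e.1.eval a.v, e.2.eval a.v)) = l'.map (Prod.map Vtx.code Vtx.code)) :
    Emits p a₀ (emitAll l) a (l'.map (Prod.map Vtx.code Vtx.code)) := by
  induction l generalizing l' a with
  | nil => rw [← he]; exact Emits.skip
  | cons e l ih =>
    cases l' with
    | nil => simp at he
    | cons z l' =>
      simp only [List.all_cons, Bool.and_eq_true, List.map_cons, List.cons.injEq, Prod.map,
        Prod.mk.injEq] at hl he
      have h1 := emits_emit (p := p) (a₀ := a₀) (a := a) hZW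
        (he.1.1 ▸ z.1.code_lt.trans_le hc) (he.1.2 ▸ z.2.code_lt.trans_le hc)
      rw [he.1.1, he.1.2] at h1
      refine h1.seq (ih l' hl.2 ?_)
      refine Eq.trans (List.map_congr_left fun x hx => ?_) he.2
      have hx := List.all_eq_true.1 hl.2 x hx
      rw [Bool.and_eq_true] at hx
      have : ∀ y, rgPos ≠ y → ((emit e.1 e.2).exec p a).v y = a.v y := fun y hy =>
        Cmd.exec_frame_v p y _ a (by simpa [emit, Cmd.writesVar] using hy.symm)
      rw [AExpr.eval_congr this _ hx.1, AExpr.eval_congr this _ hx.2]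

theorem emits_for {x y N : ℕ} {f : Fin N → List (ℕ × ℕ)} (hN : a.v y = N) (hNW : N < p.W)
    (hx : x ≠ rgPos) (hs : ∀ (i : Fin N) t, Frame x c a t → Emits p a₀ c (t.setv p x i) (f i)) :
    Emits p a₀ (.iter x y c) a ((List.finRange N).flatMap f) := by
  intro E₀ h hZ
  have hpre : ∀ i : ℕ, 2 * (E₀ ++ ((List.finRange N).take i).flatMap f).length ≤ p.Z := by
    intro i
    rw [← List.take_append_drop i (List.finRange N), List.flatMap_append] at hZ
    simp only [List.length_append] at hZ ⊢
    omega
  obtain ⟨t, A, hok, e⟩ := exec_for_frame p (x := x) (y := y) (c := c) (a := a)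
    (fun i t => Emitted p a₀ (E₀ ++ ((List.finRange N).take i).flatMap f) t)
    hN hNW (by simpa using h) h.ok (by
      intro i t hi hiW F hok A
      have A' : Emitted p a₀ (E₀ ++ ((List.finRange N).take i).flatMap f) (t.setv p x i) :=
        ⟨⟨hok, hiW⟩, by rw [setv_v, Function.update_of_ne hx.symm, A.pos], A.file, A.scan⟩
      have e1 : (List.finRange N).take (i + 1) = (List.finRange N).take i ++ [⟨i, hi⟩] := by
        rw [List.take_succ_eq_append_getElem (by simpa using hi)]; simp
      have hZ' := hpre (i + 1)
      rw [e1, List.flatMap_append, List.flatMap_singleton, ← List.append_assoc] at hZ' ⊢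
      have := hs ⟨i, hi⟩ t F _ A' hZ'
      exact ⟨this, this.ok⟩)
  rw [e] at hok ⊢
  rw [List.take_of_length_le (by simp)] at A
  exact ⟨hok, by rw [setv_v, Function.update_of_ne hx.symm, A.pos], A.file, A.scan⟩

end emits

theorem scan_for {p : Par} {a₀ a : AState} {c : Cmd} {x y N f : ℕ} (g : ℕ → ℕ) (hN : a.v y = N)
    (h0 : Scan p f a₀ (g 0) a) (hs : ∀ i t, Scan p f a₀ (g i) t →
      Scan p f a₀ (g (i + 1)) (c.exec p (t.setv p x i))) :
    Scan p f a₀ (g N) ((Cmd.iter x y c).exec p a) := by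
  obtain ⟨s, h, e⟩ := Cmd.exec_for p (x := x) (y := y) (c := c)
    (fun i s => Scan p f a₀ (g i) s) hN h0 fun i s _ h => hs i s h
  rw [e]; exact h

/-! ### Writing the gadget graph -/

/-- The codes of `edgeBlock` for the edge in `rgX` and `rgY`. -/
def edgePairs : List (AExpr × AExpr) :=
  [(var rgX, var rgN + var rgY), (var rgY, var rgN + var rgX),
    (var rgN + var rgX, 2 * var rgN + var rgY), (var rgN + var rgY, 2 * var rgN + var rgX),
    (2 * var rgN + var rgX, 3 * var rgN + var rgY), (2 * var rgN + var rgY, 3 * var rgN + var rgX)]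

/-- The codes of `vertexBlock` for the vertex in `rgI`, with the digits of the number in `rgX`. -/
def vertexPairs : List (AExpr × AExpr) :=
  [(var rgI, var rgN + var rgI), (var rgN + var rgI, 2 * var rgN + var rgI),
    (2 * var rgN + var rgI, 3 * var rgN + var rgI),
    (var rgI, 4 * var rgN + 3 * var rgQ + var rgQ * var rgQ + 0),
    (var rgI, 4 * var rgN + 3 * var rgQ + var rgQ * var rgQ + 1),
    (var rgI, 4 * var rgN + 3 * var rgQ + var rgQ * var rgQ + 2),
    (var rgI, 4 * var rgN + var rgX % var rgQ),
    (var rgI, 4 * var rgN + 2 * var rgQ + var rgX / var rgQ),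
    (4 * var rgN + 3 * var rgQ + var rgQ * var rgQ + 3, var rgN + var rgI)]

/-- The code of the edge between the vertex `star` and a hub. -/
def starPairs : List (AExpr × AExpr) :=
  [(4 * var rgN + 3 * var rgQ + var rgQ * var rgQ + 3,
    4 * var rgN + 3 * var rgQ + var rgQ * var rgQ + 0)]

/-- The codes of the edges between the vertex `star` and the vertices for the digit in `rgI`. -/
def digitPairs : List (AExpr × AExpr) :=
  [(4 * var rgN + 3 * var rgQ + var rgQ * var rgQ + 3, 4 * var rgN + var rgI),
    (4 * var rgN + 3 * var rgQ + var rgQ * var rgQ + 3, 4 * var rgN + 2 * var rgQ + var rgI)]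

/-- The codes of the first part of `cellBlock`. -/
def lowerPairs : List (AExpr × AExpr) :=
  [(4 * var rgN + var rgI, 4 * var rgN + var rgQ + var rgJ),
    (4 * var rgN + 2 * var rgQ + var rgI, 4 * var rgN + 3 * var rgQ + var rgJ * var rgQ)]

/-- The codes of the second part of `cellBlock`. -/
def rowPairs : List (AExpr × AExpr) :=
  [(4 * var rgN + 3 * var rgQ + var rgI * var rgQ,
    4 * var rgN + 3 * var rgQ + (var rgI * var rgQ + var rgJ))]

/-- The codes of `pendBlock`. -/
def pendPairs : List (AExpr × AExpr) :=
  [(4 * var rgN + 3 * var rgQ + var rgQ * var rgQ + 0,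
      4 * var rgN + 3 * var rgQ + var rgQ * var rgQ + 4 + 3 * var rgI + 0),
    (4 * var rgN + 3 * var rgQ + var rgQ * var rgQ + 1,
      4 * var rgN + 3 * var rgQ + var rgQ * var rgQ + 4 + 3 * var rgI + 1),
    (4 * var rgN + 3 * var rgQ + var rgQ * var rgQ + 2,
      4 * var rgN + 3 * var rgQ + var rgQ * var rgQ + 4 + 3 * var rgI + 2)]

/-- Write the edges that come from the edges of the graph. -/
def emitEdges : Cmd :=
  .iter rgI rgE (.read rgX 0 (2 * var rgI) ;; .read rgY 0 (2 * var rgI + 1) ;; emitAll edgePairs)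

/-- Write the edges that come from the vertices of the graph. -/
def emitVertices : Cmd :=
  .iter rgI rgN (.read rgX 4 (var rgI) ;; .set rgX (2 * var rgN - var rgX / var rgC) ;;
    emitAll vertexPairs)

/-- Write the edges that come from the digits. -/
def emitDigits : Cmd :=
  .iter rgI rgQ (emitAll digitPairs ;;
    .iter rgJ rgQ (.ite (.lt (var rgJ) (var rgI + 1)) (emitAll lowerPairs) .skip ;;
      .ite (var rgJ) (emitAll rowPairs) .skip))

/-- Write the edges to the pendant vertices. -/
def emitPendants : Cmd := .iter rgI rgP (emitAll pendPairs)

/-- Write the list of edges of the gadget graph to file `9`. -/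
def emitGadget : Cmd :=
  emitEdges ;; emitVertices ;; emitAll starPairs ;; emitDigits ;; emitPendants

section emitGadget
variable {p : Par} {n m s D R Q N : ℕ} {a a₀ : AState}

theorem Dims.Z_lt_W (d : Dims p n m s D R) : p.Z < p.W := by
  have := d.hW
  have := d.two_s_lt
  have : p.Z * 2 ≤ p.Z * p.Z := Nat.mul_le_mul_left _ (by omega)
  omega

theorem emitEdges_emits (d : Dims p n m s D R) (r : Regs n m s D R a)
    (hc : coreSize n Q + 3 * N ≤ p.W) (L : List (Fin n × Fin n)) (hm : L.length = m)
    (h0 : ∀ i, a.file 0 i = words L i) :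
    Emits p a₀ emitEdges a ((L.flatMap (edgeBlock (Q := Q) (N := N))).map
      (Prod.map Vtx.code Vtx.code)) := by
  subst hm
  have hZ := d.two_s_lt
  have hs := d.hs
  have hZW := d.Z_lt_W
  have key := emits_for (p := p) (a₀ := a₀) (a := a) (x := rgI) (y := rgE)
    (c := .read rgX 0 (2 * var rgI) ;; .read rgY 0 (2 * var rgI + 1) ;; emitAll edgePairs)
    (f := fun i : Fin L.length => (edgeBlock (Q := Q) (N := N) (L.get i)).map
      (Prod.map Vtx.code Vtx.code)) r.E (by omega) (by decide) (by
      intro i t F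
      have e0 := F.file 0 rfl
      have eN := (F.v 0 (by decide) rfl).trans r.N
      obtain ⟨w1, w2⟩ := words_get L i
      have b1 := (L.get i).1.2
      have b2 := (L.get i).2.2
      have bi := i.2
      have h1 : Emits p a₀ (.read rgX 0 (2 * var rgI)) (t.setv p rgI i) [] :=
        Emits.frame rfl rfl rfl (fun h => by
          rw [setv_ok] at h
          simp [Cmd.exec, h.1, e0, h0, w1]; omega)
      have h2 : Emits p a₀ (.read rgY 0 (2 * var rgI + 1)) ((Cmd.read rgX 0 (2 * var rgI)).exec p
          (t.setv p rgI i)) [] :=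
        Emits.frame rfl rfl rfl (fun h => by
          simp only [Cmd.exec, setv_v, setv_file, touch_v, touch_file, setv_ok, touch_ok] at h ⊢
          simp [h.1.1.1, e0, h0, w1, w2]; omega)
      refine h1.seq (h2.seq (emits_all hZW hc edgePairs (edgeBlock (L.get i)) rfl ?_))
      simp [Cmd.exec, e0, h0, w1, w2, eN, edgePairs, edgeBlock, Vtx.code])
  rw [List.map_flatMap]
  have e : L.flatMap (fun e => (edgeBlock (Q := Q) (N := N) e).map (Prod.map Vtx.code Vtx.code)) =
      (List.finRange L.length).flatMap (fun i => (edgeBlock (Q := Q) (N := N) (L.get i)).map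
        (Prod.map Vtx.code Vtx.code)) := by
    conv_lhs => rw [← List.map_get_finRange L]
    rw [List.flatMap_map]
  rw [e]
  exact key

theorem emitVertices_emits (d : Dims p n m s D R) (r : Regs n m s D R a)
    (hc : coreSize n Q + 3 * N ≤ p.W) (hQ : a.v rgQ = Q) (lo hi : Fin n → Fin Q)
    (h4 : ∀ v : Fin n, a.file 4 v < p.W ∧
      2 * n - a.file 4 v / (n + 1) = (lo v : ℕ) + (hi v : ℕ) * Q) :
    Emits p a₀ emitVertices a (((List.finRange n).flatMap (vertexBlock (N := N) lo hi)).map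
      (Prod.map Vtx.code Vtx.code)) := by
  have hZ := d.two_s_lt
  have hs := d.hs
  have hZW := d.Z_lt_W
  rw [List.map_flatMap]
  refine emits_for r.N (by omega) (by decide) ?_
  intro i t F
  have e4 := F.file 4 rfl
  have eN := (F.v 0 (by decide) rfl).trans r.N
  have eC := (F.v 6 (by decide) rfl).trans r.C
  have eQ := (F.v 7 (by decide) rfl).trans hQ
  obtain ⟨w1, w2⟩ := h4 i
  have bi := i.2
  have h1 : Emits p a₀ (.read rgX 4 (var rgI)) (t.setv p rgI i) [] :=
    Emits.frame rfl rfl rfl (fun h => by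
      rw [setv_ok] at h
      simp [Cmd.exec, h.1, e4, w1]; omega)
  have h2 : Emits p a₀ (.set rgX (2 * var rgN - var rgX / var rgC))
      ((Cmd.read rgX 4 (var rgI)).exec p (t.setv p rgI i)) [] :=
    Emits.frame rfl rfl rfl (fun h => by
      refine ⟨h, ?_⟩
      simp [Cmd.exec, eN]
      exact (Nat.sub_le _ _).trans_lt (by omega))
  refine h1.seq (h2.seq (emits_all hZW hc vertexPairs (vertexBlock lo hi i) rfl ?_))
  have hq : (lo i + hi i * Q : ℕ) / Q = hi i := by
    rw [Nat.add_mul_div_right _ _ (by have := (lo i).2; omega), Nat.div_eq_of_lt (lo i).2, zero_add]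
  have hr : (lo i + hi i * Q : ℕ) % Q = lo i := by
    rw [Nat.add_mul_mod_self_right, Nat.mod_eq_of_lt (lo i).2]
  simp [Cmd.exec, e4, w2, eN, eC, eQ, vertexPairs, vertexBlock, Vtx.code, hq, hr]

theorem emitDigits_emits (hZW : p.Z < p.W) (hN : a.v rgN = n) (hQ : a.v rgQ = Q)
    (hc : coreSize n Q + 3 * N ≤ p.W) :
    Emits p a₀ emitDigits a (((List.finRange Q).flatMap (digitBlock (n := n) (N := N))).map
      (Prod.map Vtx.code Vtx.code)) := by
  rw [List.map_flatMap]
  have hQW : Q < p.W := by rw [coreSize] at hc; omega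
  refine emits_for hQ hQW (by decide) ?_
  intro i t F
  have eN := (F.v 0 (by decide) rfl).trans hN
  have eQ := (F.v 7 (by decide) rfl).trans hQ
  rw [digitBlock, List.map_append]
  refine (emits_all hZW hc digitPairs [(.star, .l i), (.star, .h i)] rfl ?_).seq ?_
  · simp [eN, eQ, digitPairs, Vtx.code]
  have e1 := fun z (hz : (emitAll digitPairs).writesVar z = false) =>
    (emitAll digitPairs).exec_frame_v p z (t.setv p rgI i) hz
  generalize (emitAll digitPairs).exec p (t.setv p rgI i) = u at *
  have uN := (e1 0 rfl).trans eN
  have uQ := (e1 7 rfl).trans eQ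
  have uI : u.v rgI = i := (e1 13 rfl).trans (by simp)
  rw [List.map_flatMap]
  refine emits_for uQ hQW (by decide) ?_
  intro j t F
  have eN := (F.v 0 (by decide) rfl).trans uN
  have eQ := (F.v 7 (by decide) rfl).trans uQ
  have eI := (F.v 13 (by decide) rfl).trans uI
  rw [cellBlock, List.map_append, apply_ite (List.map _), apply_ite (List.map _), List.map_nil]
  refine (Emits.ite _ ?_ fun _ => emits_all hZW hc lowerPairs _ rfl ?_).seq ?_
  · rw [AExpr.eval_lt_eq_zero]; simp [eI]
  · simp [eN, eQ, eI, lowerPairs, Vtx.code, row]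
  have e1 := fun z (hz : (Cmd.ite (.lt (var rgJ) (var rgI + 1)) (emitAll lowerPairs)
      .skip).writesVar z = false) =>
    (Cmd.ite (.lt (var rgJ) (var rgI + 1)) (emitAll lowerPairs) .skip).exec_frame_v p z
      (t.setv p rgJ j) hz
  generalize (Cmd.ite (.lt (var rgJ) (var rgI + 1)) (emitAll lowerPairs) .skip).exec p
    (t.setv p rgJ j) = u at *
  have uN := (e1 0 rfl).trans eN
  have uQ := (e1 7 rfl).trans eQ
  have uI := (e1 13 rfl).trans eI
  have uJ : u.v rgJ = j := (e1 14 rfl).trans (by simp)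
  refine Emits.ite _ ?_ fun _ => emits_all hZW hc rowPairs _ rfl ?_
  · simp [uJ]
  · simp [uN, uQ, uI, uJ, rowPairs, Vtx.code, row, cell]

theorem emitPendants_emits (hZW : p.Z < p.W) (hN : a.v rgN = n) (hQ : a.v rgQ = Q)
    (hP : a.v rgP = N) (hc : coreSize n Q + 3 * N ≤ p.W) :
    Emits p a₀ emitPendants a (((List.finRange N).flatMap (pendBlock (n := n) (Q := Q))).map
      (Prod.map Vtx.code Vtx.code)) := by
  rw [List.map_flatMap]
  refine emits_for hP (by rw [coreSize] at hc; omega) (by decide) ?_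
  intro i t F
  have eN := (F.v 0 (by decide) rfl).trans hN
  have eQ := (F.v 7 (by decide) rfl).trans hQ
  refine emits_all hZW hc pendPairs (pendBlock i) rfl ?_
  simp [eN, eQ, pendPairs, pendBlock, Vtx.code]

theorem emitGadget_emits (d : Dims p n m s D R) (r : Regs n m s D R a)
    (hc : coreSize n Q + 3 * N ≤ p.W) (L : List (Fin n × Fin n)) (hm : L.length = m)
    (h0 : ∀ i, a.file 0 i = words L i) (hQ : a.v rgQ = Q) (hP : a.v rgP = N)
    (lo hi : Fin n → Fin Q) (h4 : ∀ v : Fin n, a.file 4 v < p.W ∧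
      2 * n - a.file 4 v / (n + 1) = (lo v : ℕ) + (hi v : ℕ) * Q) :
    Emits p a₀ emitGadget a ((gadgetList (N := N) L lo hi).map (Prod.map Vtx.code Vtx.code)) := by
  have hZW := d.Z_lt_W
  simp only [gadgetList, List.map_append]
  refine (emitEdges_emits d r hc L hm h0).seq ?_
  have r1 := r.exec (p := p) emitEdges (by decide)
  have f1 := emitEdges.exec_frame_file p 4 a rfl
  have q1 := (emitEdges.exec_frame_v p rgQ a rfl).trans hQ
  have p1 := (emitEdges.exec_frame_v p rgP a rfl).trans hP
  generalize emitEdges.exec p a = b at *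
  refine (emitVertices_emits d r1 hc q1 lo hi (by rwa [f1])).seq ?_
  have r2 := r1.exec (p := p) emitVertices (by decide)
  have q2 := (emitVertices.exec_frame_v p rgQ b rfl).trans q1
  have p2 := (emitVertices.exec_frame_v p rgP b rfl).trans p1
  generalize emitVertices.exec p b = c at *
  refine (emits_all hZW hc starPairs [(.star, .hub 0)] rfl ?_).seq ?_
  · simp [starPairs, r2.N, q2, Vtx.code]
  have r3 := r2.exec (p := p) (emitAll starPairs) (by decide)
  have q3 := ((emitAll starPairs).exec_frame_v p rgQ c rfl).trans q2
  have p3 := ((emitAll starPairs).exec_frame_v p rgP c rfl).trans p2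
  generalize (emitAll starPairs).exec p c = e at *
  refine (emitDigits_emits hZW r3.N q3 hc).seq ?_
  have r4 := r3.exec (p := p) emitDigits (by decide)
  have q4 := (emitDigits.exec_frame_v p rgQ e rfl).trans q3
  have p4 := (emitDigits.exec_frame_v p rgP e rfl).trans p3
  exact emitPendants_emits hZW r4.N q4 p4 hc

theorem emitGadget_io (d : Dims p n m s D R) (r : Regs n m s D R a) :
    (emitGadget.exec p a).io 0 ≤ a.io 0 + 2 + 2 * (2 * s / p.B) ∧
    (emitGadget.exec p a).io 4 ≤ a.io 4 + 2 + 2 * (2 * s / p.B) := by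
  have hs := d.hs
  have s0 : Scan p 0 a (2 * m) (emitEdges.exec p a) := by
    refine scan_for (fun i => 2 * i) r.E (Scan.refl _ _) fun i t h => ?_
    refine Scan.exec (c := emitAll edgePairs) ?_ rfl
    have := (h.touch (i := 2 * i) le_rfl).touch (i := 2 * i + 1) (by omega)
    simp only [Cmd.exec, AExpr.eval_var, AExpr.eval_mul, AExpr.eval_add, AExpr.eval_ofNat]
    simp
    exact (this.mono (by omega)).congr rfl rfl
  have r1 := r.exec (p := p) emitEdges (by decide)
  have i1 := (emitEdges.exec_frame_io p 4 a rfl).1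
  have s4 : Scan p 4 (emitEdges.exec p a) n (emitVertices.exec p (emitEdges.exec p a)) := by
    refine scan_for (fun i => i) r1.N (Scan.refl _ _) fun i t h => ?_
    refine Scan.exec (c := .set rgX (2 * var rgN - var rgX / var rgC) ;; emitAll vertexPairs) ?_ rfl
    have := h.touch (i := i) le_rfl
    simp [Cmd.exec]
    exact (this.mono (by omega)).congr rfl rfl
  have i0 := (emitVertices.exec_frame_io p 0 (emitEdges.exec p a) rfl).1
  have i2 := fun f (hf : (emitAll starPairs ;; emitDigits ;; emitPendants).usesFile f = false) =>
    ((emitAll starPairs ;; emitDigits ;; emitPendants).exec_frame_io p f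
      (emitVertices.exec p (emitEdges.exec p a)) hf).1
  have j0 := (s0.mono (q' := 2 * s) (by omega)).io_le
  have j4 := (s4.mono (q' := 2 * s) (by omega)).io_le
  rw [i1] at j4
  constructor
  · exact (i2 0 rfl).trans_le (i0.trans_le j0)
  · exact (i2 4 rfl).trans_le j4

end emitGadget

/-! ### Propagating a set of vertices to its neighbours -/

/-- Store `1` in file `g` for every vertex with a key whose second vertex lies in the block in array
`0` and has a nonzero entry there. -/
def spreadStream (g : ℕ) : Cmd :=
  .iter rgI rgS (.read rgX 3 (var rgI) ;; .set rgU (var rgX / var rgC) ;;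
    .set rgW (var rgX % var rgC) ;;
    .ite (.lt (var rgW) (var rgK * var rgD + var rgD) * .lt (var rgK * var rgD) (var rgW + 1))
      (.get rgY 0 (var rgW - var rgK * var rgD) ;; .ite (var rgY) (.write g (var rgU) 1) .skip)
      .skip)

/-- Make the entries of file `g` nonzero for the neighbours of the vertices with nonzero entry in file
`f`. -/
def spread (f g : ℕ) : Cmd := .iter rgK rgR (loadBlock f 0 ;; spreadStream g)

section spread
variable {p : Par} {n m s D R : ℕ} {a : AState}

theorem spreadStream_spec (d : Dims p n m s D R) (r : Regs n m s D R a) (ok : a.ok)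
    {A : ℕ → ℕ → Prop} {F : ℕ → ℕ} (hF : SortedKeys n s (R * D) A F) {k g : ℕ} (hg : g ≠ 3)
    (hk : a.v rgK = k) (hkR : k < R) (hFW : ∀ i < R * D, F i < p.W)
    (h3 : ∀ i < R * D, a.file 3 i = F i) (h0 : ∀ j < D, a.arr 0 j < p.W)
    (h4 : ∀ u, a.file g u < p.W) :
    ((spreadStream g).exec p a).ok ∧
    (∀ u, ((spreadStream g).exec p a).file g u < p.W ∧
      (((spreadStream g).exec p a).file g u ≠ 0 ↔ a.file g u ≠ 0 ∨
        ∃ i < s, F i / (n + 1) = u ∧ k * D ≤ F i % (n + 1) ∧ F i % (n + 1) < k * D + D ∧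
          a.arr 0 (F i % (n + 1) - k * D) ≠ 0)) ∧
    Scan p 3 a (2 * s) ((spreadStream g).exec p a) ∧
    Scan p g a (2 * s) ((spreadStream g).exec p a) := by
  have hZ := d.two_s_lt
  have hZW := d.Z_le_W
  have hs := d.hs
  have hDM := d.hDM
  have hR := d.hR
  have hblk := d.block hkR
  obtain ⟨t, ⟨A1, A2, q, A4, A5, A6⟩, h5, e⟩ := exec_for_frame p (x := rgI) (y := rgS)
    (c := .read rgX 3 (var rgI) ;; .set rgU (var rgX / var rgC) ;; .set rgW (var rgX % var rgC) ;;
      .ite (.lt (var rgW) (var rgK * var rgD + var rgD) * .lt (var rgK * var rgD) (var rgW + 1))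
        (.get rgY 0 (var rgW - var rgK * var rgD) ;; .ite (var rgY) (.write g (var rgU) 1) .skip)
        .skip) (a := a)
    (fun i t =>
      (∀ u, t.file g u < p.W ∧ (t.file g u ≠ 0 ↔ a.file g u ≠ 0 ∨
        ∃ i' < i, F i' / (n + 1) = u ∧ k * D ≤ F i' % (n + 1) ∧ F i' % (n + 1) < k * D + D ∧
          a.arr 0 (F i' % (n + 1) - k * D) ≠ 0)) ∧
      Scan p 3 a i t ∧
      ∃ q, Scan p g a q t ∧ q ≤ n ∧ ∀ i', i ≤ i' → i' < s → q ≤ F i' / (n + 1))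
    r.S (by omega) ⟨fun u => ⟨h4 u, by simp⟩, Scan.refl _ _, 0, Scan.refl _ _, by omega,
      fun _ _ _ => Nat.zero_le _⟩ ok (by
      rintro i t hi hiW Fr hok ⟨A1, A2, q, A4, A5, A6⟩
      have e3 := Fr.file 3 (by simp [Cmd.writesFile, hg.symm])
      have e0 := Fr.arr 0 rfl
      have g3 := h3 i (by omega)
      have b3 := hFW i (by omega)
      have eK := (Fr.v 15 (by decide) rfl).trans hk
      have eD := (Fr.v 4 (by decide) rfl).trans r.D
      have eC := (Fr.v 6 (by decide) rfl).trans r.C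
      have hun := hF.lt i hi
      have hmod := Nat.mod_le (F i) (n + 1)
      rw [Cmd.exec_seq, Cmd.exec_seq, Cmd.exec_seq]
      generalize hu : (Cmd.set rgW (var rgX % var rgC)).exec p
        ((Cmd.set rgU (var rgX / var rgC)).exec p
          ((Cmd.read rgX 3 (var rgI)).exec p (t.setv p rgI i))) = u
      have uu : u.v rgU = F i / (n + 1) := by
        rw [← hu]; simp [Cmd.exec, e3, g3, eC]
      have uw : u.v rgW = F i % (n + 1) := by
        rw [← hu]; simp [Cmd.exec, e3, g3, eC]
      have uk : u.v rgK = k := by rw [← hu]; simp [Cmd.exec, eK]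
      have ud : u.v rgD = D := by rw [← hu]; simp [Cmd.exec, eD]
      have uok : u.ok := by
        rw [← hu]; simp [Cmd.exec, e3, g3, eC, hok]; omega
      have ua : u.arr 0 = a.arr 0 := by rw [← hu, ← e0]; simp [Cmd.exec]
      have uf : u.file = t.file := by rw [← hu]; simp [Cmd.exec]
      have us3 : Scan p 3 a i u := by
        rw [← hu]; simp [Cmd.exec]; exact (A2.touch le_rfl).congr rfl rfl
      have usg : Scan p g a q u := by
        rw [← hu]; simp [Cmd.exec]
        exact (A4.touch_ne (g := 3) (i := i) hg).congr rfl rfl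
      clear hu
      have hsucc : ∀ w, (∃ i' < i + 1, F i' / (n + 1) = w ∧ k * D ≤ F i' % (n + 1) ∧
          F i' % (n + 1) < k * D + D ∧ a.arr 0 (F i' % (n + 1) - k * D) ≠ 0) ↔
          (∃ i' < i, F i' / (n + 1) = w ∧ k * D ≤ F i' % (n + 1) ∧
          F i' % (n + 1) < k * D + D ∧ a.arr 0 (F i' % (n + 1) - k * D) ≠ 0) ∨
          (F i / (n + 1) = w ∧ k * D ≤ F i % (n + 1) ∧
          F i % (n + 1) < k * D + D ∧ a.arr 0 (F i % (n + 1) - k * D) ≠ 0) := by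
        intro w
        constructor
        · rintro ⟨i', h1, h2⟩
          rcases Nat.lt_succ_iff_lt_or_eq.1 h1 with h1 | rfl
          · exact Or.inl ⟨i', h1, h2⟩
          · exact Or.inr h2
        · rintro (⟨i', h1, h2⟩ | h2)
          · exact ⟨i', by omega, h2⟩
          · exact ⟨i, by omega, h2⟩
      have hsame : (¬ (k * D ≤ F i % (n + 1) ∧ F i % (n + 1) < k * D + D ∧
          a.arr 0 (F i % (n + 1) - k * D) ≠ 0)) → ∀ x : AState, x.ok → x.file = t.file →
          Scan p 3 a i x → Scan p g a q x →
          ((∀ u, x.file g u < p.W ∧ (x.file g u ≠ 0 ↔ a.file g u ≠ 0 ∨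
            ∃ i' < i + 1, F i' / (n + 1) = u ∧ k * D ≤ F i' % (n + 1) ∧
              F i' % (n + 1) < k * D + D ∧ a.arr 0 (F i' % (n + 1) - k * D) ≠ 0)) ∧
          Scan p 3 a (i + 1) x ∧
          ∃ q, Scan p g a q x ∧ q ≤ n ∧ ∀ i', i + 1 ≤ i' → i' < s → q ≤ F i' / (n + 1)) ∧ x.ok := by
        intro hno x xok xf x3 xg
        refine ⟨⟨fun w => ⟨by rw [xf]; exact (A1 w).1, ?_⟩, x3.mono (by omega), q, xg, A5,
          fun i' h1 => A6 i' (by omega)⟩, xok⟩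
        rw [xf, (A1 w).2, hsucc, or_iff_left (b := _ ∧ _) (fun h => hno h.2)]
      by_cases hb : k * D ≤ F i % (n + 1) ∧ F i % (n + 1) < k * D + D
      · rw [Cmd.exec_ite_of_ne (by
          simp only [AExpr.eval_mul, AExpr.eval_var, ne_eq, mul_eq_zero, AExpr.eval_lt_eq_zero,
            AExpr.eval_add, AExpr.eval_ofNat, uw, uk, ud]
          omega), Cmd.exec_seq]
        have b0 := h0 (F i % (n + 1) - k * D) (by omega)
        generalize hv : (Cmd.get rgY 0 (var rgW - var rgK * var rgD)).exec p u = v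
        have vy : v.v rgY = a.arr 0 (F i % (n + 1) - k * D) := by
          rw [← hv]; simp [Cmd.exec, uw, uk, ud, ua]
        have vu : v.v rgU = F i / (n + 1) := by rw [← hv]; simp [Cmd.exec, uu]
        have vok : v.ok := by
          rw [← hv]; simp [Cmd.exec, uw, uk, ud, ua, uok, b0]; omega
        have vf : v.file = t.file := by rw [← hv]; simp [Cmd.exec, uf]
        have vs3 : Scan p 3 a i v := by rw [← hv]; exact us3.exec _ rfl
        have vsg : Scan p g a q v := by rw [← hv]; exact usg.exec _ rfl
        clear hv
        by_cases hy : a.arr 0 (F i % (n + 1) - k * D) = 0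
        · rw [Cmd.exec_ite_of_eq (by simp [vy, hy]), Cmd.exec]
          exact hsame (fun h => h.2.2 hy) v vok vf vs3 vsg
        · rw [Cmd.exec_ite_of_ne (by simp [vy, hy])]
          refine ⟨⟨?_, ?_, F i / (n + 1), ?_, hun.le, ?_⟩, ?_⟩
          · intro w
            simp only [Cmd.exec, AExpr.eval_var, AExpr.eval_ofNat, vu, setFile_file, touch_file,
              Function.update_self, vf]
            by_cases hw : w = F i / (n + 1)
            · subst hw
              rw [Function.update_self]
              refine ⟨by omega, iff_of_true one_ne_zero (Or.inr ⟨i, by omega, rfl, hb.1, hb.2, hy⟩)⟩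
            · rw [Function.update_of_ne hw]
              refine ⟨(A1 w).1, ?_⟩
              rw [(A1 w).2, hsucc, or_iff_left (b := _ ∧ _) (fun h => hw h.1.symm)]
          · simp [Cmd.exec]
            exact ((vs3.touch_ne (Ne.symm hg)).setFile).mono (by omega)
          · simp [Cmd.exec, vu]
            exact (vsg.touch (A6 i le_rfl hi)).setFile
          · intro i' h1 h2
            exact Nat.div_le_div_right (hF.lt_of_lt i i' (by omega) h2).le
          · simp [Cmd.exec, vok, vu]; omega
      · rw [Cmd.exec_ite_of_eq (by
          simp only [AExpr.eval_mul, AExpr.eval_var, mul_eq_zero, AExpr.eval_lt_eq_zero,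
            AExpr.eval_add, AExpr.eval_ofNat, uw, uk, ud]
          omega), Cmd.exec]
        exact hsame (fun h => hb ⟨h.1, h.2.1⟩) u uok uf us3 usg)
  rw [spreadStream, e]
  exact ⟨e ▸ h5, A1, A2.mono (by omega), A4.mono (by omega)⟩

theorem spread_spec (d : Dims p n m s D R) (r : Regs n m s D R a) (ok : a.ok)
    {A : ℕ → ℕ → Prop} {F : ℕ → ℕ} (hF : SortedKeys n s (R * D) A F) {f g : ℕ} (hg : g ≠ 3)
    (hf : f ≠ 3) (hfg : f ≠ g) (hA : ∀ u w, A u w → u < n ∧ w < n)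
    (hFW : ∀ i < R * D, F i < p.W)
    (h3 : ∀ i < R * D, a.file 3 i = F i) (hfW : ∀ w, a.file f w < p.W)
    (hfn : ∀ w, a.file f w ≠ 0 → w < n) (h0 : ∀ u, a.file g u = 0) :
    ((spread f g).exec p a).ok ∧
    (∀ u, ((spread f g).exec p a).file g u < p.W ∧
      (((spread f g).exec p a).file g u ≠ 0 ↔ ∃ w, A u w ∧ a.file f w ≠ 0)) ∧
    ((spread f g).exec p a).io 3 ≤ a.io 3 + R * (2 + 2 * (2 * s / p.B)) ∧
    ((spread f g).exec p a).io f ≤ a.io f + R * (2 + 2 * (2 * s / p.B)) ∧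
    ((spread f g).exec p a).io g ≤ a.io g + R * (2 + 2 * (2 * s / p.B)) := by
  have hZ := d.two_s_lt
  have hZW := d.Z_le_W
  have hs := d.hs
  have hRle := d.R_le
  have hR := d.hR
  obtain ⟨t, ⟨A1, A2, A3, A4⟩, h5, e⟩ := exec_for_frame p (x := rgK) (y := rgR)
    (c := loadBlock f 0 ;; spreadStream g) (a := a)
    (fun k t => (∀ u, t.file g u < p.W ∧ (t.file g u ≠ 0 ↔
        ∃ i < s, F i / (n + 1) = u ∧ F i % (n + 1) < k * D ∧ a.file f (F i % (n + 1)) ≠ 0)) ∧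
      t.io 3 ≤ a.io 3 + k * (2 + 2 * (2 * s / p.B)) ∧
      t.io f ≤ a.io f + k * (2 + 2 * (2 * s / p.B)) ∧
      t.io g ≤ a.io g + k * (2 + 2 * (2 * s / p.B)))
    r.R (by omega) ⟨fun u => ⟨by rw [h0]; omega, by simp [h0]⟩, by simp, by simp, by simp⟩ ok (by
      rintro k t hk hkW Fr hok ⟨A1, A2, A3, A4⟩
      have e3 := Fr.file 3 (by simp [Cmd.writesFile, loadBlock, spreadStream, hg.symm])
      have ef := Fr.file f (by simp [Cmd.writesFile, loadBlock, spreadStream, hfg])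
      have rt := (r.frame Fr (by decide) (by
        intro x hx
        fin_cases hx <;> rfl)).setv (p := p) (x := rgK) (k := k) (by decide)
      rw [Cmd.exec_seq]
      obtain ⟨ok1, B1, S1⟩ := loadBlock_spec d rt (⟨hok, hkW⟩ : (t.setv p rgK k).ok) (f := f)
        (b := 0) (k := k) (by simp) hk (fun i _ => by rw [setv_file, ef]; exact hfW i)
      have r1 := rt.exec (p := p) (loadBlock f 0) (by intro x hx; fin_cases hx <;> rfl)
      have k1 := ((loadBlock f 0).exec_frame_v p rgK (t.setv p rgK k) rfl).trans
        (show (t.setv p rgK k).v rgK = k by simp)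
      have f1 := fun f' => (loadBlock f 0).exec_frame_file p f' (t.setv p rgK k) rfl
      have i3 := ((loadBlock f 0).exec_frame_io p 3 (t.setv p rgK k) (by
        simp [loadBlock, Cmd.usesFile, hf.symm])).1
      have ig := ((loadBlock f 0).exec_frame_io p g (t.setv p rgK k) (by
        simp [loadBlock, Cmd.usesFile, hfg.symm])).1
      generalize (loadBlock f 0).exec p (t.setv p rgK k) = b at *
      simp only [setv_file, setv_io] at B1 f1 i3 ig
      obtain ⟨ok2, C1, S3, Sg⟩ := spreadStream_spec d r1 ok1 hF hg k1 hk hFW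
        (by rw [f1, e3]; exact h3) (by intro j hj; rw [B1 j hj, ef]; exact hfW _)
        (by rw [f1]; exact fun u => (A1 u).1)
      have if2 := ((spreadStream g).exec_frame_io p f b (by
        simp [spreadStream, Cmd.usesFile, hf, hfg])).1
      refine ⟨⟨fun u => ⟨(C1 u).1, ?_⟩, ?_, ?_, ?_⟩, ok2⟩
      · rw [(C1 u).2, f1, (A1 u).2]
        constructor
        · rintro (⟨i, h1, h2, h3, h4⟩ | ⟨i, h1, h2, h3, h4, h5⟩)
          · exact ⟨i, h1, h2, by rw [add_mul]; omega, h4⟩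
          · refine ⟨i, h1, h2, by rw [add_mul]; omega, ?_⟩
            rwa [B1 _ (by omega), Nat.add_sub_cancel' h3, ef] at h5
        · rintro ⟨i, h1, h2, h3, h4⟩
          by_cases hlt : F i % (n + 1) < k * D
          · exact Or.inl ⟨i, h1, h2, hlt, h4⟩
          · rw [add_mul] at h3
            refine Or.inr ⟨i, h1, h2, by omega, by omega, ?_⟩
            rwa [B1 _ (by omega), Nat.add_sub_cancel' (by omega), ef]
      · have := S3.io_le; rw [add_mul]; omega
      · have := S1.io_le; simp only [setv_io] at this; rw [add_mul]; omega
      · have := Sg.io_le; rw [add_mul]; omega)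
  rw [spread, e]
  refine ⟨e ▸ h5, fun u => ⟨(A1 u).1, (A1 u).2.trans ?_⟩, A2, A3, A4⟩
  constructor
  · rintro ⟨i, h1, rfl, -, h3⟩
    exact ⟨_, hF.rel h1 (hfn _ h3), h3⟩
  · rintro ⟨w, h1, h2⟩
    have hA' := hA _ _ h1
    obtain ⟨i, hi, hi'⟩ := (hF.mem u hA'.1 w hA'.2.le).2 (Or.inr h1)
    exact ⟨i, hi, by rw [hi', key_div _ hA'.2.le], by rw [hi', key_mod _ hA'.2.le]; omega,
      by rwa [hi', key_mod _ hA'.2.le]⟩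

end spread

/-! ### Sorting the keys and counting -/

/-- Vertices, given as numbers, that are equal or adjacent. -/
def NearNat {n : ℕ} (G : SimpleGraph (Fin n)) (v w : ℕ) : Prop :=
  ∃ (hv : v < n) (hw : w < n), Near G ⟨v, hv⟩ ⟨w, hw⟩

section nearNat
variable {n : ℕ} {G : SimpleGraph (Fin n)}

theorem NearNat.lt (u w : ℕ) (h : NearNat G u w) : u < n ∧ w < n := ⟨h.1, h.2.1⟩

theorem nearNat_val {v w : Fin n} : NearNat G v w ↔ Near G v w :=
  ⟨fun h => h.2.2, fun h => ⟨v.2, w.2, h⟩⟩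

theorem card_filter_range_eq (P : ℕ → Prop) (P' : Fin n → Prop) [DecidablePred P]
    [DecidablePred P'] (h : ∀ v : Fin n, P v ↔ P' v) :
    ((Finset.range n).filter P).card = (Finset.univ.filter P').card := by
  symm
  refine Finset.card_bij (fun v _ => (v : ℕ)) ?_ ?_ ?_
  · intro v hv
    simp only [Finset.mem_filter, Finset.mem_univ, true_and] at hv
    simp [(h v).2 hv]
  · exact fun v _ w _ => Fin.ext
  · intro v hv
    simp only [Finset.mem_filter, Finset.mem_range] at hv
    exact ⟨⟨v, hv.1⟩, by simp [(h ⟨v, hv.1⟩).1 hv.2], rfl⟩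

theorem keys_of_edgeList {L : List (Fin n × Fin n)} (hL : IsEdgeList G L) {K : ℕ → ℕ}
    (hE : ∀ i < L.length, K (2 * i) = words L (2 * i) * (n + 1) + words L (2 * i + 1) ∧
      K (2 * i + 1) = words L (2 * i + 1) * (n + 1) + words L (2 * i))
    (hV : ∀ v < n, K (2 * L.length + 2 * v) = v * (n + 1) + v ∧
      K (2 * L.length + 2 * v + 1) = v * (n + 1) + n) :
    Keys n (2 * L.length + 2 * n) (NearNat G) K := by
  have hE' : ∀ i : Fin L.length, K (2 * i) = (L.get i).1 * (n + 1) + (L.get i).2 ∧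
      K (2 * i + 1) = (L.get i).2 * (n + 1) + (L.get i).1 := by
    intro i
    obtain ⟨h1, h2⟩ := words_get L i
    have := hE i i.2
    rwa [h1, h2] at this
  have hadj : ∀ i : Fin L.length, G.Adj (L.get i).1 (L.get i).2 := fun i =>
    hL.adj.2 (Or.inl (List.get_mem L i))
  have hne : ∀ i : Fin L.length, ((L.get i).1 : ℕ) ≠ (L.get i).2 := fun i h =>
    (hadj i).ne (Fin.ext h)
  have huniq : ∀ i j : Fin L.length, s((L.get i).1, (L.get i).2) = s((L.get j).1, (L.get j).2) →
      i = j := by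
    intro i j h
    have := List.nodup_iff_injective_get.1 hL.1
    have := @this ⟨i, by simp⟩ ⟨j, by simp⟩ (by simpa using h)
    exact Fin.ext (by simpa using this)
  -- the index of a key can be read off from the key
  have hform : ∀ i < 2 * L.length + 2 * n, ∃ x y, x < n ∧ K i = x * (n + 1) + y ∧
      ((∃ j : Fin L.length, (i = 2 * j ∧ x = (L.get j).1 ∧ y = (L.get j).2) ∨
        (i = 2 * j + 1 ∧ x = (L.get j).2 ∧ y = (L.get j).1)) ∨
      (i = 2 * L.length + 2 * x ∧ y = x) ∨ (i = 2 * L.length + 2 * x + 1 ∧ y = n)) := by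
    intro i hi
    by_cases hi' : i < 2 * L.length
    · rcases Nat.even_or_odd' i with ⟨j, rfl | rfl⟩
      · have := hE' ⟨j, by omega⟩
        exact ⟨_, _, Fin.is_lt _, this.1, Or.inl ⟨⟨j, by omega⟩, Or.inl ⟨rfl, rfl, rfl⟩⟩⟩
      · have := hE' ⟨j, by omega⟩
        exact ⟨_, _, Fin.is_lt _, this.2, Or.inl ⟨⟨j, by omega⟩, Or.inr ⟨rfl, rfl, rfl⟩⟩⟩
    · obtain ⟨v, hv⟩ : ∃ v, i = 2 * L.length + v := ⟨i - 2 * L.length, by omega⟩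
      subst hv
      rcases Nat.even_or_odd' v with ⟨j, rfl | rfl⟩
      · exact ⟨j, j, by omega, (hV j (by omega)).1, Or.inr (Or.inl ⟨rfl, rfl⟩)⟩
      · exact ⟨j, n, by omega, (hV j (by omega)).2, Or.inr (Or.inr ⟨rfl, rfl⟩)⟩
  have hle : ∀ i x y, ((∃ j : Fin L.length, (i = 2 * (j : ℕ) ∧ x = ((L.get j).1 : ℕ) ∧
        y = ((L.get j).2 : ℕ)) ∨ (i = 2 * (j : ℕ) + 1 ∧ x = ((L.get j).2 : ℕ) ∧
        y = ((L.get j).1 : ℕ))) ∨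
      (i = 2 * L.length + 2 * x ∧ y = x) ∨ (i = 2 * L.length + 2 * x + 1 ∧ y = n)) →
      x < n → y ≤ n := by
    rintro i x y (⟨j, ⟨-, -, rfl⟩ | ⟨-, -, rfl⟩⟩ | ⟨-, rfl⟩ | ⟨-, rfl⟩) hx
    · exact (Fin.is_lt _).le
    · exact (Fin.is_lt _).le
    · omega
    · exact le_rfl
  refine ⟨?_, ?_, ?_⟩
  · intro i hi i' hi' he
    obtain ⟨x, y, hx, e1, h1⟩ := hform i hi
    obtain ⟨x', y', hx', e2, h2⟩ := hform i' hi'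
    have hy := hle i x y h1 hx
    have hy' := hle i' x' y' h2 hx'
    rw [e1, e2] at he
    obtain rfl : x = x' := by
      have := congrArg (· / (n + 1)) he
      simpa only [key_div _ hy, key_div _ hy'] using this
    obtain rfl : y = y' := by
      have := congrArg (· % (n + 1)) he
      simpa only [key_mod _ hy, key_mod _ hy'] using this
    rcases h1 with ⟨j, h1⟩ | h1 | h1 <;> rcases h2 with ⟨j', h2⟩ | h2 | h2
    · have b1 := hne j
      have b2 := hne j'
      obtain rfl : j = j' := by
        apply huniq
        rw [Sym2.eq_iff]
        simp only [Fin.ext_iff]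
        omega
      omega
    · have := hne j; omega
    · have := (L.get j).1.2; have := (L.get j).2.2; omega
    · have := hne j'; omega
    · omega
    · omega
    · have := (L.get j').1.2; have := (L.get j').2.2; omega
    · omega
    · omega
  · intro i hi
    obtain ⟨x, y, hx, e1, h1⟩ := hform i hi
    rw [e1, key_div _ (hle i x y h1 hx)]
    exact hx
  · intro v hv w hw
    constructor
    · rintro ⟨i, hi, e⟩
      obtain ⟨x, y, hx, e1, h1⟩ := hform i hi
      have hy := hle i x y h1 hx
      rw [e1] at e
      obtain rfl : x = v := by
        have := congrArg (· / (n + 1)) e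
        simpa only [key_div _ hy, key_div _ hw] using this
      obtain rfl : y = w := by
        have := congrArg (· % (n + 1)) e
        simpa only [key_mod _ hy, key_mod _ hw] using this
      rcases h1 with ⟨j, ⟨-, rfl, rfl⟩ | ⟨-, rfl, rfl⟩⟩ | ⟨-, rfl⟩ | ⟨-, rfl⟩
      · exact Or.inr (nearNat_val.2 (Or.inr (hadj j)))
      · exact Or.inr (nearNat_val.2 (Or.inr (hadj j).symm))
      · exact Or.inr ⟨hx, hx, near_refl _⟩
      · exact Or.inl rfl
    · rintro (rfl | ⟨h1, h2, h⟩)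
      · exact ⟨_, by omega, (hV v hv).2⟩
      · rcases h with h | h
        · obtain rfl : v = w := by simpa using h
          exact ⟨_, by omega, (hV v hv).1⟩
        · rcases hL.adj.1 h with h | h
          · obtain ⟨j, hj⟩ := List.get_of_mem h
            have := (hE' j).1
            rw [hj] at this
            exact ⟨_, by omega, this⟩
          · obtain ⟨j, hj⟩ := List.get_of_mem h
            have := (hE' j).2
            rw [hj] at this
            exact ⟨_, by omega, this⟩

end nearNat

/-- Compute the number of keys, the block size and the number of blocks. -/
def initCmd : Cmd :=
  .set rgS (2 * var rgE + 2 * var rgN) ;; .set rgD (var rgM - (var rgM - var rgS)) ;;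
  .set rgR (var rgS / var rgD + 1) ;; .set rgC (var rgN + 1)

/-- Sort the keys, and count the vertices within distance one and two of every vertex. -/
def countPhase : Cmd := initCmd ;; keysCmd ;; rankCmd ;; placeCmd ;; countCmd

section countPhase
variable {p : Par} {n : ℕ} {L : List (Fin n × Fin n)}

theorem initCmd_spec (hn : 1 ≤ n) (hM : 0 < p.M) (hZ : p.Z = 1000 * (n + L.length + 1))
    (hW : p.Z * p.Z ≤ p.W) (hMW : p.M < p.W) :
    ∃ D R, Dims p n L.length (2 * L.length + 2 * n) D R ∧
      D = min p.M (2 * L.length + 2 * n) ∧ R = (2 * L.length + 2 * n) / D + 1 ∧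
      (initCmd.exec p (startState L p.M)).ok ∧
      Regs n L.length (2 * L.length + 2 * n) D R (initCmd.exec p (startState L p.M)) := by
  set s := 2 * L.length + 2 * n with hs
  refine ⟨min p.M s, s / min p.M s + 1, ?_, rfl, rfl, ?_⟩
  · have hD : 0 < min p.M s := by omega
    have h1 := Nat.div_add_mod' s (min p.M s)
    have h2 := Nat.mod_lt s hD
    exact ⟨rfl, hD, min_le_right _ _, min_le_left _ _, by rw [add_mul]; omega,
      by rw [add_mul]; omega, hZ, hW⟩
  have hZW : p.Z ≤ p.W := (Nat.le_mul_of_pos_left _ (by omega)).trans hW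
  have hdiv : ∀ D, s / D ≤ s := Nat.div_le_self s
  have hmin : p.M - (p.M - s) = min p.M s := by omega
  have hrun : initCmd.exec p (startState L p.M) =
      (((((startState L p.M).setv p rgS s).setv p rgD (min p.M s)).setv p rgR
        (s / min p.M s + 1)).setv p rgC (n + 1)) := by
    rw [← hmin]; rfl
  have := hdiv (min p.M s)
  rw [hrun]
  refine ⟨by simp [startState]; omega, ?_⟩
  constructor <;> simp [startState]

theorem countPhase_spec {G : SimpleGraph (Fin n)} (hL : IsEdgeList G L) (hn : 1 ≤ n) (hM : 0 < p.M)
    (hZ : p.Z = 1000 * (n + L.length + 1)) (hW : p.Z * p.Z ≤ p.W) (hMW : p.M < p.W)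
    {s D R Θ : ℕ} (hs : s = 2 * L.length + 2 * n) (hD : D = min p.M s) (hR : R = s / D + 1)
    (hΘ : Θ = 2 + 2 * (2 * s / p.B)) {a : AState}
    (ha : a = countPhase.exec p (startState L p.M)) :
    Dims p n L.length s D R ∧ a.ok ∧ Regs n L.length s D R a ∧
    (∃ F, SortedKeys n s (R * D) (NearNat G) F ∧ ∀ i < R * D, a.file 3 i = F i ∧ F i < p.W) ∧
    (∀ v : Fin n, a.file 4 v < p.W ∧ a.file 4 v / (n + 1) = ball1 G v + ball2 G v) ∧
    a.io 0 ≤ Θ ∧ a.io 1 ≤ (3 * R + 2) * Θ ∧ a.io 2 ≤ 2 * R * Θ ∧ a.io 3 ≤ 3 * R * Θ ∧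
    a.io 4 ≤ R * Θ := by
  classical
  obtain ⟨D', R', d, hD', hR', ok0, r0⟩ := initCmd_spec (L := L) hn hM hZ hW hMW
  rw [← hs] at d hD' hR' r0
  obtain rfl : D = D' := hD.trans hD'.symm
  obtain rfl : R = R' := hR.trans hR'.symm
  have hZ2 := d.two_s_lt
  have hZW := d.Z_lt_W
  rw [countPhase, Cmd.exec_seq, Cmd.exec_seq, Cmd.exec_seq, Cmd.exec_seq] at ha
  have f0 : (initCmd.exec p (startState L p.M)).file = (startState L p.M).file := by
    funext f; exact initCmd.exec_frame_file p f _ rfl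
  have i0 : (initCmd.exec p (startState L p.M)).io = (startState L p.M).io := by
    funext f; exact (initCmd.exec_frame_io p f _ rfl).1
  have f00 : (startState L p.M).file 0 = words L := rfl
  have f0f : ∀ f, f ≠ 0 → ∀ i, (startState L p.M).file f i = 0 := fun f hf i => if_neg hf
  have i0f : ∀ f, (startState L p.M).io f = 0 := fun _ => rfl
  generalize initCmd.exec p (startState L p.M) = b at *
  -- the list of keys
  obtain ⟨ok1, K1, K2, K3, I0, I1⟩ := keysCmd_spec d r0 ok0 (by
    intro i hi; rw [f0, f00]; exact words_lt L hi) (by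
    intro i; rw [f0, f0f 1 (by decide)])
  have r1 := r0.exec (p := p) keysCmd (by decide)
  have f1 := fun f hf => keysCmd.exec_frame_file p f b hf
  have i1 := fun f hf => (keysCmd.exec_frame_io p f b hf).1
  generalize keysCmd.exec p b = c at *
  rw [f0, f00] at K1
  have hK := keys_of_edgeList hL K1 K2
  rw [← hs] at hK
  have hKW : ∀ i, c.file 1 i < p.W := by
    intro i
    by_cases hi : i < s
    · refine (hK.lt_sq hi).trans_le (le_trans (Nat.mul_le_mul ?_ ?_) d.hW) <;> omega
    · rw [K3 i (by omega)]; omega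
  -- their ranks
  obtain ⟨ok2, A2, J1, J2⟩ := rankCmd_spec d r1 ok1 hKW
  have r2 := r1.exec (p := p) rankCmd (by decide)
  have f2 := fun f hf => rankCmd.exec_frame_file p f c hf
  have i2 := fun f hf => (rankCmd.exec_frame_io p f c hf).1
  generalize rankCmd.exec p c = e at *
  have hRs := d.hR
  -- the sorted list
  have hlt : ∀ i < s, e.file 2 i < s := by
    intro i hi; rw [A2 i (by omega)]; exact rank_lt hi
  obtain ⟨ok3, A3, M1, M2, M3⟩ := placeCmd_spec d r2 ok2
    (by intro i hi; rw [f2 1 rfl]; exact hKW i) hlt (by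
      intro i hi j hj he
      rw [A2 i (by omega), A2 j (by omega)] at he
      refine hK.inj i hi j hj ?_
      by_contra hne
      rcases lt_or_gt_of_ne hne with h | h
      · have := rank_lt_rank hi h; omega
      · have := rank_lt_rank hj h; omega)
  have r3 := r2.exec (p := p) placeCmd (by decide)
  have f3 := fun f hf => placeCmd.exec_frame_file p f e hf
  have i3 := fun f hf => (placeCmd.exec_frame_io p f e hf).1
  generalize placeCmd.exec p e = g at *
  have hsorted : SortedKeys n s (R * D) (NearNat G) (g.file 3) := by
    refine hK.sorted hRs.le fun q hq => ?_
    obtain ⟨B1, B2⟩ := A3 q hq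
    rw [f2 1 rfl] at B1
    refine ⟨fun i hi h => B1 i hi (by rw [A2 i (by omega)]; exact h), fun h => B2 fun i hi => ?_⟩
    rw [A2 i (by omega)]; exact h i hi
  have hFW : ∀ i < R * D, g.file 3 i < p.W := by
    intro i hi
    by_cases his : i < s
    · refine (hsorted.lt_sq his).trans_le (le_trans (Nat.mul_le_mul ?_ ?_) d.hW) <;> omega
    · rw [hsorted.tail i (by omega) hi]; omega
  -- the counts
  obtain ⟨ok4, A4, N3, N4⟩ := countCmd_spec d r3 ok3 hsorted hFW (fun _ _ => rfl) (by
    intro v hv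
    rw [f3 4 rfl, f2 4 rfl, f1 4 rfl, f0, f0f 4 (by decide)])
  have r4 := r3.exec (p := p) countCmd (by decide)
  have f4 := fun f hf => countCmd.exec_frame_file p f g hf
  have i4 := fun f hf => (countCmd.exec_frame_io p f g hf).1
  rw [← ha] at *
  rw [i0, i0f] at I0 I1
  simp only [← hΘ] at I0 I1 J1 J2 M1 M2 M3 N3 N4
  refine ⟨d, ok4, r4, ⟨g.file 3, hsorted, fun i hi => ⟨by rw [f4 3 rfl], hFW i hi⟩⟩, ?_, ?_, ?_, ?_,
    ?_, ?_⟩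
  · intro v
    obtain ⟨cnt, last, h1, h2⟩ := A4 v v.2
    have hle := h2.le
    have hcl := h2.cnt_le
    have hR2 := d.hR2
    have hfin := h2.cnt_final hsorted hRs.le v.2 NearNat.lt
    rw [h1, key_div _ hle]
    constructor
    · refine lt_of_le_of_lt ?_ (d.mul_lt (x := cnt) (y := last) (by omega) (by omega))
      exact Nat.add_le_add_right (Nat.mul_le_mul_left _ (by omega)) _
    · rw [hfin, add_comm, ball1, ball2]
      congr 1
      · refine card_filter_range_eq _ _ fun u => ?_
        exact nearNat_val
      · refine card_filter_range_eq _ _ fun u => ?_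
        constructor
        · rintro ⟨w, h1, h2⟩
          exact ⟨⟨w, h1.2.1⟩, h1.2.2, h2.2.2.symm⟩
        · rintro ⟨w, h1, h2⟩
          exact ⟨w, nearNat_val.2 h1, nearNat_val.2 h2.symm⟩
  · rw [i4 0 rfl, i3 0 rfl, i2 0 rfl]; omega
  · rw [i4 1 rfl]; linarith
  · rw [i1 2 rfl, i0, i0f] at J2
    rw [i4 2 rfl]; linarith
  · rw [i2 3 rfl, i1 3 rfl, i0, i0f] at M3
    linarith
  · rw [i3 4 rfl, i2 4 rfl, i1 4 rfl, i0, i0f] at N4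
    linarith

end countPhase

/-! ### Building the gadget graph -/

/-- Compute the base of the digits, the number of pendant vertices, and the number of vertices of the
gadget graph. -/
def baseCmd : Cmd :=
  .set rgQ 0 ;; .set rgZ (2 * var rgN + 1) ;;
  .iter rgI rgZ (.ite (.lt (var rgQ * var rgQ) (var rgZ)) (.set rgQ (var rgQ + 1)) .skip) ;;
  .set rgP (5 * (4 * var rgN + 3 * var rgQ + var rgQ * var rgQ + 4) + 1) ;;
  .set rgV (4 * var rgN + 3 * var rgQ + var rgQ * var rgQ + 4 + 3 * var rgP)

/-- Write the gadget graph to file `9`. -/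
def gadgetPhase : Cmd :=
  baseCmd ;; .set rgPos 0 ;; emitGadget ;; .set rgF (var rgPos / 2)

section gadgetPhase
variable {p : Par} {n m s D R : ℕ} {a : AState}

theorem baseCmd_spec (d : Dims p n m s D R) (r : Regs n m s D R a) (ok : a.ok) :
    ∃ Q, 2 * n < Q * Q ∧ Q ≤ 2 * n + 1 ∧ Q * Q ≤ 6 * n + 2 ∧ (baseCmd.exec p a).ok ∧
      (baseCmd.exec p a).v rgQ = Q ∧ (baseCmd.exec p a).v rgP = 5 * coreSize n Q + 1 ∧
      (baseCmd.exec p a).v rgV = coreSize n Q + 3 * (5 * coreSize n Q + 1) := by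
  have hZ := d.hZ
  have hZW := d.Z_lt_W
  rw [baseCmd, Cmd.exec_seq, Cmd.exec_seq, Cmd.exec_seq]
  generalize hb : (Cmd.set rgZ (2 * var rgN + 1)).exec p ((Cmd.set rgQ 0).exec p a) = b
  have bok : b.ok := by rw [← hb]; simp [Cmd.exec, ok, r.N]; omega
  have bQ : b.v rgQ = 0 := by rw [← hb]; simp [Cmd.exec]
  have bZ : b.v rgZ = 2 * n + 1 := by rw [← hb]; simp [Cmd.exec, r.N]
  have bN : b.v rgN = n := by rw [← hb]; simp [Cmd.exec, r.N]
  clear hb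
  obtain ⟨t, ⟨A1, A2, A3⟩, h3, e⟩ := exec_for_frame p (x := rgI) (y := rgZ)
    (c := .ite (.lt (var rgQ * var rgQ) (var rgZ)) (.set rgQ (var rgQ + 1)) .skip) (a := b)
    (fun i t => t.v rgQ ≤ i ∧ t.v rgQ * t.v rgQ ≤ 2 * n + 2 * t.v rgQ ∧
      (2 * n < t.v rgQ * t.v rgQ ∨ t.v rgQ = i))
    bZ (by omega) ⟨by omega, by simp [bQ], Or.inr bQ⟩ bok (by
      rintro i t hi hiW F hok ⟨A1, A2, A3⟩
      have e18 := (F.v 18 (by decide) rfl).trans bZ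
      by_cases hq : t.v rgQ * t.v rgQ < 2 * n + 1
      · rw [Cmd.exec_ite_of_ne (by rw [Ne, AExpr.eval_lt_eq_zero, not_not]; simpa [e18] using hq)]
        simp [Cmd.exec, hok]
        refine ⟨⟨A1, by nlinarith, Or.inr (by omega)⟩, hiW, by omega⟩
      · rw [Cmd.exec_ite_of_eq (by rw [AExpr.eval_lt_eq_zero]; simpa [e18] using hq)]
        simp [Cmd.exec, hok, hiW]
        exact ⟨by omega, A2, by omega⟩)
  rw [e]
  rw [e] at h3
  have cN := (Cmd.exec_frame_v p rgN (.iter rgI rgZ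
    (.ite (.lt (var rgQ * var rgQ) (var rgZ)) (.set rgQ (var rgQ + 1)) .skip)) b rfl).trans bN
  rw [e] at cN
  have cQ : (t.setv p rgI (2 * n + 1)).v rgQ = t.v rgQ := by simp
  generalize t.setv p rgI (2 * n + 1) = c at *
  generalize t.v rgQ = Q at *
  have h1 : 2 * n < Q * Q := by
    rcases A3 with h | h
    · exact h
    · rw [h]; nlinarith
  have hP : 5 * (4 * n + 3 * Q + Q * Q + 4) + 1 < p.W := by omega
  have hV : 4 * n + 3 * Q + Q * Q + 4 + 3 * (5 * (4 * n + 3 * Q + Q * Q + 4) + 1) < p.W := by omega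
  refine ⟨Q, h1, A1, by omega, ?_, ?_, ?_, ?_⟩
  · simp [Cmd.exec, h3, cN, cQ, hP, hV]
  · simp [Cmd.exec, cQ]
  · simp [Cmd.exec, cN, cQ, coreSize]
  · simp [Cmd.exec, cN, cQ, coreSize]

theorem gadgetPhase_spec {G : SimpleGraph (Fin n)} {L : List (Fin n × Fin n)}
    (d : Dims p n L.length s D R) (r : Regs n L.length s D R a) (ok : a.ok)
    (h0 : ∀ i, a.file 0 i = words L i)
    (h4 : ∀ v : Fin n, a.file 4 v < p.W ∧ a.file 4 v / (n + 1) = ball1 G v + ball2 G v)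
    (h9 : ∀ i, a.file 9 i = 0) {Θ : ℕ} (hΘ : Θ = 2 + 2 * (2 * s / p.B)) :
    ∃ (Q N : ℕ) (lo hi : Fin n → Fin Q),
      (∀ v, ball1 G v + ball2 G v + (lo v + hi v * Q) = 2 * n) ∧ 5 * coreSize n Q < N ∧
      coreSize n Q + 3 * N ≤ 256 * n + 147 ∧
      (gadgetFinList L lo hi N).length ≤ 6 * L.length + 271 * n + 147 ∧
      (gadgetPhase.exec p a).ok ∧
      (∀ i, (gadgetPhase.exec p a).file 9 i = words (gadgetFinList L lo hi N) i) ∧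
      (gadgetPhase.exec p a).v rgV = coreSize n Q + 3 * N ∧
      (gadgetPhase.exec p a).v rgF = (gadgetFinList L lo hi N).length ∧
      (gadgetPhase.exec p a).io 0 ≤ a.io 0 + Θ ∧
      (gadgetPhase.exec p a).io 4 ≤ a.io 4 + Θ ∧
      (gadgetPhase.exec p a).io 9 ≤ a.io 9 + (2 + 2 * (p.Z / p.B)) := by
  have hZ := d.hZ
  have hZW := d.Z_lt_W
  obtain ⟨Q, hQ1, hQ2, hQ3, ok1, b1, b2, b3⟩ := baseCmd_spec d r ok
  have hQ0 : 0 < Q := by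
    rcases Nat.eq_zero_or_pos Q with rfl | h
    · omega
    · exact h
  have hball : ∀ v, ball1 G v + ball2 G v ≤ 2 * n := by
    intro v
    have h1 : ball1 G v ≤ n := by
      classical exact (Finset.card_le_univ _).trans (Fintype.card_fin n).le
    have h2 : ball2 G v ≤ n := by
      classical exact (Finset.card_le_univ _).trans (Fintype.card_fin n).le
    omega
  refine ⟨Q, 5 * coreSize n Q + 1, fun v => ⟨(2 * n - (ball1 G v + ball2 G v)) % Q,
    Nat.mod_lt _ hQ0⟩, fun v => ⟨(2 * n - (ball1 G v + ball2 G v)) / Q,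
    Nat.div_lt_of_lt_mul (by omega)⟩, ?_⟩
  generalize hlo : (fun v => (⟨(2 * n - (ball1 G v + ball2 G v)) % Q, Nat.mod_lt _ hQ0⟩ : Fin Q)) = lo
  generalize hhi : (fun v => (⟨(2 * n - (ball1 G v + ball2 G v)) / Q,
    Nat.div_lt_of_lt_mul (by omega)⟩ : Fin Q)) = hi
  have hdig : ∀ v, 2 * n - (ball1 G v + ball2 G v) = (lo v : ℕ) + hi v * Q := by
    intro v
    rw [← hlo, ← hhi]
    exact (Nat.mod_add_div' _ _).symm
  clear hlo hhi
  have hcs : coreSize n Q ≤ 16 * n + 9 := by rw [coreSize]; omega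
  have hlen := (length_gadgetList_le (N := 5 * coreSize n Q + 1) lo hi L).2
  have hlen' : (gadgetFinList L lo hi (5 * coreSize n Q + 1)).length ≤
      6 * L.length + 271 * n + 147 := by
    rw [gadgetFinList, List.length_map]
    refine hlen.trans ?_
    rw [mul_add, Nat.mul_left_comm]
    omega
  refine ⟨fun v => by rw [← hdig v]; have := hball v; omega, by omega, by omega, hlen', ?_⟩
  rw [gadgetPhase, Cmd.exec_seq, Cmd.exec_seq, Cmd.exec_seq]
  have f1 := fun f hf => baseCmd.exec_frame_file p f a hf
  have i1 := fun f hf => (baseCmd.exec_frame_io p f a hf).1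
  have r1 := r.exec (p := p) baseCmd (by decide)
  generalize baseCmd.exec p a = b at *
  have r2 : Regs n L.length s D R ((Cmd.set rgPos 0).exec p b) := r1.exec _ (by decide)
  have hE : Emitted p ((Cmd.set rgPos 0).exec p b) [] ((Cmd.set rgPos 0).exec p b) := by
    refine ⟨by simp [Cmd.exec, ok1]; omega, by simp [Cmd.exec], ?_, Scan.refl _ _⟩
    intro i
    simp [Cmd.exec, f1 9 rfl, h9, flat]
  have hemit := emitGadget_emits (a₀ := (Cmd.set rgPos 0).exec p b) (Q := Q)
    (N := 5 * coreSize n Q + 1) d r2 (by omega) L rfl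
    (by simp [Cmd.exec, f1 0 rfl, h0]) (by simp [Cmd.exec, b1]) (by simp [Cmd.exec, b2]) lo hi (by
      intro v
      obtain ⟨h1, h2⟩ := h4 v
      simp only [Cmd.exec, setv_file, f1 4 rfl]
      exact ⟨h1, by rw [h2, hdig v]⟩) [] hE (by
      rw [List.nil_append, List.length_map]
      rw [gadgetFinList, List.length_map] at hlen'
      omega)
  have hio := emitGadget_io d r2
  have hv := emitGadget.exec_frame_v p rgV ((Cmd.set rgPos 0).exec p b) rfl
  rw [List.nil_append] at hemit
  obtain ⟨ok3, p3, f3, s3⟩ := hemit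
  have hlen2 : ((gadgetList L lo hi : List (Vtx n Q (5 * coreSize n Q + 1) × _)).map
      (Prod.map Vtx.code Vtx.code)).length = (gadgetFinList L lo hi (5 * coreSize n Q + 1)).length := by
    rw [gadgetFinList, List.length_map, List.length_map]
  rw [hlen2] at p3 s3
  generalize emitGadget.exec p ((Cmd.set rgPos 0).exec p b) = c at *
  refine ⟨?_, ?_, ?_, ?_, ?_, ?_, ?_⟩
  · simp [Cmd.exec, ok3, p3]; omega
  · intro i
    simp only [Cmd.exec, setv_file]
    rw [f3, words_eq_flat, gadgetFinList, List.map_map]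
    rfl
  · simp [Cmd.exec, hv, b3]
  · simp [Cmd.exec, p3]
  · have := hio.1
    simp only [Cmd.exec, setv_io, i1 0 rfl] at this ⊢
    omega
  · have := hio.2
    simp only [Cmd.exec, setv_io, i1 4 rfl] at this ⊢
    omega
  · have := (s3.mono (q' := p.Z) (by omega)).io_le
    simp only [Cmd.exec, setv_io, i1 9 rfl] at this ⊢
    omega

end gadgetPhase

/-! ### Checking one vertex -/

/-- Test whether the vertex in `rgOut` has distance at most three to all vertices. -/
def checkPhase : Cmd :=
  .ite (.lt (var rgOut) (var rgN)) (.write 5 (var rgOut) 1) .skip ;;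
  spread 5 6 ;; spread 6 7 ;; spread 7 8 ;; .set rgX 1 ;;
  .iter rgI rgN (.read rgY 8 (var rgI) ;; .ite (var rgY) .skip (.set rgX 0))

section checkPhase
variable {p : Par} {n m s D R : ℕ} {a : AState}

open Classical in
theorem checkPhase_spec {G : SimpleGraph (Fin n)} (d : Dims p n m s D R) (r : Regs n m s D R a)
    (ok : a.ok) (hn : 0 < n) {F : ℕ → ℕ} (hF : SortedKeys n s (R * D) (NearNat G) F)
    (h3 : ∀ i < R * D, a.file 3 i = F i ∧ F i < p.W)
    (hz : ∀ f, 5 ≤ f → f ≤ 8 → ∀ i, a.file f i = 0) {Θ : ℕ} (hΘ : Θ = 2 + 2 * (2 * s / p.B)) :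
    (checkPhase.exec p a).ok ∧
    (checkPhase.exec p a).v rgX =
      (if ∃ v : Fin n, (v : ℕ) = a.v rgOut ∧ ∀ u, Near3 G v u then 1 else 0) ∧
    (checkPhase.exec p a).io 3 ≤ a.io 3 + 3 * R * Θ ∧
    (checkPhase.exec p a).io 5 ≤ a.io 5 + (R + 1) * Θ ∧
    (checkPhase.exec p a).io 6 ≤ a.io 6 + 2 * R * Θ ∧
    (checkPhase.exec p a).io 7 ≤ a.io 7 + 2 * R * Θ ∧
    (checkPhase.exec p a).io 8 ≤ a.io 8 + (R + 1) * Θ := by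
  have hZ := d.two_s_lt
  have hZW := d.Z_lt_W
  have hs := d.hs
  have hFW : ∀ i < R * D, F i < p.W := fun i hi => (h3 i hi).2
  rw [checkPhase, Cmd.exec_seq, Cmd.exec_seq, Cmd.exec_seq, Cmd.exec_seq, Cmd.exec_seq]
  have f1 := fun f hf => (Cmd.ite (.lt (var rgOut) (var rgN)) (.write 5 (var rgOut) 1)
    .skip).exec_frame_file p f a hf
  have i1 := fun f hf => ((Cmd.ite (.lt (var rgOut) (var rgN)) (.write 5 (var rgOut) 1)
    .skip).exec_frame_io p f a hf).1
  have r1 := r.exec (p := p) (.ite (.lt (var rgOut) (var rgN)) (.write 5 (var rgOut) 1) .skip)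
    (by decide)
  have key : ((Cmd.ite (.lt (var rgOut) (var rgN)) (.write 5 (var rgOut) 1) .skip).exec p a).ok ∧
      (∀ w, ((Cmd.ite (.lt (var rgOut) (var rgN)) (.write 5 (var rgOut) 1) .skip).exec p a).file 5 w
        = if w < n ∧ w = a.v rgOut then 1 else 0) ∧
      ((Cmd.ite (.lt (var rgOut) (var rgN)) (.write 5 (var rgOut) 1) .skip).exec p a).io 5 ≤
        a.io 5 + Θ := by
    by_cases hlt : a.v rgOut < n
    · rw [Cmd.exec_ite_of_ne (by rw [Ne, AExpr.eval_lt_eq_zero, not_not]; simpa [r.N] using hlt)]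
      refine ⟨by simp [Cmd.exec, ok]; omega, ?_, ?_⟩
      · intro w
        simp only [Cmd.exec, AExpr.eval_var, AExpr.eval_ofNat, setFile_file, touch_file,
          Function.update_self]
        by_cases hw : w = a.v rgOut
        · rw [hw, Function.update_self, if_pos ⟨hlt, rfl⟩]
        · rw [Function.update_of_ne hw, if_neg (fun h => hw h.2), hz 5 le_rfl (by decide)]
      · have := ((Scan.refl (p := p) (f := 5) a 0).touch (i := a.v rgOut) (by omega)).mono
          (q' := 2 * s) (by omega)
        have := this.io_le
        simp only [Cmd.exec, AExpr.eval_var, setFile_io]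
        omega
    · rw [Cmd.exec_ite_of_eq (by rw [AExpr.eval_lt_eq_zero]; simpa [r.N] using hlt)]
      refine ⟨ok, fun w => ?_, Nat.le_add_right _ _⟩
      rw [if_neg (show ¬ (w < n ∧ w = a.v rgOut) from fun h => hlt (h.2 ▸ h.1))]
      exact hz 5 le_rfl (by decide) w
  obtain ⟨ok1, B1, I1⟩ := key
  generalize (Cmd.ite (.lt (var rgOut) (var rgN)) (.write 5 (var rgOut) 1) .skip).exec p a = b at *
  have B1' : ∀ w, b.file 5 w ≠ 0 ↔ w < n ∧ w = a.v rgOut := by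
    intro w; rw [B1]; split_ifs with h
    · exact iff_of_true one_ne_zero h
    · exact iff_of_false (by simp) h
  obtain ⟨ok2, B2, I23, I25, I26⟩ := spread_spec d r1 ok1 hF (f := 5) (g := 6) (by decide)
    (by decide) (by decide) NearNat.lt hFW (by rw [f1 3 rfl]; exact fun i hi => (h3 i hi).1)
    (by intro w; rw [B1]; split_ifs <;> omega) (fun w hw => ((B1' w).1 hw).1)
    (by rw [f1 6 rfl]; exact hz 6 (by decide) (by decide))
  have f2 := fun f hf => (spread 5 6).exec_frame_file p f b hf
  have i2 := fun f hf => ((spread 5 6).exec_frame_io p f b hf).1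
  have r2 := r1.exec (p := p) (spread 5 6) (by decide)
  generalize (spread 5 6).exec p b = c at *
  obtain ⟨ok3, B3, I33, I36, I37⟩ := spread_spec d r2 ok2 hF (f := 6) (g := 7) (by decide)
    (by decide) (by decide) NearNat.lt hFW
    (by rw [f2 3 rfl, f1 3 rfl]; exact fun i hi => (h3 i hi).1)
    (fun w => (B2 w).1) (fun w hw => by
      obtain ⟨w', h, -⟩ := (B2 w).2.1 hw
      exact h.1)
    (by rw [f2 7 rfl, f1 7 rfl]; exact hz 7 (by decide) (by decide))
  have f3 := fun f hf => (spread 6 7).exec_frame_file p f c hf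
  have i3 := fun f hf => ((spread 6 7).exec_frame_io p f c hf).1
  have r3 := r2.exec (p := p) (spread 6 7) (by decide)
  generalize (spread 6 7).exec p c = e at *
  obtain ⟨ok4, B4, I43, I47, I48⟩ := spread_spec d r3 ok3 hF (f := 7) (g := 8) (by decide)
    (by decide) (by decide) NearNat.lt hFW
    (by rw [f3 3 rfl, f2 3 rfl, f1 3 rfl]; exact fun i hi => (h3 i hi).1)
    (fun w => (B3 w).1) (fun w hw => by
      obtain ⟨w', h, -⟩ := (B3 w).2.1 hw
      exact h.1)
    (by rw [f3 8 rfl, f2 8 rfl, f1 8 rfl]; exact hz 8 (by decide) (by decide))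
  have i4 := fun f hf => ((spread 7 8).exec_frame_io p f e hf).1
  have r4 := r3.exec (p := p) (spread 7 8) (by decide)
  generalize (spread 7 8).exec p e = g at *
  have r5 : Regs n m s D R ((Cmd.set rgX 1).exec p g) := r4.exec _ (by decide)
  have hnear : ∀ u : Fin n, g.file 8 u ≠ 0 ↔ ∃ v : Fin n, (v : ℕ) = a.v rgOut ∧ Near3 G v u := by
    intro u
    rw [(B4 u).2]
    constructor
    · rintro ⟨w, h1, h2⟩
      obtain ⟨x, h3, h4⟩ := (B3 w).2.1 h2
      obtain ⟨v, h5, h6⟩ := (B2 x).2.1 h4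
      obtain ⟨h7, h8⟩ := (B1' v).1 h6
      exact ⟨⟨v, h7⟩, h8, ⟨w, h1.2.1⟩, ⟨⟨x, h3.2.1⟩, h5.2.2.symm, h3.2.2.symm⟩, h1.2.2.symm⟩
    · rintro ⟨v, h1, w, ⟨x, h2, h3⟩, h4⟩
      exact ⟨w, nearNat_val.2 h4.symm, (B3 w).2.2 ⟨x, nearNat_val.2 h3.symm,
        (B2 x).2.2 ⟨v, nearNat_val.2 h2.symm, (B1' v).2 ⟨v.2, h1⟩⟩⟩⟩
  have i5 : ∀ f, ((Cmd.set rgX 1).exec p g).io f = g.io f := fun _ => rfl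
  have f5 : ((Cmd.set rgX 1).exec p g).file = g.file := rfl
  have ok5 : ((Cmd.set rgX 1).exec p g).ok := by simp [Cmd.exec, ok4]; omega
  have x5 : ((Cmd.set rgX 1).exec p g).v rgX = 1 := by simp [Cmd.exec]
  generalize (Cmd.set rgX 1).exec p g = h at *
  have i6 := fun f hf => ((Cmd.iter rgI rgN (.read rgY 8 (var rgI) ;;
    .ite (var rgY) .skip (.set rgX 0))).exec_frame_io p f h hf).1
  obtain ⟨t, ⟨A1, A2⟩, ok6, e6⟩ := exec_for_frame p (x := rgI) (y := rgN)
    (c := .read rgY 8 (var rgI) ;; .ite (var rgY) .skip (.set rgX 0)) (a := h)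
    (fun i t => t.v rgX = (if ∀ u < i, g.file 8 u ≠ 0 then 1 else 0) ∧ Scan p 8 h i t)
    r5.N (by omega) ⟨by simp [x5], Scan.refl _ _⟩ ok5 (by
      rintro i t hi hiW Fr hok ⟨A1, A2⟩
      have e8 := (Fr.file 8 rfl).trans (congrFun f5 8)
      have b8 := (B4 i).1
      rw [Cmd.exec_seq]
      generalize hu : (Cmd.read rgY 8 (var rgI)).exec p (t.setv p rgI i) = u
      have uok : u.ok := by rw [← hu]; simp [Cmd.exec, hok, e8, b8]; omega
      have uy : u.v rgY = g.file 8 i := by rw [← hu]; simp [Cmd.exec, e8]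
      have ux : u.v rgX = t.v rgX := by rw [← hu]; simp [Cmd.exec]
      have us : Scan p 8 h (i + 1) u := by
        rw [← hu]; simp [Cmd.exec]; exact ((A2.touch le_rfl).mono (by omega)).congr rfl rfl
      by_cases hy : g.file 8 i = 0
      · rw [Cmd.exec_ite_of_eq (by simp [uy, hy])]
        refine ⟨⟨?_, us⟩, by simp [Cmd.exec, uok]; omega⟩
        rw [if_neg (fun hc => hc i (by omega) hy)]
        simp [Cmd.exec]
      · rw [Cmd.exec_ite_of_ne (by simp [uy, hy]), Cmd.exec, ux, A1]
        refine ⟨⟨?_, us⟩, uok⟩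
        congr 1
        refine propext ⟨fun hc w hw => ?_, fun hc w hw => hc w (by omega)⟩
        rcases Nat.lt_succ_iff_lt_or_eq.1 hw with hw | rfl
        · exact hc w hw
        · exact hy)
  rw [e6] at ok6 i6 ⊢
  refine ⟨ok6, ?_, ?_, ?_, ?_, ?_, ?_⟩
  · simp only [setv_v]
    rw [Function.update_of_ne (by decide), A1]
    congr 1
    refine propext ⟨fun hc => ?_, ?_⟩
    · obtain ⟨v, hv, -⟩ := (hnear ⟨0, hn⟩).1 (hc 0 hn)
      refine ⟨v, hv, fun u => ?_⟩
      obtain ⟨v', hv', h⟩ := (hnear u).1 (hc u u.2)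
      obtain rfl : v' = v := Fin.ext (hv'.trans hv.symm)
      exact h
    · rintro ⟨v, hv, hc⟩ u hu
      exact (hnear ⟨u, hu⟩).2 ⟨v, hv, hc _⟩
  all_goals simp only [← hΘ] at I23 I25 I26 I33 I36 I37 I43 I47 I48
  · rw [i6 3 rfl, i5]
    rw [i1 3 rfl] at I23
    linarith
  · rw [i6 5 rfl, i5, i4 5 rfl, i3 5 rfl]
    linarith
  · rw [i6 6 rfl, i5, i4 6 rfl]
    rw [i1 6 rfl] at I26
    linarith
  · rw [i6 7 rfl, i5]
    rw [i2 7 rfl, i1 7 rfl] at I37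
    linarith
  · have := (A2.mono (q' := 2 * s) (by omega)).io_le
    rw [i5] at this
    rw [i3 8 rfl, i2 8 rfl, i1 8 rfl] at I48
    simp only [setv_io]
    have h9 : t.io 8 ≤ g.io 8 + Θ := by omega
    linarith

end checkPhase

/-! ### The reduction -/

theorem Run.mono {B S S' W W' : ℕ} {P : Prog} {σ τ : State} {k : ℕ} (h : Run B S W P σ k τ)
    (hS : S ≤ S') (hW : W ≤ W') : Run B S' W' P σ k τ := by
  induction h with
  | skip σ => exact .skip σ
  | assign a e σ ha he => exact .assign a e σ (ha.trans_le hS) (he.trans_le hW)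
  | readLine p l σ hp hl => exact .readLine p l σ (hp.trans hS) (hl.trans_le hW)
  | writeLine p l σ hp hl => exact .writeLine p l σ (hp.trans hS) (hl.trans_le hW)
  | seq _ _ ih₁ ih₂ => exact .seq ih₁ ih₂
  | condTrue he _ ih => exact .condTrue he ih
  | condFalse he _ ih => exact .condFalse he ih
  | loopTrue he _ _ ih₁ ih₂ => exact .loopTrue he ih₁ ih₂
  | loopFalse he => exact .loopFalse he

/-- Decide whether the radius is at most three, given a program `P` for graph median, for graphs with
at least one vertex. -/
def radiusProgPos (P : Prog) : Prog :=
  .seq setup (.seq (countPhase ;; gadgetPhase).compile (.seq (call P rgOut rgV rgF)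
    (.seq checkPhase.compile (.assign (.const 0) (.cell (.const (32 + rgX)))))))

/-- Decide whether the radius is at most three, given a program `P` for graph median.  Graphs with
too few edges to be connected and graphs without edges are treated separately; for the remaining
ones, the gadget graph is larger by a constant factor only. -/
def radiusProg (P : Prog) : Prog :=
  .cond (.sub (.cell (.const 0)) (.add (.cell (.const 1)) (.const 1))) (.assign (.const 0) (.const 0))
    (.cond (.cell (.const 0))
      (.cond (.cell (.const 1)) (radiusProgPos P) (.assign (.const 0) (.const 1)))
      (.assign (.const 0) (.const 0)))

open Classical in
theorem radiusProgPos_run {n : ℕ} {G : SimpleGraph (Fin n)} {L : List (Fin n × Fin n)}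
    (hL : IsEdgeList G L) (hn : 1 ≤ n) {p : Par} (hB : 0 < p.B) (hBM : p.B ≤ p.M)
    (hZ : p.Z = 1000 * (n + L.length + 1)) (hW : p.Z * p.Z ≤ p.W) (hWM : 64 + 12 * p.M < p.W)
    {S S₀ W₀ κ : ℕ} (hS : S₀ + (64 + 12 * p.M) ≤ S) (hS4 : 4 ≤ S₀) (hW₀ : W₀ + 9 * p.Z ≤ p.W)
    {P : Prog}
    (hP : ∀ (n' : ℕ) (G' : SimpleGraph (Fin n')) (L' : List (Fin n' × Fin n')), G'.Connected →
      IsEdgeList G' L' → n ≤ n' → n' ≤ 256 * n + 147 → L.length ≤ L'.length →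
      L'.length ≤ 6 * L.length + 271 * n + 147 →
      ∃ k τ, Run p.B S₀ W₀ P (initState L' p.M p.B) k τ ∧ k ≤ κ ∧
        ∃ v : Fin n', (v : ℕ) = τ.cache 0 ∧
          ∀ w : Fin n', ∑ u : Fin n', G'.dist v u ≤ ∑ u : Fin n', G'.dist w u)
    {s D R Θ : ℕ} (hs : s = 2 * L.length + 2 * n) (hD : D = min p.M s) (hR : R = s / D + 1)
    (hΘ : Θ = 2 + 2 * (2 * s / p.B)) :
    ∃ k τ, Run p.B S p.W (radiusProgPos P) (initState L p.M p.B) k τ ∧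
      k ≤ κ + (18 * R + 7) * Θ + 4 + 2 * (p.Z / p.B) ∧
      τ.cache 0 = if G.radius ≤ 3 then 1 else 0 := by
  have hW10 : 10 * p.Z ≤ p.W := le_trans (Nat.mul_le_mul_right _ (by omega)) hW
  obtain ⟨σ₁, run₁, rep₁⟩ := setup_run L hZ hB hBM (S := S) (by omega) hW10 hWM
  obtain ⟨d, ok₂, r₂, ⟨F, hF, h3⟩, h4, i0, i1, i2, i3, i4⟩ := countPhase_spec (p := p) hL hn
    (by omega) hZ hW (by omega) hs hD hR hΘ rfl
  have f2 := fun f hf => countPhase.exec_frame_file p f (startState L p.M) hf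
  have j2 := fun f hf => (countPhase.exec_frame_io p f (startState L p.M) hf).1
  obtain ⟨Q, N, lo, hi, hdig, hN, hsz, hlen, ok₃, f9, v3, e3, g0, g4, g9⟩ := gadgetPhase_spec d r₂
    ok₂ (by intro i; rw [f2 0 rfl]; rfl) h4 (by intro i; rw [f2 9 rfl]; rfl) hΘ
  obtain ⟨k₃, σ₃, run₃, rep₃, t₃⟩ := Rep.compile le_rfl hB hBM (S := S) (by omega) hW10
    (countPhase ;; gadgetPhase) rfl _ _ rep₁ ok₃
  rw [Cmd.exec_seq] at rep₃ t₃
  have r₃ := r₂.exec (p := p) gadgetPhase (by decide)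
  have f3 := fun f hf => gadgetPhase.exec_frame_file p f (countPhase.exec p (startState L p.M)) hf
  have j3 := fun f hf =>
    (gadgetPhase.exec_frame_io p f (countPhase.exec p (startState L p.M)) hf).1
  have hZ1 := d.two_s_lt
  have hle : n ≤ coreSize n Q + 3 * N := by rw [coreSize]; omega
  obtain ⟨k₄, τ₄, run₄, hk₄, z, hz, hmed⟩ := hP _ (gadgetFin G lo hi N) (gadgetFinList L lo hi N)
    (gadgetFin_connected lo hi ⟨0, hn⟩) (gadgetFin_isEdgeList lo hi hL) hle hsz (by
      rw [gadgetFinList, List.length_map]; exact (length_gadgetList_le lo hi L).1) hlen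
  have hzW : τ₄.cache 0 < p.W := by have := z.2; omega
  have hfile : ∀ f, 5 ≤ f → f ≤ 8 → ∀ i,
      (gadgetPhase.exec p (countPhase.exec p (startState L p.M))).file f i = 0 := by
    intro f h5 h8 i
    interval_cases f <;> (rw [f3 _ rfl, f2 _ rfl]; rfl)
  have h3' : ∀ i < R * D, (gadgetPhase.exec p (countPhase.exec p (startState L p.M))).file 3 i = F i ∧
      F i < p.W := by rw [f3 3 rfl]; exact h3
  have hio : (gadgetPhase.exec p (countPhase.exec p (startState L p.M))).total 10 ≤
      (9 * R + 5) * Θ + 2 + 2 * (p.Z / p.B) := by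
    simp only [AState.total, Finset.sum_range_succ, Finset.sum_range_zero]
    rw [j3 1 rfl, j3 2 rfl, j3 3 rfl, j3 5 rfl, j3 6 rfl, j3 7 rfl, j3 8 rfl]
    rw [j2 5 rfl, j2 6 rfl, j2 7 rfl, j2 8 rfl]
    rw [j2 9 rfl] at g9
    have start : ∀ f, (startState L p.M).io f = 0 := fun _ => rfl
    rw [start] at g9
    simp only [start]
    linarith
  generalize gadgetPhase.exec p (countPhase.exec p (startState L p.M)) = b at *
  obtain ⟨h, g, σ₄, run₅, rep₄⟩ := call_run rep₃ hB hBM hS hS4 hW₀ hW10 (by omega) (x := rgOut)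
    (y := rgV) (z := rgF) (by decide) (by decide) (by decide) (gadgetFinList L lo hi N) (by omega)
    (by omega) f9 v3 e3 run₄ hzW
  obtain ⟨ok₅, hx, c3, c5, c6, c7, c8⟩ := checkPhase_spec (G := G) (a := b.setv p rgOut (τ₄.cache 0))
    d (r₃.setv (by decide)) ⟨ok₃, hzW⟩ hn hF h3' hfile hΘ
  obtain ⟨k₅, σ₅, run₆, rep₅, t₅⟩ := Rep.compile (by decide) hB hBM (S := S) (by omega) hW10
    checkPhase rfl _ _ rep₄ ok₅
  have j5 := fun f hf => (checkPhase.exec_frame_io p f (b.setv p rgOut (τ₄.cache 0)) hf).1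
  have hout : σ₅.cache (32 + rgX) = if G.radius ≤ 3 then 1 else 0 := by
    rw [rep₅.v _ (by decide), hx]
    congr 1
    rw [radius_le_three_iff_of_median lo hi hdig hN hmed, hz]
    simp
  refine ⟨_, _, run₁.seq (run₃.seq (run₅.seq (run₆.seq (.assign _ _ _ ?_ ?_)))), ?_, ?_⟩
  · simp only [Expr.eval]; omega
  · simp only [Expr.eval]; rw [hout]; split_ifs <;> omega
  · have e1 : (startState L p.M).total 10 = 0 := by simp [AState.total, startState]
    have e2 : k₅ ≤ (9 * R + 2) * Θ := by
      simp only [AState.total, Finset.sum_range_succ, Finset.sum_range_zero] at t₅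
      rw [j5 0 rfl, j5 1 rfl, j5 2 rfl, j5 4 rfl] at t₅
      linarith
    linarith
  · simp only [Expr.eval, Function.update_self]
    exact hout

/-! ### The number of I/Os -/

/-- The cost of block-nested loops over `s = 2 * m + 2 * n` words. -/
theorem blocks_mul_lines_le {n m M B K s D R Θ : ℕ} (hB : 1 ≤ B) (hBM : B ≤ M) (hm : 1 ≤ m)
    (hnm : n ≤ m + 1) (hK : m ≤ K * n) (hs : s = 2 * m + 2 * n) (hD : D = min M s)
    (hR : R = s / D + 1) (hΘ : Θ = 2 + 2 * (2 * s / B)) :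
    (R * Θ : ℝ) ≤ 4 + 48 * (m / B) + 432 * K ^ 2 * (n ^ 2 / (M * B)) := by
  have hB' : (1 : ℝ) ≤ B := by exact_mod_cast hB
  have hM' : (B : ℝ) ≤ M := by exact_mod_cast hBM
  have hM0 : (0 : ℝ) < M := by linarith
  have hs6 : (s : ℝ) ≤ 6 * m := by
    have : s ≤ 6 * m := by omega
    exact_mod_cast this
  have hx : (0 : ℝ) ≤ m / B := by positivity
  have hΘ' : (Θ : ℝ) ≤ 2 + 24 * (m / B) := by
    have h1 : ((2 * s / B : ℕ) : ℝ) ≤ 2 * s / B := by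
      exact_mod_cast (Nat.cast_div_le (α := ℝ) (m := 2 * s) (n := B))
    have h2 : (2 * s / B : ℝ) ≤ 12 * (m / B) := by
      rw [← mul_div_assoc]
      exact div_le_div_of_nonneg_right (by linarith) (by linarith)
    rw [hΘ]; push_cast; linarith
  rcases le_or_gt s M with h | h
  · have hR2 : R = 2 := by
      rw [hR, hD, min_eq_right h, Nat.div_self (by omega)]
    rw [hR2]
    have : (0 : ℝ) ≤ 432 * K ^ 2 * (n ^ 2 / (M * B)) := by positivity
    push_cast
    linarith
  · have hMs : (M : ℝ) ≤ s := by exact_mod_cast h.le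
    have hR' : (R : ℝ) ≤ 12 * m / M := by
      have h1 : ((s / M : ℕ) : ℝ) ≤ s / M := Nat.cast_div_le
      have h2 : (1 : ℝ) ≤ s / M := (one_le_div hM0).2 hMs
      have h3 : (s / M : ℝ) ≤ 6 * m / M := by gcongr
      rw [hR, hD, min_eq_left h.le]
      push_cast
      rw [show (12 * m / M : ℝ) = 6 * m / M + 6 * m / M by ring]
      linarith
    have hΘ'' : (Θ : ℝ) ≤ 36 * m / B := by
      have : (1 : ℝ) ≤ 6 * (m / B) := by
        rw [← mul_div_assoc, one_le_div (by linarith)]; linarith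
      rw [mul_div_assoc]
      linarith
    have hKn : (m : ℝ) ≤ K * n := by exact_mod_cast hK
    calc (R * Θ : ℝ) ≤ (12 * m / M) * (36 * m / B) := by gcongr
      _ = 432 * m ^ 2 / (M * B) := by rw [div_mul_div_comm]; ring
      _ ≤ 432 * (K * n) ^ 2 / (M * B) := by gcongr
      _ = 432 * K ^ 2 * (n ^ 2 / (M * B)) := by ring
      _ ≤ _ := by linarith

theorem div_le_one_add_mul_log_div {m B : ℕ} (hB : 1 ≤ B) (hm : 1 ≤ m) :
    (m / B : ℝ) ≤ 1 + 2 * (m * Real.log m / B) := by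
  have hB' : (1 : ℝ) ≤ B := by exact_mod_cast hB
  rcases hm.eq_or_lt with rfl | h
  · simp only [Nat.cast_one, Real.log_one, mul_zero, zero_div, add_zero]
    exact div_le_one_of_le₀ hB' (by linarith)
  · have h1 : Real.log 2 ≤ Real.log m := Real.log_le_log (by norm_num) (by exact_mod_cast h)
    have h2 := Real.log_two_gt_d9
    have h3 : (m / B : ℝ) ≤ 2 * (m * Real.log m / B) := by
      rw [← mul_div_assoc]
      gcongr
      have : (0 : ℝ) ≤ m := by positivity
      nlinarith
    linarith

/-- Word lengths: the values that occur are bounded by powers of `n + m + M + 2`. -/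
theorem word_bounds {n m M c : ℕ} (hn : 1 ≤ n) (hm : 1 ≤ m) (hM : 1 ≤ M) {Z W : ℕ}
    (hZ : Z = 1000 * (n + m + 1)) (hW : (n + m + M + 2) ^ (6 * c + 12) ≤ W) :
    Z * Z ≤ W ∧ 64 + 12 * M < W ∧ (527 * (n + m + M + 2)) ^ c + 9 * Z ≤ W := by
  generalize hq : n + m + M + 2 = q at *
  have hq5 : 5 ≤ q := by omega
  have h5 : 5 ^ 5 ≤ q ^ 5 := Nat.pow_le_pow_left hq5 5
  have hZq : Z ≤ q ^ 6 := by
    have : 1000 * q ≤ q ^ 5 * q := Nat.mul_le_mul_right _ (by omega)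
    rw [pow_succ]; omega
  have h12 : q ^ 12 ≤ q ^ (6 * c + 12) := Nat.pow_le_pow_right (by omega) (by omega)
  refine ⟨?_, ?_, ?_⟩
  · calc Z * Z ≤ q ^ 6 * q ^ 6 := Nat.mul_le_mul hZq hZq
      _ = q ^ 12 := by ring
      _ ≤ W := h12.trans hW
  · have h6 : q ^ 6 ≤ q ^ 12 := Nat.pow_le_pow_right (by omega) (by omega)
    have h7 : 3125 * q ≤ q ^ 6 := by
      rw [pow_succ]; exact Nat.mul_le_mul_right _ (by omega)
    omega
  · have h1 : (527 * q) ^ c ≤ q ^ (6 * c) := by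
      rw [pow_mul]
      refine Nat.pow_le_pow_left ?_ c
      have : 527 * q ≤ q ^ 5 * q := Nat.mul_le_mul_right _ (by omega)
      rwa [pow_succ]
    have h2 : 9 * Z ≤ q ^ 11 := by
      have : 9 * q ^ 6 ≤ q ^ 5 * q ^ 6 := Nat.mul_le_mul_right _ (by omega)
      rw [show q ^ 11 = q ^ 5 * q ^ 6 by ring]
      omega
    have h3 : q ^ (6 * c) ≤ q ^ (6 * c + 11) := Nat.pow_le_pow_right (by omega) (by omega)
    have h4 : q ^ 11 ≤ q ^ (6 * c + 11) := Nat.pow_le_pow_right (by omega) (by omega)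
    have h6 : q ^ (6 * c + 11) * 2 ≤ q ^ (6 * c + 12) := by
      rw [pow_succ q (6 * c + 11)]
      exact Nat.mul_le_mul_left _ (by omega)
    omega

end ExtMem

theorem mainTheorem6 (T : ℕ → ℕ → ℕ → ℕ → ℝ)
    (hT_one : ∀ n m M B : ℕ, 1 ≤ B → B ≤ M → 1 ≤ T n m M B)
    (hT_scale : ∀ a : ℕ, ∃ C : ℝ, ∀ n m n' m' M B : ℕ, 1 ≤ B → B ≤ M →
      n ≤ n' → n' ≤ a * n → m ≤ m' → m' ≤ a * m → T n' m' M B ≤ C * T n m M B)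
    (hMedian : ExtMem.MedianSolvableIn T) (K : ℕ) :
    ExtMem.SparseRadiusSolvableIn K (fun n m M B =>
      T n m M B + (n : ℝ) ^ 2 / ((M : ℝ) * (B : ℝ)) + (m : ℝ) * Real.log (m : ℝ) / (B : ℝ)) := by
  classical
  obtain ⟨P, c₀, hP⟩ := hMedian
  -- the gadget graph has at most `256 * n + 147` vertices and `6 * m + 271 * n + 147` edges
  obtain ⟨C, hC⟩ := hT_scale 1000
  -- `7 * c₀` and the first summand make room for the words, the cache and the additive constants
  obtain ⟨c, hc⟩ : ∃ c, c = 30000 + 10800 * K ^ 2 + 7 * c₀ + c₀ * ⌈C⌉₊ := ⟨_, rfl⟩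
  have hc' : (c : ℝ) = 30000 + 10800 * K ^ 2 + 7 * c₀ + c₀ * ⌈C⌉₊ := by rw [hc]; push_cast; ring
  refine ⟨ExtMem.radiusProg P, c, ?_⟩
  intro M B hB hBM n G L hK hL
  have hK : G.edgeSet.ncard ≤ K * n := hK
  rw [hL.ncard] at hK ⊢
  set m := L.length with hm
  have hT := hT_one n m M B hB hBM
  have hy : (0 : ℝ) ≤ (n : ℝ) ^ 2 / ((M : ℝ) * (B : ℝ)) := by positivity
  have hu : (0 : ℝ) ≤ (m : ℝ) * Real.log (m : ℝ) / (B : ℝ) :=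
    div_nonneg (mul_nonneg (Nat.cast_nonneg _) (Real.log_natCast_nonneg _)) (Nat.cast_nonneg _)
  have hS : 1 ≤ c * M := Nat.mul_pos (by omega) (by omega)
  have hW : 2 ≤ (n + m + M + 2) ^ c :=
    le_trans (by omega : 2 ≤ n + m + M + 2) (Nat.le_self_pow (by omega) _)
  have c0 : (ExtMem.initState L M B).cache 0 = n := rfl
  have c1 : (ExtMem.initState L M B).cache 1 = m := rfl
  have triv : (0 : ℕ) ≤ (c : ℝ) * (T n m M B + (n : ℝ) ^ 2 / ((M : ℝ) * (B : ℝ)) +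
      (m : ℝ) * Real.log (m : ℝ) / (B : ℝ)) := by
    rw [Nat.cast_zero]; exact mul_nonneg (Nat.cast_nonneg _) (by linarith)
  have out : ∀ w < 2, ExtMem.Run B (c * M) ((n + m + M + 2) ^ c) (.assign (.const 0) (.const w))
      (ExtMem.initState L M B) 0 ⟨Function.update (ExtMem.initState L M B).cache 0 w,
        (ExtMem.initState L M B).mem⟩ :=
    fun w hw => .assign (.const 0) (.const w) _ hS (hw.trans_le hW)
  -- too few edges for a connected graph
  by_cases hdisc : m + 1 < n
  · refine ⟨0, _, .condTrue ?_ (out 0 (by decide)), triv, Or.inr ⟨fun hr => ?_, by simp⟩⟩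
    · simp only [ExtMem.Expr.eval, c0, c1]; omega
    · obtain ⟨v, hv⟩ := ExtMem.radius_le_three_iff.1 hr
      have hreach : ∀ u, G.Reachable v u := fun u => SimpleGraph.edist_ne_top_iff_reachable.1
        (ne_top_of_le_ne_top (by decide) (ExtMem.near3_iff_edist_le.1 (hv u)))
      have hconn : G.Connected := SimpleGraph.connected_iff_exists_forall_reachable G |>.2 ⟨v, hreach⟩
      have := hconn.card_vert_le_card_edgeSet_add_one
      rw [Nat.card_eq_fintype_card, Fintype.card_fin] at this
      have e : Nat.card G.edgeSet = m := hL.ncard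
      omega
  have hcond : (ExtMem.Expr.sub (.cell (.const 0)) (.add (.cell (.const 1)) (.const 1))).eval
      (ExtMem.initState L M B).cache = 0 := by
    simp only [ExtMem.Expr.eval, c0, c1]; omega
  by_cases hn : n = 0
  · refine ⟨0, _, .condFalse hcond (.condFalse (c0.trans hn) (out 0 (by decide))), triv,
      Or.inr ⟨fun hr => ?_, by simp⟩⟩
    obtain ⟨v, -⟩ := ExtMem.radius_le_three_iff.1 hr
    exact absurd v.2 (by omega)
  -- a single vertex
  by_cases hm0 : m = 0
  · refine ⟨0, _, .condFalse hcond (.condTrue (c0.trans_ne hn) (.condFalse (c1.trans hm0)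
      (out 1 (by decide)))), triv, Or.inl ⟨ExtMem.radius_le_three_iff.2 ⟨⟨0, by omega⟩, fun u => ?_⟩,
        by simp⟩⟩
    obtain rfl : u = ⟨0, by omega⟩ := Fin.ext (by have := u.2; simp only; omega)
    exact ⟨_, ⟨_, Or.inl rfl, Or.inl rfl⟩, Or.inl rfl⟩
  -- from here on, `n ≤ m + 1 ≤ 2 * m`
  obtain ⟨hW1, hW2, hW3⟩ := ExtMem.word_bounds (c := c₀) (n := n) (m := m) (M := M) (by omega)
    (by omega) (by omega) rfl
    (Nat.pow_le_pow_right (by omega : 0 < n + m + M + 2) (by omega : 6 * c₀ + 12 ≤ c))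
  obtain ⟨k, τ, hrun, hk, hout⟩ := ExtMem.radiusProgPos_run hL (by omega)
    (p := ⟨M, B, 1000 * (n + m + 1), (n + m + M + 2) ^ c⟩) hB hBM rfl hW1 hW2 (S := c * M)
    (S₀ := c₀ * M + 4) (W₀ := (527 * (n + m + M + 2)) ^ c₀)
    (κ := ⌊c₀ * ⌈C⌉₊ * T n m M B⌋₊) (P := P) (by
      have h1 : (c₀ + 80) * M ≤ c * M := Nat.mul_le_mul_right _ (by omega)
      rw [add_mul] at h1
      simp only
      omega) (by omega) hW3 (by
      intro n' G' L' hG' hL' h1 h2 h3 h4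
      obtain ⟨k, τ, hrun, hk, hout⟩ := hP M B hB hBM n' G' L' hG' hL'
      rw [hL'.ncard] at hrun hk
      refine ⟨k, τ, hrun.mono (by simp) (Nat.pow_le_pow_left (by omega) _), Nat.le_floor ?_, hout⟩
      have h5 := hC n m n' L'.length M B hB hBM h1 (by omega) h3 (by omega)
      calc (k : ℝ) ≤ c₀ * T n' L'.length M B := hk
        _ ≤ c₀ * (⌈C⌉₊ * T n m M B) := by
          gcongr
          exact h5.trans (mul_le_mul_of_nonneg_right (Nat.le_ceil C) (by linarith))
        _ = _ := by ring) rfl rfl rfl rfl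
  refine ⟨k, τ, .condFalse hcond (.condTrue (c0.trans_ne hn) (.condTrue (c1.trans_ne hm0) hrun)),
    ?_, ?_⟩
  · simp only at hk ⊢
    have h1 := ExtMem.blocks_mul_lines_le hB hBM (by omega) (by omega : n ≤ m + 1) hK rfl rfl rfl rfl
    have h2 := ExtMem.div_le_one_add_mul_log_div hB (by omega : 1 ≤ m)
    generalize 2 + 2 * (2 * (2 * m + 2 * n) / B) = Θ at *
    generalize hR : (2 * m + 2 * n) / min M (2 * m + 2 * n) + 1 = R at *
    have hR1 : 1 ≤ R := by rw [← hR]; exact Nat.le_add_left _ _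
    have h3 : (18 * R + 7) * Θ ≤ 25 * (R * Θ) := by
      rw [← mul_assoc]; exact Nat.mul_le_mul_right _ (by omega)
    have h4 : ((1000 * (n + m + 1) / B : ℕ) : ℝ) ≤ 4000 * (m / B) := by
      refine Nat.cast_div_le.trans ?_
      rw [← mul_div_assoc]
      gcongr
      have h0 : n + m + 1 ≤ 4 * m := by omega
      have h0' : (n : ℝ) + m + 1 ≤ 4 * m := by exact_mod_cast h0
      push_cast
      linarith
    have h5 : ((⌊c₀ * ⌈C⌉₊ * T n m M B⌋₊ : ℕ) : ℝ) ≤ c₀ * ⌈C⌉₊ * T n m M B :=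
      Nat.floor_le (by positivity)
    generalize ⌊c₀ * ⌈C⌉₊ * T n m M B⌋₊ = κ at *
    generalize 1000 * (n + m + 1) / B = z at *
    have h6 : (k : ℝ) ≤ κ + 25 * (R * Θ) + 4 + 2 * z := by
      exact_mod_cast hk.trans (by omega)
    have h7 : (k : ℝ) ≤ c₀ * ⌈C⌉₊ * T n m M B + 10800 * K ^ 2 * ((n : ℝ) ^ 2 / (M * B)) +
        18400 * (m * Real.log m / B) + 9304 := by linarith
    generalize (n : ℝ) ^ 2 / ((M : ℝ) * (B : ℝ)) = y at *
    generalize (m : ℝ) * Real.log (m : ℝ) / (B : ℝ) = u at *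
    generalize T n m M B = t at *
    have e0 : (0 : ℝ) ≤ (K : ℝ) ^ 2 := by positivity
    have e1 : (0 : ℝ) ≤ c₀ := by positivity
    have e2 : (0 : ℝ) ≤ (c₀ : ℝ) * ⌈C⌉₊ := by positivity
    have g1 : ((c₀ : ℝ) * ⌈C⌉₊ + 9304) * t ≤ c * t :=
      mul_le_mul_of_nonneg_right (by linarith) (by linarith)
    have g2 : 10800 * (K : ℝ) ^ 2 * y ≤ c * y := mul_le_mul_of_nonneg_right (by linarith) hy
    have g3 : 18400 * u ≤ c * u := mul_le_mul_of_nonneg_right (by linarith) hu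
    linarith
  · by_cases hr : G.radius ≤ 3
    · exact Or.inl ⟨hr, by rw [hout, if_pos hr]⟩
    · exact Or.inr ⟨hr, by rw [hout, if_neg hr]⟩
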